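/- **Setting.** Let $I\subset\mathbb N$ be finite and non-empty, $S_I=\{x\in\mathbb R^I:\sum_i x_i^2=1\}$, and let $G$ be a finite-dimensional (Hausdorff) Lie group with a right-invariant Riemannian metric $\langle\cdot,\cdot\rangle_G$. On $S_I\times G^I$ consider the (possibly degenerate) warped metric $$g=\sum_{i\in I}dx_i^2+\sum_{i\in I}x_i^2\,\langle\cdot,\cdot\rangle_G^{(i)},$$ and the product metric $g_0=\sum_i dx_i^2+\sum_i\langle\cdot,\cdot\rangle_G^{(i)}$. Let $\mathcal K=\ker g$, $\mathcal H=T/\mathcal K$, with the induced form $\bar g$. Let $U\subset S_I\times G^I$ be open such that over $U$ the family $\mathcal H$ is of finite, locally constant rank and $\bar g$ is strongly non-degenerate, i.e. $v\mapsto\bar g(v,\cdot)$ is an isomorphism $\mathcal H_p\to\mathcal H_p^*$ for all $p \in U$, with inverse $\sharp$. (When $\dim G\ge1$ and $|I|\ge2$, this means that no $x_i$ vanishes on $U$.) A smooth $k$-form $\omega$ on $U$ is horizontal if $\iota_v\omega=0$ for all $v\in\mathcal K$; $\Omega^k_{\rm hor}(U)$ is the space of these. Horizontal forms are paired pointwise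 by $\langle\alpha,\beta\rangle=\bar g(\sharp\alpha,\sharp\beta)$ on one-forms and by $\det(\langle\alpha_i,\beta_j\rangle)$ on $\alpha_1\wedge\dots\wedge\alpha_k$ and $\beta_1\wedge\dots\wedge\beta_k$. Fix a smooth positive density $\mu=\rho\,\mathrm{vol}_g$, with $\rho\in C^\infty(U)$, $\rho>0$. Two linear operators $D$, $D'$ between spaces of forms are formally adjoint if $\int\langle D\alpha,\beta\rangle\,d\mu=\int\langle\alpha,D'\beta\rangle\,d\mu$ for all $\alpha,\beta$ of which at least one has compact support. **Proposition.** 1. The exterior derivative maps $\Omega^k_{\rm hor}(U)$ to $\Omega^{k+1}_{\rm hor}(U)$, and for every $k$ it has exactly one formal adjoint $\delta:\Omega^{k+1}_{\rm hor}(U)\to\Omega^k_{\rm hor}(U)$. 2. The Hodge-type Laplacian $\Delta=d\delta+\delta d$ on $\Omega^k_{\rm hor}(U)$ (with $\Delta=\delta d$ for $k=0$) is formally self-adjoint for every $k$. 3. Let $d_S$ and $d_{G,i}$ be the exterior derivatives in the variables of $S_I$ and of the $i$-th copy of $G$. Each of them has exactly one formal adjoint $\delta_S$, $\delta_{G,i}$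 on the smooth forms on $U$ with respect to $g_0$ and its Riemannian volume. With the Laplacians $\Delta_{S_I}=d_S\delta_S+\delta_Sd_S$ and $\Delta_{G,i}=d_{G,i}\delta_{G,i}+\delta_{G,i}d_{G,i}$ of the factors one has, in every degree $k$, $$\Delta=\Delta_{S_I}+\sum_{i\in I}\frac1{x_i^2}\,\Delta_{G,i}+L,$$ where $L:\Omega^k_{\rm hor}(U)\to\Omega^k_{\rm hor}(U)$ is a linear differential operator of order at most one. On functions it is given by the derivatives of the coefficients $x_i$ and of the density: $$Lf=-\langle d\log\rho,df\rangle-\dim G\sum_{i\in I}\frac1{x_i}\langle dx_i,df\rangle .$$ -/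

import Mathlib

open Set MeasureTheory Module
open scoped Manifold ContDiff Topology

noncomputable section

namespace SphMilnor

/-! ### Differential forms on a finite-dimensional manifold without boundary -/

section Forms

variable {V : Type*} [NormedAddCommGroup V] [NormedSpace ℝ V]
  {H : Type*} [TopologicalSpace H] (J : ModelWithCorners ℝ V H)
  (M : Type*) [TopologicalSpace M] [ChartedSpace H M]

/-- Fields of alternating `k`-forms on the tangent spaces of `M`, without any regularity. -/
abbrev FormField (k : ℕ) : Type _ := ∀ p : M, TangentSpace J p [⋀^Fin k]→L[ℝ] ℝ

variable {M}

/-- The pull-back of a field of forms under the inverse of the preferred chart at `p₀`. -/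
def chartRep {k : ℕ} (p₀ : M) (η : FormField J M k) : V → V [⋀^Fin k]→L[ℝ] ℝ := fun y =>
  (η ((extChartAt J p₀).symm y)).compContinuousLinearMap
    (mfderiv 𝓘(ℝ, V) J (extChartAt J p₀).symm y : V →L[ℝ] _)

/-- A field of forms is smooth if its coefficients are smooth in charts. -/
def IsSmoothForm {k : ℕ} (η : FormField J M k) : Prop :=
  ∀ p₀ : M, ContDiffOn ℝ ∞ (chartRep J p₀ η) (extChartAt J p₀).target

/-- The exterior derivative, computed at `p` in the preferred chart at `p`. -/
def extD {k : ℕ} (η : FormField J M k) : FormField J M (k + 1) := fun p =>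
  (extDeriv (chartRep J p η) (extChartAt J p p)).compContinuousLinearMap
    (mfderiv J 𝓘(ℝ, V) (extChartAt J p) p : TangentSpace J p →L[ℝ] V)

/-- The partial exterior derivative along a projection `P` of the model space:
in the preferred chart at `p`, only the derivatives in the directions in the range of `P` are kept,
`∑ⱼ dyʲ ∧ ∂ⱼ`, with `j` running through the coordinates of the range of `P`. -/
def extDAlong (P : V →L[ℝ] V) {k : ℕ} (η : FormField J M k) : FormField J M (k + 1) := fun p =>
  (ContinuousAlternatingMap.alternatizeUncurryFin
    ((fderiv ℝ (chartRep J p η) (extChartAt J p p)).comp P)).compContinuousLinearMap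
      (mfderiv J 𝓘(ℝ, V) (extChartAt J p) p : TangentSpace J p →L[ℝ] V)

/-- A function as a field of `0`-forms. -/
def funForm (f : M → ℝ) : FormField J M 0 := fun p =>
  ContinuousAlternatingMap.constOfIsEmpty ℝ (TangentSpace J p) (Fin 0) (f p)

variable (M) in
/-- A symmetric bilinear form on each tangent space. -/
structure SymTensor where
  inner : ∀ p : M, LinearMap.BilinForm ℝ (TangentSpace J p)
  symm : ∀ (p : M) (v w : TangentSpace J p), inner p v w = inner p w v

variable {J}

namespace SymTensor

variable (b : SymTensor J M)

/-- The degeneracy space `𝒦_p = ker b_p`. -/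
def kernel (p : M) : Submodule ℝ (TangentSpace J p) :=
  LinearMap.ker (b.inner p)

/-- The effective horizontal space `ℋ_p = T_p / 𝒦_p`. -/
abbrev Hor (p : M) : Type _ := TangentSpace J p ⧸ b.kernel p

/-- The musical map `v ↦ b̄(v, ·)` from `ℋ_p` to its dual, where `b̄` is induced by `b`. -/
def flat (p : M) : b.Hor p →ₗ[ℝ] Dual ℝ (b.Hor p) :=
  (b.kernel p).liftQ
    { toFun := fun v => (b.kernel p).liftQ (b.inner p v) (by
        intro w hw
        have hw' : b.inner p w = 0 := hw
        change b.inner p v w = 0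
        rw [b.symm, hw']; rfl)
      map_add' := by
        intro v w
        ext u
        simp
      map_smul' := by
        intro c v
        ext u
        simp }
    (by
      intro v hv
      have hv' : b.inner p v = 0 := hv
      ext u
      simp [hv'])

/-- Strong non-degeneracy: the musical map is an isomorphism onto the dual. -/
def StronglyNondegenerate : Prop := ∀ p : M, Function.Bijective (b.flat p)

/-- The effective horizontal spaces have finite, locally constant rank. -/
def HasFiniteRank : Prop :=
  (∀ p : M, Module.Finite ℝ (b.Hor p)) ∧ IsLocallyConstant fun p : M => finrank ℝ (b.Hor p)

/-- The inverse of the musical map (for strongly non-degenerate `b`). -/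
def sharp (p : M) : Dual ℝ (b.Hor p) → b.Hor p := Function.invFun (b.flat p)

/-- A representative in `T_p` of a vector of `ℋ_p`. -/
def rep (p : M) : b.Hor p → TangentSpace J p := Function.surjInv (b.kernel p).mkQ_surjective

/-- The metric pairing of alternating forms on `ℋ_p = T_p / 𝒦_p`, for horizontal `α` and `β`: with
a basis `e` of `ℋ_p` and its dual basis `e*`, it is the complete contraction
`(1/k!) ∑ α(e_{f 1}, …, e_{f k}) β(♯e*_{f 1}, …, ♯e*_{f k})`. This is bilinear, independent of the
basis, and has the value `det ⟨αᵢ, βⱼ⟩` on `α₁ ∧ ⋯ ∧ αₖ` and `β₁ ∧ ⋯ ∧ βₖ`. -/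
def pairing [FiniteDimensional ℝ V] {k : ℕ} (p : M)
    (α β : TangentSpace J p [⋀^Fin k]→L[ℝ] ℝ) : ℝ :=
  haveI : FiniteDimensional ℝ (TangentSpace J p) := inferInstanceAs (FiniteDimensional ℝ V)
  let e := finBasis ℝ (b.Hor p)
  ((k.factorial : ℝ))⁻¹ * ∑ f : Fin k → Fin (finrank ℝ (b.Hor p)),
    α (fun j => b.rep p (e (f j))) * β (fun j => b.rep p (b.sharp p (e.coord (f j))))

/-- A field of forms is horizontal if it vanishes as soon as one argument lies in `𝒦`. -/
def IsHorizontal {k : ℕ} (η : FormField J M k) : Prop :=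
  ∀ (p : M) (v : Fin k → TangentSpace J p), (∃ j, v j ∈ b.kernel p) → η p v = 0

/-- The Gram matrix of `b` on the coordinate vector fields of the preferred chart at `p₀`, at the
point with coordinates `y ∈ ℝᵐ` (coordinates of `V` in a fixed basis). -/
def gram [FiniteDimensional ℝ V] (p₀ : M) (y : Fin (finrank ℝ V) → ℝ) :
    Matrix (Fin (finrank ℝ V)) (Fin (finrank ℝ V)) ℝ :=
  let z : V := (finBasis ℝ V).equivFun.symm y
  let D : V →L[ℝ] TangentSpace J ((extChartAt J p₀).symm z) :=
    mfderiv 𝓘(ℝ, V) J (extChartAt J p₀).symm z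
  Matrix.of fun i j => b.inner _ (D (finBasis ℝ V i)) (D (finBasis ℝ V j))

/-- `μ` is the Riemannian volume of `b`: in every chart its density with respect to Lebesgue
measure is `√ det b(∂ᵢ, ∂ⱼ)`. -/
def IsVolume [FiniteDimensional ℝ V] [MeasurableSpace M] (μ : Measure M) : Prop :=
  ∀ (p₀ : M) (A : Set M), MeasurableSet A → A ⊆ (extChartAt J p₀).source →
    μ A = ∫⁻ y in (fun q => (finBasis ℝ V).equivFun (extChartAt J p₀ q)) '' A,
      ENNReal.ofReal (Real.sqrt (b.gram p₀ y).det)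

end SymTensor

end Forms

/-! ### Spaces of smooth forms, adjoints and Laplacians -/

section Operators

variable {V : Type*} [NormedAddCommGroup V] [NormedSpace ℝ V]
  {H : Type*} [TopologicalSpace H] (J : ModelWithCorners ℝ V H)
  (M : Type*) [TopologicalSpace M] [ChartedSpace H M]

/-- The space `Ωᵏ(M)` of smooth `k`-forms. -/
def smoothForms (k : ℕ) : Submodule ℝ (FormField J M k) where
  carrier := {η | IsSmoothForm J η}
  add_mem' {α β} hα hβ := fun p₀ => by
    have h : chartRep J p₀ (α + β) = chartRep J p₀ α + chartRep J p₀ β := by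
      funext y; ext v; rfl
    rw [h]; exact (hα p₀).add (hβ p₀)
  zero_mem' := fun p₀ => by
    have h : chartRep J p₀ (0 : FormField J M k) = fun _ => 0 := by
      funext y; ext v; rfl
    rw [h]; exact contDiffOn_const
  smul_mem' c α hα := fun p₀ => by
    have h : chartRep J p₀ (c • α) = c • chartRep J p₀ α := by
      funext y; ext v; rfl
    rw [h]; exact (hα p₀).const_smul c

variable {J M}

/-- The space `Ωᵏ_hor(M)` of smooth horizontal `k`-forms. -/
def horizontalForms (b : SymTensor J M) (k : ℕ) : Submodule ℝ (FormField J M k) where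
  carrier := {η | IsSmoothForm J η ∧ b.IsHorizontal η}
  add_mem' {α β} hα hβ := ⟨(smoothForms J M k).add_mem hα.1 hβ.1, fun p v hv => by
    simp [hα.2 p v hv, hβ.2 p v hv]⟩
  zero_mem' := ⟨(smoothForms J M k).zero_mem, fun p v _ => by simp⟩
  smul_mem' c α hα := ⟨(smoothForms J M k).smul_mem c hα.1, fun p v hv => by
    simp [hα.2 p v hv]⟩

theorem horizontalForms_le (b : SymTensor J M) (k : ℕ) :
    horizontalForms b k ≤ smoothForms J M k := fun _ h => h.1

/-- A horizontal form, seen as a smooth form. -/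
def toSmooth (b : SymTensor J M) (k : ℕ) : horizontalForms b k →ₗ[ℝ] smoothForms J M k :=
  Submodule.inclusion (horizontalForms_le b k)

/-- Multiplication of a horizontal form by a smooth function. -/
def smulFun [IsManifold J ∞ M] (b : SymTensor J M) {k : ℕ} (f : C^∞⟮J, M; ℝ⟯)
    (η : horizontalForms b k) : horizontalForms b k :=
  ⟨fun p => f p • (η : FormField J M k) p, fun p₀ => by
    have h : chartRep J p₀ (fun p => f p • (η : FormField J M k) p) =
        fun y => f ((extChartAt J p₀).symm y) • chartRep J p₀ (η : FormField J M k) y := by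
      funext y; ext v; rfl
    rw [h]
    have hf : ContDiffOn ℝ ∞ (fun y => f ((extChartAt J p₀).symm y))
        (extChartAt J p₀).target :=
      (f.contMDiff.comp_contMDiffOn (contMDiffOn_extChartAt_symm p₀)).contDiffOn
    exact hf.smul (η.2.1 p₀), fun p v hv => by
      simp [η.2.2 p v hv]⟩

/-- Compact support of a field of forms. -/
def HasCptSupport {k : ℕ} (η : FormField J M k) : Prop := IsCompact (closure {p | η p ≠ 0})

/-- `D'` is formally adjoint to `D` for the pairing `∫ ⟨α, β⟩_b dμ`, tested on all pairs of forms
one of which has compact support. -/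
def IsFormalAdjoint [FiniteDimensional ℝ V] [MeasurableSpace M] (b : SymTensor J M)
    (μ : Measure M) {k l : ℕ} {A : Submodule ℝ (FormField J M k)}
    {B : Submodule ℝ (FormField J M l)} (D : A →ₗ[ℝ] B) (D' : B →ₗ[ℝ] A) : Prop :=
  ∀ (α : A) (β : B), HasCptSupport (α : FormField J M k) ∨ HasCptSupport (β : FormField J M l) →
    ∫ p, b.pairing p ((D α : FormField J M l) p) ((β : FormField J M l) p) ∂μ =
      ∫ p, b.pairing p ((α : FormField J M k) p) ((D' β : FormField J M k) p) ∂μ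

/-- The Hodge-type Laplacian `d δ + δ d` (which is `δ d` on functions). -/
def hodgeLaplacian {A : ∀ k, Submodule ℝ (FormField J M k)}
    (d : ∀ k, A k →ₗ[ℝ] A (k + 1)) (δ : ∀ k, A (k + 1) →ₗ[ℝ] A k) : ∀ k, A k →ₗ[ℝ] A k
  | 0 => δ 0 ∘ₗ d 0
  | k + 1 => d k ∘ₗ δ k + δ (k + 1) ∘ₗ d (k + 1)

/-- A linear operator is a differential operator of order at most one if its double commutators
with multiplications by smooth functions vanish. -/
def IsDiffOpOrderLEOne [IsManifold J ∞ M] (b : SymTensor J M) {k : ℕ}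
    (L : horizontalForms b k →ₗ[ℝ] horizontalForms b k) : Prop :=
  ∀ (f h : C^∞⟮J, M; ℝ⟯) (η : horizontalForms b k),
    L (smulFun b f (smulFun b h η)) - smulFun b f (L (smulFun b h η))
      - smulFun b h (L (smulFun b f η)) + smulFun b f (smulFun b h (L η)) = 0

end Operators

/-! ### The finite local models `S_I × G^I` -/

section LocalModel

variable (I : Finset ℕ) (n : ℕ) (E : Type*) [NormedAddCommGroup E] [NormedSpace ℝ E]
  (G : Type*) [TopologicalSpace G] [ChartedSpace E G]

/-- The finite local model `S_I × G^I`. -/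
abbrev LocalModel : Type _ := Metric.sphere (0 : EuclideanSpace ℝ I) 1 × (I → G)

/-- The model with corners of `S_I × G^I`, with `dim S_I = n` and `G` modelled on `E`. -/
abbrev localModel : ModelWithCorners ℝ (EuclideanSpace ℝ (Fin n) × (I → E))
    (ModelProd (EuclideanSpace ℝ (Fin n)) (ModelPi fun _ : I => E)) :=
  (𝓡 n).prod (ModelWithCorners.pi fun _ : I => 𝓘(ℝ, E))

/-- A finite power of a smooth manifold is a smooth manifold. -/
instance instIsManifoldPi [IsManifold 𝓘(ℝ, E) ∞ G] :
    IsManifold (ModelWithCorners.pi fun _ : I => 𝓘(ℝ, E)) ∞ (I → G) := by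
  refine isManifold_of_contDiffOn _ _ _ ?_
  rintro _ _ ⟨e, he, rfl⟩ ⟨e', he', rfl⟩
  rw [contDiffOn_pi]
  intro i
  have hi := (contDiffGroupoid ∞ 𝓘(ℝ, E)).compatible (he i trivial) (he' i trivial)
  rw [contDiffGroupoid, mem_groupoid_of_pregroupoid] at hi
  have hi1 : ContDiffOn ℝ ∞ _ _ := hi.1
  refine ContDiffOn.comp (g := _) (f := fun y : I → E => y i) hi1 (contDiff_apply ℝ E i).contDiffOn ?_
  rintro y ⟨hy, -⟩
  refine ⟨?_, by simp⟩
  exact ⟨hy.1 i trivial, hy.2 i trivial⟩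

variable {I n E G}
variable [Fact (finrank ℝ (EuclideanSpace ℝ I) = n + 1)]
  (U : TopologicalSpace.Opens (LocalModel I G))

/-- The spherical coordinate `x ∈ S_I ⊆ ℝᴵ` on an open part `U` of the local model. -/
def sphCoord (p : U) : EuclideanSpace ℝ I := (p.1.1 : EuclideanSpace ℝ I)

/-- The `i`-th group coordinate on `U`. -/
def grpCoord (i : I) (p : U) : G := p.1.2 i

/-- The symmetric tensor `∑ᵢ dxᵢ² + ∑ᵢ cᵢ ⟨·,·⟩_G⁽ⁱ⁾` on `U`, with weights `cᵢ`. -/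
def weightedMetric [IsManifold 𝓘(ℝ, E) ∞ G]
    (gG : Bundle.ContMDiffRiemannianMetric 𝓘(ℝ, E) ∞ E (fun a : G => TangentSpace 𝓘(ℝ, E) a))
    (c : U → I → ℝ) : SymTensor (localModel I n E) U where
  inner p :=
    let X : TangentSpace (localModel I n E) p →L[ℝ] EuclideanSpace ℝ I :=
      mfderiv (localModel I n E) 𝓘(ℝ, EuclideanSpace ℝ I) (sphCoord U) p
    let Y (i : I) : TangentSpace (localModel I n E) p →L[ℝ] TangentSpace 𝓘(ℝ, E) (grpCoord U i p) :=
      mfderiv (localModel I n E) 𝓘(ℝ, E) (grpCoord U i) p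
    LinearMap.mk₂ ℝ (fun v w => inner ℝ (X v) (X w) +
        ∑ i : I, c p i * gG.inner (grpCoord U i p) (Y i v) (Y i w))
      (fun u v w => by
        simp only [map_add, inner_add_left, add_apply, mul_add,
          Finset.sum_add_distrib]; ring)
      (fun a v w => by
        simp only [map_smul, inner_smul_left, smul_apply, smul_eq_mul,
          mul_add, Finset.mul_sum, RCLike.conj_to_real]
        congr 1; exact Finset.sum_congr rfl fun i _ => by ring)
      (fun u v w => by
        simp only [map_add, inner_add_right, mul_add, Finset.sum_add_distrib]; ring)
      (fun a v w => by
        simp only [map_smul, inner_smul_right, smul_eq_mul, mul_add, Finset.mul_sum]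
        congr 1; exact Finset.sum_congr rfl fun i _ => by ring)
  symm p v w := by
    simp only [LinearMap.mk₂_apply]
    rw [real_inner_comm]
    congr 1
    exact Finset.sum_congr rfl fun i _ => by rw [gG.symm]

/-- The warped metric `∑ᵢ dxᵢ² + ∑ᵢ xᵢ² ⟨·,·⟩_G⁽ⁱ⁾`. -/
abbrev warpedMetric [IsManifold 𝓘(ℝ, E) ∞ G]
    (gG : Bundle.ContMDiffRiemannianMetric 𝓘(ℝ, E) ∞ E (fun a : G => TangentSpace 𝓘(ℝ, E) a)) :
    SymTensor (localModel I n E) U :=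
  weightedMetric U gG fun p i => sphCoord U p i ^ 2

/-- The product metric `∑ᵢ dxᵢ² + ∑ᵢ ⟨·,·⟩_G⁽ⁱ⁾`. -/
abbrev productMetric [IsManifold 𝓘(ℝ, E) ∞ G]
    (gG : Bundle.ContMDiffRiemannianMetric 𝓘(ℝ, E) ∞ E (fun a : G => TangentSpace 𝓘(ℝ, E) a)) :
    SymTensor (localModel I n E) U :=
  weightedMetric U gG fun _ _ => 1

variable (I n E) in
/-- The projection of the model space of `S_I × G^I` onto one factor: `none` stands for `S_I` and
`some i` for the `i`-th copy of `G`. -/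
def factorProj : Option I →
    (EuclideanSpace ℝ (Fin n) × (I → E)) →L[ℝ] (EuclideanSpace ℝ (Fin n) × (I → E))
  | none => (ContinuousLinearMap.inl ℝ _ _).comp (ContinuousLinearMap.fst ℝ _ _)
  | some i => (ContinuousLinearMap.inr ℝ _ _).comp
      ((ContinuousLinearMap.single ℝ (fun _ : I => E) i).comp
        ((ContinuousLinearMap.proj i).comp (ContinuousLinearMap.snd ℝ _ _)))

end LocalModel

end SphMilnor

end

/-! The geometric input is the local constancy of the rank of `Hor`. If `E` is nontrivial and some
coordinate `x_i` vanishes at a point, the `i`-th group direction lies in the kernel there, while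
arbitrarily close points have all coordinates nonzero and hence trivial kernel; the rank would jump
(`sphCoord_ne_zero_of_hasFiniteRank`). If `E` is trivial, there are no group directions at all. In
both cases the warped metric is a genuine Riemannian metric on `U`, every form is horizontal, and
what remains concerns a Riemannian metric obtained from a product metric by rescaling the factors
(`IsWarped`), together with a smooth positive density.

Adjoints. The exterior derivative and its partial versions are all of the form `d_P = ∑ⱼ (dyʲ ∘ P) ∧
∂ⱼ`, where `P` is a projection of the model space that commutes with the changes of charts; `P = id`
gives `d`. Since `θ ∧ ·` is adjoint to contraction with `♯θ` (`formPair_wedge`), the density `⟨d_P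
α, β⟩ w - ⟨α, δ_P β⟩ w` is in coordinates a divergence, for an explicit `δ_P` (`formPair_codiff`),
and its integral vanishes when `α` has compact support in the chart. No transformation law for `δ_P`
is computed: two charts give the same operator because both versions are adjoint to `d_P` on the
overlap, and adjoints are unique (`IsRiemannian.eq_of_forall_integral_eq`,
`codiffField_eq_codiffChart`). Bump functions then pass from charts to the manifold.
Self-adjointness of the Laplacian is a formal consequence.

Decomposition. `L` is defined as the difference of the two sides (`remainder`). The commutators of
`d_P` and `δ_P` with multiplication by `f` are `d_P f ∧ ·` and minus the contraction with `♯ d_P f`.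
By Cartan's identity (`curryLeft_wedge`) the double commutator of the Laplacian along `P` with `f`
and `h` is multiplication by `-2⟨d_P f, d_P h⟩`, in every degree (`doubleComm_hodgeLaplacian`). The
inverse of the warped metric is the sum of the inverse metrics of the factors divided by the weights
(`IsWarped.apply_sharpL`), so the double commutators cancel in `L`, which therefore has order at
most one.

On functions the Laplacian is `-w⁻¹ ∑ ∂ⱼ(w gʲˡ ∂ₗ)`. The density of `μ` relative to the product
volume is `σ = ρ ∏ |x_i|^dim G` (`volDensity_warpedMetric`). The product rule leaves only `-⟨d log
σ, df⟩`, because the weight of a factor is constant along that factor (`remainder_zeroForm`), and `d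
log σ` splits into the two stated terms. -/

noncomputable section

set_option linter.unusedSectionVars false

namespace SphMilnor

/-! ### Dual bases and the invariance of contractions -/

section DualBases

variable {W : Type*} [AddCommGroup W] [Module ℝ W]

/-- The families `u` and `u'` are dual to each other for the bilinear form `b`. -/
def IsDualPair {ι : Type*} (b : W → W → ℝ) (u u' : ι → W) : Prop :=
  ∀ i j, b (u' i) (u j) = (Finsupp.single i (1 : ℝ)) j

/-- If a basis changes by a matrix, its dual family changes by the transposed matrix in the opposite
direction, so both contractions expand to the same double sum. This makes the pairing of forms
independent of the basis used to define it. -/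
theorem sum_dualPair_eq {ι κ : Type*} [Fintype ι] [Fintype κ] {k : ℕ} (b : W →ₗ[ℝ] W →ₗ[ℝ] ℝ)
    (hb : ∀ v, (∀ w, b v w = 0) → v = 0) (u : Basis ι ℝ W) (u' : ι → W) (t : Basis κ ℝ W)
    (t' : κ → W) (hu : IsDualPair (fun v w => b v w) u u')
    (ht : IsDualPair (fun v w => b v w) t t')
    (A B : MultilinearMap ℝ (fun _ : Fin k => W) ℝ) :
    ∑ f : Fin k → ι, A (fun j => u (f j)) * B (fun j => u' (f j)) =
      ∑ f : Fin k → κ, A (fun j => t (f j)) * B (fun j => t' (f j)) := by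
  classical
  have h1 (f : Fin k → ι) : A (fun j => u (f j)) =
      ∑ g : Fin k → κ, (∏ j, t.repr (u (f j)) (g j)) * A (fun j => t (g j)) := by
    have : (fun j => u (f j)) = fun j => ∑ c, t.repr (u (f j)) c • t c := by
      funext j; exact (t.sum_repr _).symm
    rw [this, MultilinearMap.map_sum]
    refine Finset.sum_congr rfl fun g _ => ?_
    rw [MultilinearMap.map_smul_univ, smul_eq_mul]
  -- Both sides pair equally with every `u l`; nondegeneracy of `b` then identifies them.
  have h2 (c : κ) : t' c = ∑ i, t.repr (u i) c • u' i := by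
    rw [← sub_eq_zero]
    refine hb _ fun w => ?_
    have key : b (t' c - ∑ i, t.repr (u i) c • u' i) = 0 := by
      refine u.ext fun l => ?_
      simp only [map_sub, map_sum, map_smul, LinearMap.sub_apply, LinearMap.sum_apply,
        LinearMap.smul_apply, LinearMap.zero_apply, smul_eq_mul]
      have e1 : b (t' c) (u l) = t.repr (u l) c := by
        conv_lhs => rw [← t.sum_repr (u l)]
        simp only [map_sum, map_smul, smul_eq_mul]
        rw [Finset.sum_eq_single c]
        · have := ht c c; simp only [Finsupp.single_eq_same] at this; rw [this, mul_one]
        · intro d _ hd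
          have := ht c d
          simp only [Finsupp.single_apply, if_neg hd.symm] at this; rw [this, mul_zero]
        · simp
      rw [e1, Finset.sum_eq_single l]
      · have := hu l l; simp only [Finsupp.single_eq_same] at this; rw [this, mul_one, sub_self]
      · intro d _ hd
        have := hu d l
        simp only [Finsupp.single_apply, if_neg hd] at this; rw [this, mul_zero]
      · simp
    rw [key]; rfl
  have h3 (g : Fin k → κ) : B (fun j => t' (g j)) =
      ∑ f : Fin k → ι, (∏ j, t.repr (u (f j)) (g j)) * B (fun j => u' (f j)) := by
    have : (fun j => t' (g j)) = fun j => ∑ i, t.repr (u i) (g j) • u' i := by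
      funext j; exact h2 _
    rw [this, MultilinearMap.map_sum]
    refine Finset.sum_congr rfl fun f _ => ?_
    rw [MultilinearMap.map_smul_univ, smul_eq_mul]
  simp_rw [h1, h3, Finset.sum_mul, Finset.mul_sum]
  rw [Finset.sum_comm]
  exact Finset.sum_congr rfl fun g _ => Finset.sum_congr rfl fun f _ => by ring

/-- Normalise an orthogonal basis. In a self-dual basis the pairing of forms is a sum of products of
coefficients, from which symmetry and definiteness can be read off. -/
theorem exists_selfDual_basis [FiniteDimensional ℝ W] (b : W →ₗ[ℝ] W →ₗ[ℝ] ℝ)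
    (hs : ∀ v w, b v w = b w v) (hpos : ∀ v, v ≠ 0 → 0 < b v v) :
    ∃ u : Basis (Fin (finrank ℝ W)) ℝ W, IsDualPair (fun v w => b v w) u u := by
  obtain ⟨v, hv⟩ := LinearMap.BilinForm.exists_orthogonal_basis (B := b) ⟨fun x y => by simpa using hs x y⟩
  have hne : ∀ i, IsUnit ((Real.sqrt (b (v i) (v i)))⁻¹) := fun i =>
    (inv_ne_zero (Real.sqrt_ne_zero'.2 (hpos _ (v.ne_zero i)))).isUnit
  refine ⟨v.isUnitSMul hne, fun i j => ?_⟩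
  simp only [Basis.isUnitSMul_apply, map_smul, LinearMap.smul_apply, smul_eq_mul]
  rcases eq_or_ne i j with rfl | hij
  · have h := hpos _ (v.ne_zero i)
    have h2 := Real.mul_self_sqrt h.le
    have h3 := Real.sqrt_ne_zero'.2 h
    rw [Finsupp.single_eq_same, ← mul_assoc, ← mul_inv, h2, inv_mul_cancel₀ h.ne']
  · have : b (v i) (v j) = 0 := hv hij
    simp [this, hij]

end DualBases

/-! ### The pairing of alternating forms, exterior multiplication and contraction -/

section FormPair

variable {V : Type*} [NormedAddCommGroup V] [NormedSpace ℝ V] [FiniteDimensional ℝ V]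

/-- Positive definite symmetric bilinear forms on `V`. -/
structure IsInner (B : V →L[ℝ] V →L[ℝ] ℝ) : Prop where
  symm : ∀ v w, B v w = B w v
  pos : ∀ v, v ≠ 0 → 0 < B v v

variable (V) in
/-- The isomorphism from `V` to its dual given by the fixed basis. -/
def basisFlat : V ≃L[ℝ] (V →L[ℝ] ℝ) :=
  ((finBasis ℝ V).equiv ((finBasis ℝ V).dualBasis) (Equiv.refl _) ≪≫ₗ
    LinearMap.toContinuousLinearMap).toContinuousLinearEquiv

variable (V) in
/-- The elements of the dual basis of the fixed basis. -/
def coord (j : Fin (finrank ℝ V)) : V →L[ℝ] ℝ := LinearMap.toContinuousLinearMap ((finBasis ℝ V).coord j)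

theorem coord_apply (j : Fin (finrank ℝ V)) (v : V) : coord V j v = (finBasis ℝ V).repr v j := rfl

theorem coord_basis (i j : Fin (finrank ℝ V)) :
    coord V j (finBasis ℝ V i) = Finsupp.single i (1 : ℝ) j := by
  rw [coord_apply, Basis.repr_self]

theorem basisFlat_basis (j : Fin (finrank ℝ V)) : basisFlat V (finBasis ℝ V j) = coord V j := by
  have : (finBasis ℝ V).equiv ((finBasis ℝ V).dualBasis) (Equiv.refl _) (finBasis ℝ V j) =
      (finBasis ℝ V).coord j := by
    rw [Basis.equiv_apply]; simp
  exact congrArg LinearMap.toContinuousLinearMap this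

theorem sum_coord_smul (θ : V →L[ℝ] ℝ) : ∑ j, θ (finBasis ℝ V j) • coord V j = θ := by
  ext v
  conv_rhs => rw [← (finBasis ℝ V).sum_repr v]
  simp only [map_sum, map_smul, sum_apply, smul_apply,
    coord_apply, smul_eq_mul]
  exact Finset.sum_congr rfl fun i _ => mul_comm _ _

/-- The musical isomorphism from the dual of `V` to `V`. -/
def sharpL (B : V →L[ℝ] V →L[ℝ] ℝ) : (V →L[ℝ] ℝ) →L[ℝ] V := B.inverse

namespace IsInner

variable {B : V →L[ℝ] V →L[ℝ] ℝ} (hB : IsInner B)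
include hB

theorem isInvertible : B.IsInvertible := by
  have hinj : Function.Injective (B : V →ₗ[ℝ] (V →L[ℝ] ℝ)) := by
    rw [← LinearMap.ker_eq_bot, LinearMap.ker_eq_bot']
    intro v hv
    by_contra h
    have := hB.pos v h
    have h0 : B v = 0 := hv
    rw [h0] at this
    simp at this
  have hfin : finrank ℝ V = finrank ℝ (V →L[ℝ] ℝ) := (basisFlat V).toLinearEquiv.finrank_eq
  refine ⟨(LinearEquiv.ofInjectiveOfFinrankEq (B : V →ₗ[ℝ] (V →L[ℝ] ℝ)) hinj
    hfin).toContinuousLinearEquiv, ?_⟩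
  ext v w; rfl

theorem apply_sharpL (θ : V →L[ℝ] ℝ) : B (sharpL B θ) = θ := by
  obtain ⟨e, rfl⟩ := hB.isInvertible
  simp [sharpL]

theorem sharpL_apply (v : V) : sharpL B (B v) = v := by
  obtain ⟨e, rfl⟩ := hB.isInvertible
  simp [sharpL]

theorem sharpL_unique {θ : V →L[ℝ] ℝ} {v : V} (h : B v = θ) : sharpL B θ = v := by
  rw [← h, hB.sharpL_apply]

theorem apply_sharpL_symm (θ η : V →L[ℝ] ℝ) : θ (sharpL B η) = η (sharpL B θ) := by
  conv_lhs => rw [← hB.apply_sharpL θ]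
  conv_rhs => rw [← hB.apply_sharpL η]
  exact hB.symm _ _

theorem isDualPair : IsDualPair (fun v w => B v w) (finBasis ℝ V)
    (fun j => sharpL B (coord V j)) := by
  intro i j
  simp only [hB.apply_sharpL, coord_basis, Finsupp.single_apply, eq_comm]

end IsInner

/-- The pairing of alternating forms on `V` induced by `B`. -/
def formPair (B : V →L[ℝ] V →L[ℝ] ℝ) {k : ℕ} (α β : V [⋀^Fin k]→L[ℝ] ℝ) : ℝ :=
  ((k.factorial : ℝ))⁻¹ * ∑ f : Fin k → Fin (finrank ℝ V),
    α (fun j => finBasis ℝ V (f j)) * β (fun j => sharpL B (coord V (f j)))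

theorem IsInner.formPair_eq {B : V →L[ℝ] V →L[ℝ] ℝ} (hB : IsInner B) {ι : Type*} [Fintype ι]
    (u : Basis ι ℝ V) (u' : ι → V) (hu : IsDualPair (fun v w => B v w) u u') {k : ℕ}
    (α β : V [⋀^Fin k]→L[ℝ] ℝ) :
    formPair B α β = ((k.factorial : ℝ))⁻¹ *
      ∑ f : Fin k → ι, α (fun j => u (f j)) * β (fun j => u' (f j)) := by
  rw [formPair]
  congr 1
  refine sum_dualPair_eq (W := V) (LinearMap.mk₂ ℝ (fun v w => B v w) (by simp) (by simp) (by simp)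
    (by simp)) ?_ _ _ u u' hB.isDualPair hu α.toMultilinearMap β.toMultilinearMap
  intro v hv
  by_contra h
  exact (hB.pos v h).ne' (hv v)

theorem formPair_add_left (B : V →L[ℝ] V →L[ℝ] ℝ) {k : ℕ} (α α' β : V [⋀^Fin k]→L[ℝ] ℝ) :
    formPair B (α + α') β = formPair B α β + formPair B α' β := by
  simp [formPair, add_mul, Finset.sum_add_distrib, mul_add]

theorem formPair_zero_left (B : V →L[ℝ] V →L[ℝ] ℝ) {k : ℕ} (β : V [⋀^Fin k]→L[ℝ] ℝ) :
    formPair B 0 β = 0 := by simp [formPair]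

theorem formPair_sum_left (B : V →L[ℝ] V →L[ℝ] ℝ) {k : ℕ} {ι : Type*} (s : Finset ι)
    (α : ι → V [⋀^Fin k]→L[ℝ] ℝ) (β : V [⋀^Fin k]→L[ℝ] ℝ) :
    formPair B (∑ i ∈ s, α i) β = ∑ i ∈ s, formPair B (α i) β := by
  induction s using Finset.cons_induction with
  | empty => simp [formPair_zero_left]
  | cons a s ha ih => rw [Finset.sum_cons, Finset.sum_cons, formPair_add_left, ih]

theorem IsInner.formPair_comm {B : V →L[ℝ] V →L[ℝ] ℝ} (hB : IsInner B) {k : ℕ}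
    (α β : V [⋀^Fin k]→L[ℝ] ℝ) : formPair B α β = formPair B β α := by
  obtain ⟨u, hu⟩ := exists_selfDual_basis (LinearMap.mk₂ ℝ (fun v w => B v w) (by simp) (by simp)
    (by simp) (by simp)) hB.symm hB.pos
  rw [hB.formPair_eq u u hu, hB.formPair_eq u u hu]
  simp only [mul_comm]

theorem IsInner.formPair_self_nonneg {B : V →L[ℝ] V →L[ℝ] ℝ} (hB : IsInner B) {k : ℕ}
    (α : V [⋀^Fin k]→L[ℝ] ℝ) : 0 ≤ formPair B α α := by
  obtain ⟨u, hu⟩ := exists_selfDual_basis (LinearMap.mk₂ ℝ (fun v w => B v w) (by simp) (by simp)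
    (by simp) (by simp)) hB.symm hB.pos
  rw [hB.formPair_eq u u hu]
  exact mul_nonneg (by positivity) (Finset.sum_nonneg fun f _ => mul_self_nonneg _)

theorem IsInner.formPair_self_eq_zero {B : V →L[ℝ] V →L[ℝ] ℝ} (hB : IsInner B) {k : ℕ}
    {α : V [⋀^Fin k]→L[ℝ] ℝ} (h : formPair B α α = 0) : α = 0 := by
  obtain ⟨u, hu⟩ := exists_selfDual_basis (LinearMap.mk₂ ℝ (fun v w => B v w) (by simp) (by simp)
    (by simp) (by simp)) hB.symm hB.pos
  rw [hB.formPair_eq u u hu, mul_eq_zero, Finset.sum_eq_zero_iff_of_nonneg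
    (fun f _ => mul_self_nonneg _)] at h
  have h' := h.resolve_left (by positivity)
  apply ContinuousAlternatingMap.toAlternatingMap_injective
  refine Basis.ext_alternating u fun f _ => ?_
  simpa using h' f (Finset.mem_univ _)

/-- Exterior multiplication by a covector. -/
def wedge {k : ℕ} (θ : V →L[ℝ] ℝ) (α : V [⋀^Fin k]→L[ℝ] ℝ) : V [⋀^Fin (k + 1)]→L[ℝ] ℝ :=
  ContinuousAlternatingMap.alternatizeUncurryFin (θ.smulRight α)

theorem wedge_apply {k : ℕ} (θ : V →L[ℝ] ℝ) (α : V [⋀^Fin k]→L[ℝ] ℝ) (v : Fin (k + 1) → V) :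
    wedge θ α v = ∑ i : Fin (k + 1), (-1) ^ (i : ℕ) * (θ (v i) * α (i.removeNth v)) := by
  simp [wedge, ContinuousAlternatingMap.alternatizeUncurryFin_apply]

theorem wedge_smul {k : ℕ} (θ : V →L[ℝ] ℝ) (c : ℝ) (α : V [⋀^Fin k]→L[ℝ] ℝ) :
    wedge θ (c • α) = c • wedge θ α := by
  ext v
  simp only [wedge_apply, ContinuousAlternatingMap.smul_apply, smul_eq_mul, Finset.mul_sum]
  exact Finset.sum_congr rfl fun i _ => by ring

/-- Bringing the argument in slot `i` to the front takes `i` transpositions. -/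
theorem alternatize_eq_neg_one_pow {k : ℕ} (β : V [⋀^Fin (k + 1)]→L[ℝ] ℝ) (i : Fin (k + 1))
    (v : Fin (k + 1) → V) :
    β.curryLeft (v i) (i.removeNth v) = (-1) ^ (i : ℕ) * β v := by
  have h := ContinuousAlternatingMap.curryLeft_apply_apply β (v i) (i.removeNth v)
  have h2 := β.toAlternatingMap.map_insertNth i (v i) (i.removeNth v)
  rw [Fin.insertNth_self_removeNth] at h2
  have h3 : β v = (-1) ^ (i : ℕ) * β (Matrix.vecCons (v i) (i.removeNth v)) := by
    simpa using h2
  rw [h, h3, ← mul_assoc, ← pow_add, ← two_mul, pow_mul]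
  simp

/-- Each of the `k + 1` summands of the exterior product contributes the same amount, since its sign
is compensated by moving the matching argument of `β` to the front. The factor `k + 1` turns
`1/(k+1)!` into `1/k!`. -/
theorem formPair_wedge (B : V →L[ℝ] V →L[ℝ] ℝ) {k : ℕ} (θ : V →L[ℝ] ℝ)
    (α : V [⋀^Fin k]→L[ℝ] ℝ) (β : V [⋀^Fin (k + 1)]→L[ℝ] ℝ) :
    formPair B (wedge θ α) β = formPair B α (β.curryLeft (sharpL B θ)) := by
  have hterm (i : Fin (k + 1)) : ∑ f : Fin (k + 1) → Fin (finrank ℝ V),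
      ((-1) ^ (i : ℕ) * (θ (finBasis ℝ V (f i)) *
        α (i.removeNth fun j => finBasis ℝ V (f j)))) * β (fun j => sharpL B (coord V (f j))) =
      ∑ f : Fin k → Fin (finrank ℝ V), α (fun j => finBasis ℝ V (f j)) *
        β.curryLeft (sharpL B θ) (fun j => sharpL B (coord V (f j))) := by
    -- The multi-index is split into its entry `l` at position `i` and the rest; summing over `l`
    -- reassembles `♯θ`.
    rw [← (Fin.insertNthEquiv (fun _ => Fin (finrank ℝ V)) i).sum_comp, Fintype.sum_prod_type_right]
    refine Finset.sum_congr rfl fun f _ => ?_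
    conv_rhs => rw [← sum_coord_smul θ]
    simp only [map_sum, map_smul, ContinuousAlternatingMap.sum_apply,
      ContinuousAlternatingMap.smul_apply, smul_eq_mul, Finset.mul_sum]
    refine Finset.sum_congr rfl fun l _ => ?_
    simp only [Fin.insertNthEquiv_apply, Fin.insertNth_apply_same]
    have e1 : (i.removeNth fun j => finBasis ℝ V (i.insertNth (α := fun _ => Fin (finrank ℝ V)) l f j)) =
        fun j => finBasis ℝ V (f j) := by
      funext j; simp [Fin.removeNth]
    have e2 := alternatize_eq_neg_one_pow β i
      (fun j => sharpL B (coord V (i.insertNth (α := fun _ => Fin (finrank ℝ V)) l f j)))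
    have e3 : (i.removeNth fun j => sharpL B (coord V (i.insertNth (α := fun _ => Fin (finrank ℝ V)) l f j))) =
        fun j => sharpL B (coord V (f j)) := by
      funext j; simp [Fin.removeNth]
    rw [e3] at e2
    simp only [Fin.insertNth_apply_same] at e2
    rw [e1, e2]
    ring
  rw [formPair, formPair]
  simp only [wedge_apply, Finset.sum_mul]
  rw [Finset.sum_comm]
  simp only [hterm]
  rw [Finset.sum_const, Finset.card_univ, Fintype.card_fin, nsmul_eq_mul, ← mul_assoc,
    Nat.factorial_succ]
  congr 1
  push_cast
  have : (k.factorial : ℝ) ≠ 0 := by positivity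
  field_simp

/-- Cartan's identity. In the expansion of `wedge θ η` on `(s, v)` the first term is `θ s • η`; each
other term has `s` as first argument of `η` and cancels, by the shift of the index in the sign,
against a term of `wedge θ (η.curryLeft s)`. -/
theorem curryLeft_wedge {k : ℕ} (θ : V →L[ℝ] ℝ) (s : V) (η : V [⋀^Fin (k + 1)]→L[ℝ] ℝ) :
    (wedge θ η).curryLeft s + wedge θ (η.curryLeft s) = θ s • η := by
  ext v
  simp only [ContinuousAlternatingMap.add_apply, ContinuousAlternatingMap.curryLeft_apply_apply,
    ContinuousAlternatingMap.smul_apply, smul_eq_mul]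
  rw [wedge_apply, wedge_apply, Fin.sum_univ_succ, add_assoc, ← Finset.sum_add_distrib]
  have h0 : (0 : Fin (k + 2)).removeNth (Matrix.vecCons s v) = v := by
    funext j; simp [Fin.removeNth]
  rw [h0]
  simp only [Fin.val_zero, pow_zero, one_mul, Matrix.cons_val_zero, Matrix.cons_val_succ]
  rw [Finset.sum_eq_zero, add_zero]
  intro i _
  have h1 : i.succ.removeNth (Matrix.vecCons s v) = Matrix.vecCons s (i.removeNth v) := by
    funext j
    refine Fin.cases ?_ (fun j => ?_) j <;> simp [Fin.removeNth]
  rw [h1, ContinuousAlternatingMap.curryLeft_apply_apply, Fin.val_succ, pow_succ]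
  ring

/-- Degree zero needs its own version of Cartan's identity because a `0`-form has no contraction. -/
theorem curryLeft_wedge_zero (θ : V →L[ℝ] ℝ) (s : V) (η : V [⋀^Fin 0]→L[ℝ] ℝ) :
    (wedge θ η).curryLeft s = θ s • η := by
  ext v
  simp only [ContinuousAlternatingMap.curryLeft_apply_apply,
    ContinuousAlternatingMap.smul_apply, smul_eq_mul]
  rw [wedge_apply]
  rw [Fin.sum_univ_one, Fin.val_zero, pow_zero, one_mul]
  congr 2

end FormPair

/-! ### Smooth dependence of forms on parameters -/

section FormSmooth

variable {X V : Type*} [NormedAddCommGroup X] [NormedSpace ℝ X]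
  [NormedAddCommGroup V] [NormedSpace ℝ V] [FiniteDimensional ℝ V]

theorem form_apply_eq_sum {k : ℕ} (α : V [⋀^Fin k]→L[ℝ] ℝ) (v : Fin k → V) :
    α v = ∑ f : Fin k → Fin (finrank ℝ V),
      (∏ j, coord V (f j) (v j)) * α (fun j => finBasis ℝ V (f j)) := by
  have : v = fun j => ∑ c, coord V c (v j) • finBasis ℝ V c := by
    funext j; exact ((finBasis ℝ V).sum_repr _).symm
  conv_lhs => rw [this]
  rw [ContinuousAlternatingMap.map_sum]
  refine Finset.sum_congr rfl fun g _ => ?_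
  rw [ContinuousAlternatingMap.map_smul_univ, smul_eq_mul]

variable {n : WithTop ℕ∞}

/-- Evaluation on tuples of basis vectors embeds the forms into a finite-dimensional coordinate
space, and a linear left inverse of this embedding is automatically continuous. Smoothness can
therefore be tested on coefficients. -/
theorem contDiffAt_form_iff {k : ℕ} {c : X → V [⋀^Fin k]→L[ℝ] ℝ} {x : X} :
    ContDiffAt ℝ n c x ↔ ∀ v, ContDiffAt ℝ n (fun y => c y v) x := by
  constructor
  · intro h v
    exact (ContinuousAlternatingMap.apply ℝ V ℝ v).contDiff.contDiffAt.comp x h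
  · intro h
    let ev : (V [⋀^Fin k]→L[ℝ] ℝ) →ₗ[ℝ] ((Fin k → Fin (finrank ℝ V)) → ℝ) :=
      LinearMap.pi fun f =>
        (ContinuousAlternatingMap.apply ℝ V ℝ (fun j => finBasis ℝ V (f j)) : _ →ₗ[ℝ] ℝ)
    have hev : LinearMap.ker ev = ⊥ := by
      rw [LinearMap.ker_eq_bot']
      intro α hα
      ext v
      rw [form_apply_eq_sum]
      refine Finset.sum_eq_zero fun f _ => ?_
      have : α (fun j => finBasis ℝ V (f j)) = 0 := congrFun hα f
      rw [this, mul_zero]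
    obtain ⟨g, hg⟩ := ev.exists_leftInverse_of_injective hev
    have : c = fun y => LinearMap.toContinuousLinearMap g (fun f => c y (fun j => finBasis ℝ V (f j))) := by
      funext y
      exact (LinearMap.congr_fun hg (c y)).symm
    rw [this]
    exact (LinearMap.toContinuousLinearMap g).contDiff.contDiffAt.comp x
      (contDiffAt_pi.2 fun f => h _)

theorem ContDiffAt.form_apply {k : ℕ} {c : X → V [⋀^Fin k]→L[ℝ] ℝ} {v : Fin k → X → V} {x : X}
    (hc : ContDiffAt ℝ n c x) (hv : ∀ j, ContDiffAt ℝ n (v j) x) :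
    ContDiffAt ℝ n (fun y => c y (fun j => v j y)) x := by
  have : (fun y => c y (fun j => v j y)) = fun y => ∑ f : Fin k → Fin (finrank ℝ V),
      (∏ j, coord V (f j) (v j y)) * c y (fun j => finBasis ℝ V (f j)) := by
    funext y; exact form_apply_eq_sum _ _
  rw [this]
  refine ContDiffAt.sum fun f _ => ContDiffAt.mul (contDiffAt_prod fun j _ => ?_)
    (contDiffAt_form_iff.1 hc _)
  exact (coord V (f j)).contDiff.contDiffAt.comp x (hv j)

theorem ContDiffAt.form_comp {k : ℕ} {c : X → V [⋀^Fin k]→L[ℝ] ℝ} {A : X → V →L[ℝ] V} {x : X}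
    (hc : ContDiffAt ℝ n c x) (hA : ContDiffAt ℝ n A x) :
    ContDiffAt ℝ n (fun y => (c y).compContinuousLinearMap (A y)) x :=
  contDiffAt_form_iff.2 fun v => ContDiffAt.form_apply (v := fun j y => A y (v j)) hc fun _ =>
    hA.clm_apply contDiffAt_const

theorem ContDiffAt.form_curryLeft {k : ℕ} {c : X → V [⋀^Fin (k + 1)]→L[ℝ] ℝ} {s : X → V} {x : X}
    (hc : ContDiffAt ℝ n c x) (hs : ContDiffAt ℝ n s x) :
    ContDiffAt ℝ n (fun y => (c y).curryLeft (s y)) x := by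
  refine contDiffAt_form_iff.2 fun v => ?_
  have := ContDiffAt.form_apply (v := Fin.cons s fun j _ => v j) hc
    (fun j => Fin.cases (by simpa using hs) (fun j => by simpa using contDiffAt_const) j)
  refine this.congr_of_eventuallyEq (Filter.Eventually.of_forall fun y => ?_)
  simp only [ContinuousAlternatingMap.curryLeft_apply_apply]
  congr 1
  funext j
  refine Fin.cases ?_ (fun j => ?_) j <;> simp

end FormSmooth

/-! ### Naturality of partial exterior derivatives -/

section Pullback

variable {V : Type*} [NormedAddCommGroup V] [NormedSpace ℝ V]

/-- The exterior derivative along a projection commutes with pull-back by maps whose derivative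
commutes with the projection. -/
theorem alternatize_fderiv_comp_pullback {k : ℕ} {c : V → V [⋀^Fin k]→L[ℝ] ℝ} {f : V → V} {x : V}
    (P : V →L[ℝ] V) (hc : DifferentiableAt ℝ c (f x)) (hf : ContDiffAt ℝ 2 f x)
    (hP : ∀ᶠ z in 𝓝 x, P.comp (fderiv ℝ f z) = (fderiv ℝ f z).comp P) :
    ContinuousAlternatingMap.alternatizeUncurryFin
      ((fderiv ℝ (fun x => (c (f x)).compContinuousLinearMap (fderiv ℝ f x)) x).comp P) =
    (ContinuousAlternatingMap.alternatizeUncurryFin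
      ((fderiv ℝ c (f x)).comp P)).compContinuousLinearMap (fderiv ℝ f x) := by
  have hdf : DifferentiableAt ℝ f x := hf.differentiableAt (by norm_num)
  have hd2f : DifferentiableAt ℝ (fderiv ℝ f) x :=
    (hf.fderiv_right (m := 1) (by norm_num)).differentiableAt one_ne_zero
  have hsymm : IsSymmSndFDerivAt ℝ f x := hf.isSymmSndFDerivAt (by simp)
  have hcf : DifferentiableAt ℝ (fun z => c (f z)) x := hc.comp x hdf
  rw [fderiv_continuousAlternatingMapCompContinuousLinearMap hcf hd2f,
    fderiv_fun_comp _ hc hdf, ContinuousLinearMap.add_comp,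
    ContinuousAlternatingMap.alternatizeUncurryFin_add, 
    ContinuousLinearMap.comp_assoc ((c (f x)).fderivCompContinuousLinearMap (fderiv ℝ f x)),
    ContinuousAlternatingMap.alternatizeUncurryFin_fderivCompContinuousLinearMap_eq_zero, add_zero]
  · ext v
    have : ∀ w, fderiv ℝ f x (P w) = P (fderiv ℝ f x w) := fun w =>
      (DFunLike.congr_fun hP.self_of_nhds w).symm
    simp +unfoldPartialApp [ContinuousAlternatingMap.alternatizeUncurryFin_apply, Fin.removeNth,
      Function.comp_def, this]
  -- Differentiating the commutation relation shows that the second derivative of `f` commutes with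
  -- `P` in its last argument. With the symmetry of second derivatives, `(u, w) ↦ D²f(P u, w)` is
  -- symmetric, so the term containing it is killed by alternation.
  · have key : ∀ u w, fderiv ℝ (fderiv ℝ f) x u (P w) = P (fderiv ℝ (fderiv ℝ f) x u w) := by
      intro u w
      have h1 : (fun z => fderiv ℝ f z (P w)) =ᶠ[𝓝 x] fun z => P (fderiv ℝ f z w) := by
        filter_upwards [hP] with z hz
        exact (DFunLike.congr_fun hz w).symm
      have h2 := h1.fderiv_eq (𝕜 := ℝ)
      have h3 : fderiv ℝ (fun z => fderiv ℝ f z (P w)) x u = fderiv ℝ (fderiv ℝ f) x u (P w) := by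
        rw [(hd2f.hasFDerivAt.clm_apply (hasFDerivAt_const (P w) x)).fderiv]; simp
      have h4 : fderiv ℝ (fun z => P (fderiv ℝ f z w)) x u = P (fderiv ℝ (fderiv ℝ f) x u w) := by
        have h5 : HasFDerivAt (fun z => P (fderiv ℝ f z w)) _ x :=
          P.hasFDerivAt.comp x (hd2f.hasFDerivAt.clm_apply (hasFDerivAt_const w x))
        rw [h5.fderiv]; simp
      rw [← h3, h2, h4]
    intro u w
    change fderiv ℝ (fderiv ℝ f) x (P u) w = fderiv ℝ (fderiv ℝ f) x (P w) u
    rw [hsymm (P u) w, key, hsymm (P w) u, key, hsymm w u]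

end Pullback

theorem isManifold_one_of_infty {V : Type*} [NormedAddCommGroup V] [NormedSpace ℝ V]
    {H : Type*} [TopologicalSpace H] {J : ModelWithCorners ℝ V H}
    {M : Type*} [TopologicalSpace M] [ChartedSpace H M] [IsManifold J ∞ M] : IsManifold J 1 M :=
  IsManifold.of_le (n := ∞) (by simp)

attribute [local instance] isManifold_one_of_infty

/-! ### Forms and exterior derivatives in charts -/

section Charts

variable {V : Type*} [NormedAddCommGroup V] [NormedSpace ℝ V]
  {H : Type*} [TopologicalSpace H] {J : ModelWithCorners ℝ V H} [J.Boundaryless]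
  {M : Type*} [TopologicalSpace M] [ChartedSpace H M] [IsManifold J ∞ M]

variable (J) in
/-- The derivative of the inverse of the preferred chart at `p₀`. -/
abbrev chartInv (p₀ : M) (y : V) : V →L[ℝ] TangentSpace J ((extChartAt J p₀).symm y) :=
  mfderiv 𝓘(ℝ, V) J (extChartAt J p₀).symm y

variable (J) in
/-- The derivative of the preferred chart at `p₀`. -/
abbrev chartDer (p₀ p : M) : TangentSpace J p →L[ℝ] V :=
  mfderiv J 𝓘(ℝ, V) (extChartAt J p₀) p

variable (J) in
/-- The change of coordinates from the chart at `p` to the chart at `p₀`. -/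
abbrev transition (p₀ p : M) : V → V := extChartAt J p₀ ∘ (extChartAt J p).symm

theorem chartDer_chartInv {p₀ : M} {y : V} (hy : y ∈ (extChartAt J p₀).target) (v : V) :
    chartDer J p₀ ((extChartAt J p₀).symm y) (chartInv J p₀ y v) = v := by
  have h := mfderiv_extChartAt_comp_mfderivWithin_extChartAt_symm hy
  rw [J.range_eq_univ, mfderivWithin_univ] at h
  exact DFunLike.congr_fun h v

theorem chartInv_chartDer {p₀ : M} {y : V} (hy : y ∈ (extChartAt J p₀).target)
    (v : TangentSpace J ((extChartAt J p₀).symm y)) :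
    chartInv J p₀ y (chartDer J p₀ ((extChartAt J p₀).symm y) v) = v := by
  have h := mfderivWithin_extChartAt_symm_comp_mfderiv_extChartAt hy
  rw [J.range_eq_univ, mfderivWithin_univ] at h
  exact DFunLike.congr_fun h v

theorem mdifferentiableAt_chartSymm {p₀ : M} {y : V} (hy : y ∈ (extChartAt J p₀).target) :
    MDifferentiableAt 𝓘(ℝ, V) J (extChartAt J p₀).symm y := by
  have := mdifferentiableWithinAt_extChartAt_symm hy
  rwa [J.range_eq_univ, mdifferentiableWithinAt_univ] at this

theorem mdifferentiableAt_chart {p₀ p : M} (hp : p ∈ (extChartAt J p₀).source) :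
    MDifferentiableAt J 𝓘(ℝ, V) (extChartAt J p₀) p := by
  rw [extChartAt_source] at hp
  exact mdifferentiableAt_extChartAt hp

theorem isOpen_transition_source (p₀ p : M) :
    IsOpen ((extChartAt J p).target ∩ (extChartAt J p).symm ⁻¹' (extChartAt J p₀).source) :=
  (continuousOn_extChartAt_symm p).isOpen_inter_preimage (isOpen_extChartAt_target p)
    (isOpen_extChartAt_source p₀)

theorem contDiffAt_transition {p₀ p : M} {y : V} (hy : y ∈ (extChartAt J p).target)
    (hy' : (extChartAt J p).symm y ∈ (extChartAt J p₀).source) :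
    ContDiffAt ℝ ∞ (transition J p₀ p) y := by
  have h : ContMDiffOn 𝓘(ℝ, V) 𝓘(ℝ, V) ∞ (transition J p₀ p)
      ((extChartAt J p).target ∩ (extChartAt J p).symm ⁻¹' (extChartAt J p₀).source) := by
    refine (contMDiffOn_extChartAt (x := p₀)).comp ((contMDiffOn_extChartAt_symm p).mono
      inter_subset_left) fun z hz => ?_
    have := hz.2
    rwa [mem_preimage, extChartAt_source] at this
  exact (contMDiffOn_iff_contDiffOn.1 h).contDiffAt ((isOpen_transition_source p₀ p).mem_nhds ⟨hy, hy'⟩)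

theorem chartInv_transition {p₀ p : M} {y : V} (hy : y ∈ (extChartAt J p).target)
    (hy' : (extChartAt J p).symm y ∈ (extChartAt J p₀).source) (v : V) :
    (chartInv J p y v : V) =
      (chartInv J p₀ (transition J p₀ p y) (fderiv ℝ (transition J p₀ p) y v) : V) := by
  have hev : (extChartAt J p).symm =ᶠ[𝓝 y] (extChartAt J p₀).symm ∘ transition J p₀ p := by
    filter_upwards [(isOpen_transition_source p₀ p).mem_nhds ⟨hy, hy'⟩] with z hz
    exact ((extChartAt J p₀).left_inv hz.2).symm
  have hτ : DifferentiableAt ℝ (transition J p₀ p) y :=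
    (contDiffAt_transition hy hy').differentiableAt (by simp)
  have h1 := hev.mfderiv_eq (I := 𝓘(ℝ, V)) (I' := J)
  have h2 := mfderiv_comp y (I := 𝓘(ℝ, V)) (I' := 𝓘(ℝ, V)) (I'' := J)
    (mdifferentiableAt_chartSymm (J := J) ((extChartAt J p₀).map_source hy'))
    hτ.mdifferentiableAt
  rw [mfderiv_eq_fderiv] at h2
  exact (DFunLike.congr_fun h1 v).trans (DFunLike.congr_fun h2 v)

theorem fderiv_transition_chartDer {p₀ p q : M} (hq : q ∈ (extChartAt J p).source)
    (hq' : q ∈ (extChartAt J p₀).source) (v : TangentSpace J q) :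
    fderiv ℝ (transition J p₀ p) (extChartAt J p q) (chartDer J p q v) = chartDer J p₀ q v := by
  have hev : transition J p₀ p ∘ extChartAt J p =ᶠ[𝓝 q] extChartAt J p₀ := by
    filter_upwards [(isOpen_extChartAt_source (I := J) p).mem_nhds hq] with z hz
    rw [Function.comp_apply, transition, Function.comp_apply, (extChartAt J p).left_inv hz]
  have hτ : DifferentiableAt ℝ (transition J p₀ p) (extChartAt J p q) :=
    (contDiffAt_transition ((extChartAt J p).map_source hq)
      (by rwa [(extChartAt J p).left_inv hq])).differentiableAt (by simp)
  have h1 := hev.mfderiv_eq (I := J) (I' := 𝓘(ℝ, V))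
  have h2 := mfderiv_comp q (I := J) (I' := 𝓘(ℝ, V)) (I'' := 𝓘(ℝ, V))
    hτ.mdifferentiableAt (mdifferentiableAt_chart hq)
  rw [mfderiv_eq_fderiv] at h2
  exact (DFunLike.congr_fun h2 v).symm.trans (DFunLike.congr_fun h1 v)

/-- All tangent spaces are copies of `V`, so arguments at two points that are only propositionally
equal, such as `p` and the image of its coordinates, can be compared in `V`. -/
theorem formField_apply_congr {k : ℕ} (η : FormField J M k) {p q : M} (h : p = q)
    {v : Fin k → TangentSpace J p} {w : Fin k → TangentSpace J q}
    (hvw : ∀ j, (v j : V) = (w j : V)) : η p v = η q w := by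
  subst h
  have : v = w := funext hvw
  rw [this]

theorem chartRep_transition {k : ℕ} (η : FormField J M k) {p₀ p : M} {y : V}
    (hy : y ∈ (extChartAt J p).target)
    (hy' : (extChartAt J p).symm y ∈ (extChartAt J p₀).source) :
    chartRep J p η y = (chartRep J p₀ η (transition J p₀ p y)).compContinuousLinearMap
      (fderiv ℝ (transition J p₀ p) y) := by
  ext v
  exact formField_apply_congr η ((extChartAt J p₀).left_inv hy').symm
    fun j => chartInv_transition hy hy' (v j)

theorem chartRep_chartDer {k : ℕ} (η : FormField J M k) {p₀ p : M}
    (hp : p ∈ (extChartAt J p₀).source) :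
    (chartRep J p₀ η (extChartAt J p₀ p)).compContinuousLinearMap (chartDer J p₀ p) = η p := by
  ext v
  refine formField_apply_congr η ((extChartAt J p₀).left_inv hp) fun j => ?_
  obtain ⟨y, hy, rfl⟩ : ∃ y, y ∈ (extChartAt J p₀).target ∧ (extChartAt J p₀).symm y = p :=
    ⟨_, (extChartAt J p₀).map_source hp, (extChartAt J p₀).left_inv hp⟩
  have := chartInv_chartDer hy (v j)
  rw [(extChartAt J p₀).right_inv hy]
  exact this

theorem formField_ext_chart {k : ℕ} {η ζ : FormField J M k} {p₀ p : M}
    (hp : p ∈ (extChartAt J p₀).source)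
    (h : chartRep J p₀ η (extChartAt J p₀ p) = chartRep J p₀ ζ (extChartAt J p₀ p)) :
    η p = ζ p := by
  rw [← chartRep_chartDer η hp, h, chartRep_chartDer ζ hp]

variable (J) in
/-- The field of forms with coefficients `c` in the preferred chart at `p₀`. -/
def fieldOf {k : ℕ} (p₀ : M) (c : V → V [⋀^Fin k]→L[ℝ] ℝ) : FormField J M k := fun p =>
  (c (extChartAt J p₀ p)).compContinuousLinearMap (chartDer J p₀ p)

theorem chartRep_fieldOf {k : ℕ} {p₀ : M} (c : V → V [⋀^Fin k]→L[ℝ] ℝ) {y : V}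
    (hy : y ∈ (extChartAt J p₀).target) : chartRep J p₀ (fieldOf J p₀ c) y = c y := by
  ext v
  change c (extChartAt J p₀ ((extChartAt J p₀).symm y)) _ = _
  rw [(extChartAt J p₀).right_inv hy]
  congr 1
  funext j
  exact chartDer_chartInv hy (v j)

theorem chartRep_eq_of_eq {k : ℕ} {η ζ : FormField J M k} {p₀ : M} {y : V}
    (h : η ((extChartAt J p₀).symm y) = ζ ((extChartAt J p₀).symm y)) :
    chartRep J p₀ η y = chartRep J p₀ ζ y := by
  rw [chartRep, chartRep, h]

variable (J) in
/-- A field of forms is smooth near `p`. -/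
def SmoothFormAt {k : ℕ} (η : FormField J M k) (p : M) : Prop :=
  ContDiffAt ℝ ∞ (chartRep J p η) (extChartAt J p p)

theorem extChartAt_symm_tendsto {p₀ p : M} (hp : p ∈ (extChartAt J p₀).source) :
    Filter.Tendsto (extChartAt J p₀).symm (𝓝 (extChartAt J p₀ p)) (𝓝 p) := by
  have := continuousAt_extChartAt_symm'' ((extChartAt J p₀).map_source hp)
  rwa [ContinuousAt, (extChartAt J p₀).left_inv hp] at this

variable [FiniteDimensional ℝ V]

/-- The two coordinate representations differ by pull-back under the smooth transition map, so
smoothness at a point may be checked in any chart around it. -/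
theorem ContDiffAt.chartRep_change {k : ℕ} {η : FormField J M k} {p₀ p q : M}
    (hq : q ∈ (extChartAt J p).source) (hq' : q ∈ (extChartAt J p₀).source)
    (h : ContDiffAt ℝ ∞ (chartRep J p₀ η) (extChartAt J p₀ q)) :
    ContDiffAt ℝ ∞ (chartRep J p η) (extChartAt J p q) := by
  have hy := (extChartAt J p).map_source hq
  have hy' : (extChartAt J p).symm (extChartAt J p q) ∈ (extChartAt J p₀).source := by
    rwa [(extChartAt J p).left_inv hq]
  have hτ := contDiffAt_transition hy hy'
  have hev : chartRep J p η =ᶠ[𝓝 (extChartAt J p q)] fun y =>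
      (chartRep J p₀ η (transition J p₀ p y)).compContinuousLinearMap
      (fderiv ℝ (transition J p₀ p) y) := by
    filter_upwards [(isOpen_transition_source p₀ p).mem_nhds ⟨hy, hy'⟩] with z hz
    exact chartRep_transition η hz.1 hz.2
  refine ContDiffAt.congr_of_eventuallyEq (ContDiffAt.form_comp
    (c := fun y : V => chartRep J p₀ η (transition J p₀ p y)) (A := fderiv ℝ (transition J p₀ p))
    ?_ ?_) hev
  · have h' : ContDiffAt ℝ ∞ (chartRep J p₀ η) (transition J p₀ p (extChartAt J p q)) := by
      rwa [transition, Function.comp_apply, (extChartAt J p).left_inv hq]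
    exact h'.comp (extChartAt J p q) hτ
  · exact hτ.fderiv_right (by simp)

theorem smoothFormAt_iff {k : ℕ} {η : FormField J M k} {p₀ p : M}
    (hp : p ∈ (extChartAt J p₀).source) :
    SmoothFormAt J η p ↔ ContDiffAt ℝ ∞ (chartRep J p₀ η) (extChartAt J p₀ p) :=
  ⟨fun h => ContDiffAt.chartRep_change hp (mem_extChartAt_source p) h,
    fun h => ContDiffAt.chartRep_change (mem_extChartAt_source p) hp h⟩

theorem isSmoothForm_iff {k : ℕ} {η : FormField J M k} :
    IsSmoothForm J η ↔ ∀ p, SmoothFormAt J η p := by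
  constructor
  · intro h p
    exact (h p).contDiffAt (extChartAt_target_mem_nhds p)
  · intro h p₀ y hy
    have := (smoothFormAt_iff (p₀ := p₀) ((extChartAt J p₀).map_target hy)).1 (h _)
    rw [(extChartAt J p₀).right_inv hy] at this
    exact this.contDiffWithinAt

theorem IsSmoothForm.contDiffAt {k : ℕ} {η : FormField J M k} (h : IsSmoothForm J η) {p₀ : M}
    {y : V} (hy : y ∈ (extChartAt J p₀).target) : ContDiffAt ℝ ∞ (chartRep J p₀ η) y :=
  (h p₀).contDiffAt ((isOpen_extChartAt_target p₀).mem_nhds hy)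

theorem chartRep_eventuallyEq {k : ℕ} {η ζ : FormField J M k} {p₀ p : M}
    (hp : p ∈ (extChartAt J p₀).source) (h : ∀ᶠ q in 𝓝 p, η q = ζ q) :
    chartRep J p₀ η =ᶠ[𝓝 (extChartAt J p₀ p)] chartRep J p₀ ζ := by
  filter_upwards [(extChartAt_symm_tendsto hp).eventually h] with y hy
  exact chartRep_eq_of_eq hy

theorem SmoothFormAt.congr {k : ℕ} {η ζ : FormField J M k} {p : M} (hη : SmoothFormAt J η p)
    (h : ∀ᶠ q in 𝓝 p, ζ q = η q) : SmoothFormAt J ζ p :=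
  ContDiffAt.congr_of_eventuallyEq hη (chartRep_eventuallyEq (mem_extChartAt_source p) h)

theorem smoothFormAt_fieldOf {k : ℕ} {p₀ p : M} {c : V → V [⋀^Fin k]→L[ℝ] ℝ}
    (hp : p ∈ (extChartAt J p₀).source) (hc : ContDiffAt ℝ ∞ c (extChartAt J p₀ p)) :
    SmoothFormAt J (fieldOf J p₀ c) p := by
  rw [smoothFormAt_iff hp]
  refine hc.congr_of_eventuallyEq ?_
  filter_upwards [(isOpen_extChartAt_target p₀).mem_nhds ((extChartAt J p₀).map_source hp)] with y hy
  exact chartRep_fieldOf c hy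

/-- Multiplication of a field of forms by a function. -/
def smulField {k : ℕ} (f : M → ℝ) (η : FormField J M k) : FormField J M k := fun p => f p • η p

theorem contDiffAt_comp_chartSymm {f : M → ℝ} {p₀ : M} {y : V}
    (hy : y ∈ (extChartAt J p₀).target)
    (hf : ContMDiffAt J 𝓘(ℝ, ℝ) ∞ f ((extChartAt J p₀).symm y)) :
    ContDiffAt ℝ ∞ (fun z => f ((extChartAt J p₀).symm z)) y := by
  have h1 : ContMDiffAt 𝓘(ℝ, V) J ∞ (extChartAt J p₀).symm y :=
    (contMDiffOn_extChartAt_symm p₀).contMDiffAt ((isOpen_extChartAt_target p₀).mem_nhds hy)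
  exact (ContMDiffAt.comp y hf h1).contDiffAt

theorem SmoothFormAt.smul {k : ℕ} {f : M → ℝ} {η : FormField J M k} {p : M}
    (hf : ContMDiffAt J 𝓘(ℝ, ℝ) ∞ f p) (hη : SmoothFormAt J η p) :
    SmoothFormAt J (smulField f η) p := by
  refine ContDiffAt.smul (contDiffAt_comp_chartSymm (mem_extChartAt_target p) ?_) hη
  rwa [(extChartAt J p).left_inv (mem_extChartAt_source p)]

variable (J M) in
/-- The linear map `P` commutes with all changes of coordinates. -/
def CommutesWithCharts (P : V →L[ℝ] V) : Prop :=
  ∀ (p₀ p : M) (y : V), y ∈ (extChartAt J p).target →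
    (extChartAt J p).symm y ∈ (extChartAt J p₀).source →
    P.comp (fderiv ℝ (transition J p₀ p) y) = (fderiv ℝ (transition J p₀ p) y).comp P

theorem commutesWithCharts_id : CommutesWithCharts J M (ContinuousLinearMap.id ℝ V) :=
  fun _ _ _ _ _ => by simp

/-- The full exterior derivative is the case `P = id`; the theory of adjoints is therefore developed
once, for a general `P`. -/
theorem extD_eq_extDAlong {k : ℕ} (η : FormField J M k) :
    extD J η = extDAlong J (ContinuousLinearMap.id ℝ V) η := rfl

/-- The derivative is defined at each point in that point's own chart, so a priori the chart moves
with the point. Naturality under the transition maps allows a single chart to be kept fixed, and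
this is what makes the result smooth. -/
theorem chartRep_extDAlong {P : V →L[ℝ] V} (hP : CommutesWithCharts J M P) {k : ℕ}
    {η : FormField J M k} {p₀ : M} {y : V} (hy : y ∈ (extChartAt J p₀).target)
    (hη : ContDiffAt ℝ ∞ (chartRep J p₀ η) y) :
    chartRep J p₀ (extDAlong J P η) y =
      ContinuousAlternatingMap.alternatizeUncurryFin ((fderiv ℝ (chartRep J p₀ η) y).comp P) := by
  obtain ⟨q, hq, rfl⟩ : ∃ q, q ∈ (extChartAt J p₀).source ∧ extChartAt J p₀ q = y :=
    ⟨_, (extChartAt J p₀).map_target hy, (extChartAt J p₀).right_inv hy⟩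
  have hz := mem_extChartAt_target (I := J) q
  have hz' : (extChartAt J q).symm (extChartAt J q q) ∈ (extChartAt J p₀).source := by
    rwa [(extChartAt J q).left_inv (mem_extChartAt_source q)]
  have hτ := contDiffAt_transition hz hz'
  have hτz : transition J p₀ q (extChartAt J q q) = extChartAt J p₀ q := by
    rw [transition, Function.comp_apply, (extChartAt J q).left_inv (mem_extChartAt_source q)]
  have hev : chartRep J q η =ᶠ[𝓝 (extChartAt J q q)] fun y =>
      (chartRep J p₀ η (transition J p₀ q y)).compContinuousLinearMap
      (fderiv ℝ (transition J p₀ q) y) := by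
    filter_upwards [(isOpen_transition_source p₀ q).mem_nhds ⟨hz, hz'⟩] with z hz
    exact chartRep_transition η hz.1 hz.2
  have key := alternatize_fderiv_comp_pullback (x := extChartAt J q q) P
    (c := chartRep J p₀ η) (f := transition J p₀ q)
    (by rw [hτz]; exact hη.differentiableAt (by simp))
    (hτ.of_le (WithTop.coe_le_coe.2 le_top))
    (by
      filter_upwards [(isOpen_transition_source p₀ q).mem_nhds ⟨hz, hz'⟩] with z hz
      exact hP p₀ q z hz.1 hz.2)
  rw [← hev.fderiv_eq, hτz] at key
  have h2 : extDAlong J P η q = fieldOf J p₀ (fun y =>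
      ContinuousAlternatingMap.alternatizeUncurryFin ((fderiv ℝ (chartRep J p₀ η) y).comp P)) q := by
    rw [extDAlong, key, fieldOf]
    ext v
    exact congrArg _ (funext fun j => fderiv_transition_chartDer (mem_extChartAt_source q) hq (v j))
  have h3 : (extChartAt J p₀).symm (extChartAt J p₀ q) = q := (extChartAt J p₀).left_inv hq
  rw [← chartRep_fieldOf (J := J) (p₀ := p₀) (fun y =>
      ContinuousAlternatingMap.alternatizeUncurryFin ((fderiv ℝ (chartRep J p₀ η) y).comp P)) hy]
  refine chartRep_eq_of_eq ?_
  rw [h3]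
  exact h2

theorem contDiffAt_alternatize_fderiv (P : V →L[ℝ] V) {k : ℕ} {c : V → V [⋀^Fin k]→L[ℝ] ℝ} {y : V}
    (hc : ContDiffAt ℝ ∞ c y) : ContDiffAt ℝ ∞ (fun y =>
      ContinuousAlternatingMap.alternatizeUncurryFin ((fderiv ℝ c y).comp P)) y := by
  have h1 : ContDiffAt ℝ ∞ (fun z => (fderiv ℝ c z).comp P) y :=
    (hc.fderiv_right (m := ∞) (by simp)).clm_comp contDiffAt_const
  exact (ContinuousLinearMap.contDiff (𝕜 := ℝ) (E := V →L[ℝ] V [⋀^Fin k]→L[ℝ] ℝ)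
    (F := V [⋀^Fin (k + 1)]→L[ℝ] ℝ)
    (ContinuousAlternatingMap.alternatizeUncurryFinCLM (n := k) ℝ V ℝ)).contDiffAt.comp y h1

theorem IsSmoothForm.extDAlong {P : V →L[ℝ] V} (hP : CommutesWithCharts J M P) {k : ℕ}
    {η : FormField J M k} (hη : IsSmoothForm J η) : IsSmoothForm J (extDAlong J P η) := by
  intro p₀ y hy
  refine ContDiffAt.contDiffWithinAt ?_
  refine (contDiffAt_alternatize_fderiv P (hη.contDiffAt hy)).congr_of_eventuallyEq ?_
  filter_upwards [(isOpen_extChartAt_target p₀).mem_nhds hy] with z hz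
  exact chartRep_extDAlong hP hz (hη.contDiffAt hz)

end Charts

/-! ### Riemannian tensors: trivial kernel and the pairing in coordinates -/

section Riemannian

variable {V : Type*} [NormedAddCommGroup V] [NormedSpace ℝ V] [FiniteDimensional ℝ V]
  {H : Type*} [TopologicalSpace H] {J : ModelWithCorners ℝ V H} [J.Boundaryless]
  {M : Type*} [TopologicalSpace M] [ChartedSpace H M] [IsManifold J ∞ M]

/-- The coefficients of a symmetric tensor in the preferred chart at `p₀`. -/
def chartMetric (b : SymTensor J M) (p₀ : M) (y : V) : V →L[ℝ] V →L[ℝ] ℝ :=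
  LinearMap.toContinuousBilinearMap ((b.inner ((extChartAt J p₀).symm y)).compl₁₂
    (chartInv J p₀ y : V →ₗ[ℝ] TangentSpace J ((extChartAt J p₀).symm y))
    (chartInv J p₀ y : V →ₗ[ℝ] TangentSpace J ((extChartAt J p₀).symm y)))

theorem chartMetric_apply (b : SymTensor J M) (p₀ : M) (y v w : V) :
    chartMetric b p₀ y v w =
      b.inner ((extChartAt J p₀).symm y) (chartInv J p₀ y v) (chartInv J p₀ y w) := rfl

/-- A symmetric tensor which is a smooth Riemannian metric. -/
structure IsRiemannian (b : SymTensor J M) : Prop where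
  pos : ∀ (p : M) (v : TangentSpace J p), v ≠ 0 → 0 < b.inner p v v
  smooth : ∀ (p₀ : M) (v w : V),
    ContDiffOn ℝ ∞ (fun y => chartMetric b p₀ y v w) (extChartAt J p₀).target

namespace IsRiemannian

variable {b : SymTensor J M} (hb : IsRiemannian b)
include hb

theorem isInner {p₀ : M} {y : V} (hy : y ∈ (extChartAt J p₀).target) :
    IsInner (chartMetric b p₀ y) where
  symm v w := b.symm _ _ _
  pos v hv := by
    refine hb.pos _ _ fun h => hv ?_
    rw [← chartDer_chartInv hy v]
    exact (congrArg _ h).trans (map_zero _)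

theorem contDiffAt_chartMetric {p₀ : M} {y : V} (hy : y ∈ (extChartAt J p₀).target) :
    ContDiffAt ℝ ∞ (chartMetric b p₀) y := by
  have h : ContDiffOn ℝ ∞ (chartMetric b p₀) (extChartAt J p₀).target :=
    contDiffOn_clm_apply.2 fun v => contDiffOn_clm_apply.2 fun w => hb.smooth p₀ v w
  exact h.contDiffAt ((isOpen_extChartAt_target p₀).mem_nhds hy)

theorem contDiffAt_sharpL {p₀ : M} {y : V} (hy : y ∈ (extChartAt J p₀).target) :
    ContDiffAt ℝ ∞ (fun z => sharpL (chartMetric b p₀ z)) y := by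
  have h := (hb.isInner hy).isInvertible.contDiffAt_map_inverse (n := ∞)
  exact h.comp y (hb.contDiffAt_chartMetric hy)

theorem kernel_eq_bot (p : M) : b.kernel p = ⊥ := by
  rw [SymTensor.kernel, LinearMap.ker_eq_bot']
  intro v hv
  by_contra h
  have := hb.pos p v h
  rw [hv] at this
  simp at this

theorem isHorizontal {k : ℕ} (η : FormField J M k) : b.IsHorizontal η := by
  rintro p v ⟨j, hj⟩
  rw [hb.kernel_eq_bot] at hj
  exact (η p).map_coord_zero j hj

/-- With trivial kernel the projection onto `Hor` is an isomorphism, so the representatives and the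
inverse musical map in the definition of the pairing are forced. The pairing is then a contraction
on the tangent space itself, to which `sum_dualPair_eq` applies. -/
theorem pairing_eq_of_dual {k : ℕ} (p : M) (α β : TangentSpace J p [⋀^Fin k]→L[ℝ] ℝ)
    {ι : Type*} [Fintype ι] (u : Basis ι ℝ (TangentSpace J p)) (u' : ι → TangentSpace J p)
    (hu : IsDualPair (fun v w => b.inner p v w) u u') :
    b.pairing p α β = ((k.factorial : ℝ))⁻¹ *
      ∑ f : Fin k → ι, α (fun j => u (f j)) * β (fun j => u' (f j)) := by
  have : FiniteDimensional ℝ (TangentSpace J p) := inferInstanceAs (FiniteDimensional ℝ V)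
  have hbot := hb.kernel_eq_bot p
  let r : TangentSpace J p ≃ₗ[ℝ] b.Hor p :=
    LinearEquiv.ofBijective (b.kernel p).mkQ
      ⟨by rw [← LinearMap.ker_eq_bot, Submodule.ker_mkQ, hbot], (b.kernel p).mkQ_surjective⟩
  have hrep (h : b.Hor p) : b.rep p h = r.symm h := by
    apply r.injective
    rw [r.apply_symm_apply]
    exact Function.surjInv_eq (b.kernel p).mkQ_surjective h
  have hflat (v w : TangentSpace J p) : b.flat p (r v) (r w) = b.inner p v w := rfl
  have hinj : Function.Injective (b.flat p) := by
    rw [← LinearMap.ker_eq_bot, LinearMap.ker_eq_bot']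
    intro h h0
    obtain ⟨v, rfl⟩ := r.surjective h
    by_contra hne
    have h1 := hb.pos p v (fun hv => hne (by rw [hv, map_zero]))
    rw [← hflat, h0] at h1
    simp at h1
  -- Surjectivity is what makes `sharp`, defined through `Function.invFun`, an actual right inverse.
  have hsurj : Function.Surjective (b.flat p) :=
    (LinearMap.injective_iff_surjective_of_finrank_eq_finrank
      (Subspace.dual_finrank_eq (K := ℝ) (V := b.Hor p)).symm).1 hinj
  have hsharp (φ : Dual ℝ (b.Hor p)) : b.flat p (b.sharp p φ) = φ :=
    Function.rightInverse_invFun hsurj φ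
  rw [SymTensor.pairing]
  congr 1
  have key := sum_dualPair_eq (b.inner p) (fun v hv => by
      by_contra h
      exact (hb.pos p v h).ne' (hv v))
    ((finBasis ℝ (b.Hor p)).map r.symm)
    (fun i => b.rep p (b.sharp p ((finBasis ℝ (b.Hor p)).coord i))) u u' (fun i j => by
      simp only [hrep, Basis.map_apply]
      rw [← hflat, r.apply_symm_apply, r.apply_symm_apply, hsharp, Basis.coord_apply,
        Basis.repr_self, Finsupp.single_apply, Finsupp.single_apply]
      simp only [eq_comm]) hu α.toMultilinearMap β.toMultilinearMap
  refine Eq.trans (Finset.sum_congr rfl fun f _ => ?_) key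
  simp only [hrep]
  rfl

/-- The derivative of the inverse chart carries the fixed basis of `V` and its metric dual to a dual
pair in the tangent space. -/
theorem pairing_chart {k : ℕ} (η ζ : FormField J M k) {p₀ : M} {y : V}
    (hy : y ∈ (extChartAt J p₀).target) :
    b.pairing ((extChartAt J p₀).symm y) (η ((extChartAt J p₀).symm y))
      (ζ ((extChartAt J p₀).symm y)) =
      formPair (chartMetric b p₀ y) (chartRep J p₀ η y) (chartRep J p₀ ζ y) := by
  let D : V ≃ₗ[ℝ] TangentSpace J ((extChartAt J p₀).symm y) :=
    LinearEquiv.ofLinearMap (chartInv J p₀ y : V →ₗ[ℝ] TangentSpace J ((extChartAt J p₀).symm y))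
      (chartDer J p₀ ((extChartAt J p₀).symm y) : TangentSpace J ((extChartAt J p₀).symm y) →ₗ[ℝ] V)
      (LinearMap.ext fun v => chartInv_chartDer hy v)
      (LinearMap.ext fun v => chartDer_chartInv hy v)
  rw [hb.pairing_eq_of_dual _ _ _ ((finBasis ℝ V).map D)
    (fun j => D (sharpL (chartMetric b p₀ y) (coord V j)))
    (fun i j => (hb.isInner hy).isDualPair i j)]
  rfl

theorem pairing_eq {k : ℕ} (η ζ : FormField J M k) {p₀ p : M}
    (hp : p ∈ (extChartAt J p₀).source) :
    b.pairing p (η p) (ζ p) = formPair (chartMetric b p₀ (extChartAt J p₀ p))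
      (chartRep J p₀ η (extChartAt J p₀ p)) (chartRep J p₀ ζ (extChartAt J p₀ p)) := by
  obtain ⟨y, hy, rfl⟩ : ∃ y, y ∈ (extChartAt J p₀).target ∧ (extChartAt J p₀).symm y = p :=
    ⟨_, (extChartAt J p₀).map_source hp, (extChartAt J p₀).left_inv hp⟩
  rw [hb.pairing_chart η ζ hy, (extChartAt J p₀).right_inv hy]

theorem contDiffAt_formPair {k : ℕ} {c c' : V → V [⋀^Fin k]→L[ℝ] ℝ} {p₀ : M} {y : V}
    (hy : y ∈ (extChartAt J p₀).target) (hc : ContDiffAt ℝ ∞ c y) (hc' : ContDiffAt ℝ ∞ c' y) :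
    ContDiffAt ℝ ∞ (fun z => formPair (chartMetric b p₀ z) (c z) (c' z)) y := by
  refine contDiffAt_const.mul (ContDiffAt.sum fun f _ => (contDiffAt_form_iff.1 hc _).mul ?_)
  exact ContDiffAt.form_apply (v := fun j z => sharpL (chartMetric b p₀ z) (coord V (f j))) hc'
    fun j => (hb.contDiffAt_sharpL hy).clm_apply contDiffAt_const

theorem continuousAt_pairing {k : ℕ} {η ζ : FormField J M k} {p : M} (hη : SmoothFormAt J η p)
    (hζ : SmoothFormAt J ζ p) : ContinuousAt (fun q => b.pairing q (η q) (ζ q)) p := by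
  have h1 := (hb.contDiffAt_formPair (mem_extChartAt_target p) hη hζ).continuousAt
  have h2 : ContinuousAt ((fun z => formPair (chartMetric b p z) (chartRep J p η z)
      (chartRep J p ζ z)) ∘ extChartAt J p) p := h1.comp (continuousAt_extChartAt p)
  refine h2.congr ?_
  filter_upwards [(isOpen_extChartAt_source (I := J) p).mem_nhds (mem_extChartAt_source p)] with q hq
  exact (hb.pairing_eq η ζ hq).symm

theorem pairing_comm {k : ℕ} (η ζ : FormField J M k) (p : M) :
    b.pairing p (η p) (ζ p) = b.pairing p (ζ p) (η p) := by
  rw [hb.pairing_eq η ζ (mem_extChartAt_source p), hb.pairing_eq ζ η (mem_extChartAt_source p)]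
  exact (hb.isInner (mem_extChartAt_target p)).formPair_comm _ _

theorem pairing_self_nonneg {k : ℕ} (η : FormField J M k) (p : M) :
    0 ≤ b.pairing p (η p) (η p) := by
  rw [hb.pairing_eq η η (mem_extChartAt_source p)]
  exact (hb.isInner (mem_extChartAt_target p)).formPair_self_nonneg _

theorem pairing_self_eq_zero {k : ℕ} {η : FormField J M k} {p : M}
    (h : b.pairing p (η p) (η p) = 0) : η p = 0 := by
  rw [hb.pairing_eq η η (mem_extChartAt_source p)] at h
  have h2 := (hb.isInner (mem_extChartAt_target p)).formPair_self_eq_zero h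
  rw [← chartRep_chartDer η (mem_extChartAt_source p), h2]
  ext v; rfl

end IsRiemannian

theorem pairing_add_left (b : SymTensor J M) {k : ℕ} (p : M)
    (α α' β : TangentSpace J p [⋀^Fin k]→L[ℝ] ℝ) :
    b.pairing p (α + α') β = b.pairing p α β + b.pairing p α' β := by
  simp [SymTensor.pairing, add_mul, Finset.sum_add_distrib, mul_add]

theorem pairing_add_right (b : SymTensor J M) {k : ℕ} (p : M)
    (α β β' : TangentSpace J p [⋀^Fin k]→L[ℝ] ℝ) :
    b.pairing p α (β + β') = b.pairing p α β + b.pairing p α β' := by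
  simp [SymTensor.pairing, Finset.sum_add_distrib, mul_add]

theorem pairing_smul_left (b : SymTensor J M) {k : ℕ} (p : M) (c : ℝ)
    (α β : TangentSpace J p [⋀^Fin k]→L[ℝ] ℝ) :
    b.pairing p (c • α) β = c * b.pairing p α β := by
  simp only [SymTensor.pairing, ContinuousAlternatingMap.smul_apply, smul_eq_mul, mul_assoc,
    ← Finset.mul_sum]
  ring

theorem pairing_zero_left (b : SymTensor J M) {k : ℕ} (p : M)
    (β : TangentSpace J p [⋀^Fin k]→L[ℝ] ℝ) : b.pairing p 0 β = 0 := by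
  simp [SymTensor.pairing]

theorem pairing_zero_right (b : SymTensor J M) {k : ℕ} (p : M)
    (β : TangentSpace J p [⋀^Fin k]→L[ℝ] ℝ) : b.pairing p β 0 = 0 := by
  simp [SymTensor.pairing]

end Riemannian

/-! ### The codifferential in coordinates -/

section LocalCodifferential

variable {V : Type*} [NormedAddCommGroup V] [NormedSpace ℝ V] [FiniteDimensional ℝ V]

/-- The linear map sending the vectors of the fixed basis to the metric duals of the dual basis. -/
def raise (B : V →L[ℝ] V →L[ℝ] ℝ) : V →L[ℝ] V := (sharpL B).comp (basisFlat V : V →L[ℝ] V →L[ℝ] ℝ)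

/-- The inverse of `raise B`. -/
def lower (B : V →L[ℝ] V →L[ℝ] ℝ) : V →L[ℝ] V :=
  ((basisFlat V).symm : (V →L[ℝ] ℝ) →L[ℝ] V).comp B

theorem raise_basis (B : V →L[ℝ] V →L[ℝ] ℝ) (j : Fin (finrank ℝ V)) :
    raise B (finBasis ℝ V j) = sharpL B (coord V j) := by
  rw [raise, ContinuousLinearMap.comp_apply, ContinuousLinearEquiv.coe_coe, basisFlat_basis]

theorem IsInner.lower_sharpL {B : V →L[ℝ] V →L[ℝ] ℝ} (hB : IsInner B) (j : Fin (finrank ℝ V)) :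
    lower B (sharpL B (coord V j)) = finBasis ℝ V j := by
  rw [lower, ContinuousLinearMap.comp_apply, hB.apply_sharpL, ContinuousLinearEquiv.coe_coe,
    ContinuousLinearEquiv.symm_apply_eq, basisFlat_basis]

/-- The components of the density whose divergence is the codifferential along `P`. -/
def flux (G : V → V →L[ℝ] V →L[ℝ] ℝ) (w : V → ℝ) (P : V →L[ℝ] V) {k : ℕ}
    (β : V → V [⋀^Fin (k + 1)]→L[ℝ] ℝ) (j : Fin (finrank ℝ V)) (y : V) : V [⋀^Fin k]→L[ℝ] ℝ :=
  w y • ((β y).curryLeft (sharpL (G y) ((coord V j).comp P))).compContinuousLinearMap (raise (G y))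

/-- The codifferential along `P` in coordinates, for the metric `G` and the density `w`. -/
def codiff (G : V → V →L[ℝ] V →L[ℝ] ℝ) (w : V → ℝ) (P : V →L[ℝ] V) {k : ℕ}
    (β : V → V [⋀^Fin (k + 1)]→L[ℝ] ℝ) (y : V) : V [⋀^Fin k]→L[ℝ] ℝ :=
  (-(w y)⁻¹ • ∑ j, fderiv ℝ (flux G w P β j) y (finBasis ℝ V j)).compContinuousLinearMap
    (lower (G y))

variable {G : V → V →L[ℝ] V →L[ℝ] ℝ} {w : V → ℝ} {P : V →L[ℝ] V} {k : ℕ}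

/-- This is the form `∑ⱼ (dyʲ ∘ P) ∧ ∂ⱼ` of the derivative, on which the adjointness of wedge and
contraction can act. -/
theorem alternatize_comp_eq_sum (a : V →L[ℝ] V [⋀^Fin k]→L[ℝ] ℝ) :
    ContinuousAlternatingMap.alternatizeUncurryFin (a.comp P) =
      ∑ j, wedge ((coord V j).comp P) (a (finBasis ℝ V j)) := by
  ext v
  simp only [ContinuousAlternatingMap.alternatizeUncurryFin_apply,
    ContinuousAlternatingMap.sum_apply, wedge_apply]
  rw [Finset.sum_comm]
  refine Finset.sum_congr rfl fun i _ => ?_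
  rw [← Finset.mul_sum, zsmul_eq_mul]
  push_cast
  congr 1
  have : a.comp P (v i) = ∑ j, coord V j (P (v i)) • a (finBasis ℝ V j) := by
    conv_lhs => rw [ContinuousLinearMap.comp_apply, ← (finBasis ℝ V).sum_repr (P (v i))]
    simp only [map_sum, map_smul]
    rfl
  refine (congrArg (fun α : V [⋀^Fin k]→L[ℝ] ℝ => α (i.removeNth v)) this).trans ?_
  simp

theorem contDiffAt_flux {β : V → V [⋀^Fin (k + 1)]→L[ℝ] ℝ} {y : V}
    (hG : ContDiffAt ℝ ∞ (fun z => sharpL (G z)) y) (hw : ContDiffAt ℝ ∞ w y)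
    (hβ : ContDiffAt ℝ ∞ β y) (j : Fin (finrank ℝ V)) : ContDiffAt ℝ ∞ (flux G w P β j) y := by
  refine hw.smul (ContDiffAt.form_comp (A := fun z => raise (G z)) ?_ ?_)
  · exact ContDiffAt.form_curryLeft hβ (hG.clm_apply contDiffAt_const)
  · exact hG.clm_comp contDiffAt_const

theorem contDiffAt_codiff {β : V → V [⋀^Fin (k + 1)]→L[ℝ] ℝ} {y : V}
    (hG : ContDiffAt ℝ ∞ G y)
    (hG' : ContDiffAt ℝ ∞ (fun z => sharpL (G z)) y) (hw : ContDiffAt ℝ ∞ w y) (hw0 : w y ≠ 0)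
    (hβ : ContDiffAt ℝ ∞ β y) : ContDiffAt ℝ ∞ (codiff G w P β) y := by
  refine ContDiffAt.form_comp (c := fun z => -(w z)⁻¹ • ∑ j, fderiv ℝ (flux G w P β j) z
    (finBasis ℝ V j)) (A := fun z => lower (G z)) ?_ ?_
  · refine (hw.inv hw0).neg.smul (ContDiffAt.sum fun j _ => ?_)
    exact ((contDiffAt_flux hG' hw hβ j).fderiv_right (m := ∞) (by simp)).clm_apply contDiffAt_const
  · exact contDiffAt_const.clm_comp hG

/-- The pointwise form of integration by parts: the difference of the two integrands is a
divergence. -/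
theorem formPair_codiff {a : V → V [⋀^Fin k]→L[ℝ] ℝ} {β : V → V [⋀^Fin (k + 1)]→L[ℝ] ℝ} {y : V}
    (hin : IsInner (G y)) (hG : ContDiffAt ℝ ∞ (fun z => sharpL (G z)) y)
    (hw : ContDiffAt ℝ ∞ w y) (hw0 : w y ≠ 0) (hβ : ContDiffAt ℝ ∞ β y) (ha : ContDiffAt ℝ ∞ a y) :
    formPair (G y) (ContinuousAlternatingMap.alternatizeUncurryFin ((fderiv ℝ a y).comp P)) (β y) *
        w y - formPair (G y) (a y) (codiff G w P β y) * w y =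
      ∑ j, fderiv ℝ (fun z => ((k.factorial : ℝ))⁻¹ * ∑ f : Fin k → Fin (finrank ℝ V),
        a z (fun i => finBasis ℝ V (f i)) * flux G w P β j z (fun i => finBasis ℝ V (f i))) y
        (finBasis ℝ V j) := by
  have hda : DifferentiableAt ℝ a y := ha.differentiableAt (by simp)
  have hdf (j) : DifferentiableAt ℝ (flux G w P β j) y :=
    (contDiffAt_flux hG hw hβ j).differentiableAt (by simp)
  have hR (j) : fderiv ℝ (fun z => ((k.factorial : ℝ))⁻¹ * ∑ f : Fin k → Fin (finrank ℝ V),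
        a z (fun i => finBasis ℝ V (f i)) * flux G w P β j z (fun i => finBasis ℝ V (f i))) y
        (finBasis ℝ V j) = ((k.factorial : ℝ))⁻¹ * ∑ f : Fin k → Fin (finrank ℝ V),
        (a y (fun i => finBasis ℝ V (f i)) *
            fderiv ℝ (flux G w P β j) y (finBasis ℝ V j) (fun i => finBasis ℝ V (f i)) +
          fderiv ℝ a y (finBasis ℝ V j) (fun i => finBasis ℝ V (f i)) *
            flux G w P β j y (fun i => finBasis ℝ V (f i))) := by
    have h1 : HasFDerivAt (fun z => ((k.factorial : ℝ))⁻¹ * ∑ f : Fin k → Fin (finrank ℝ V),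
        a z (fun i => finBasis ℝ V (f i)) * flux G w P β j z (fun i => finBasis ℝ V (f i))) _ y :=
      (HasFDerivAt.fun_sum fun f _ =>
        (hda.hasFDerivAt.continuousAlternatingMap_apply_const (fun i => finBasis ℝ V (f i))).mul
        ((hdf j).hasFDerivAt.continuousAlternatingMap_apply_const
          (fun i => finBasis ℝ V (f i)))).const_mul _
    rw [h1.fderiv]
    simp only [smul_apply, sum_apply, add_apply, smul_eq_mul,
      ContinuousLinearMap.flipAlternating_apply_apply]
    congr 1
    refine Finset.sum_congr rfl fun f _ => ?_
    ring
  simp only [hR]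
  -- The covectors `dyʲ ∘ P` are moved over to `β` as contractions. The dual basis vectors in the
  -- remaining arguments are absorbed into the flux by `raise`, so that the product rule sees only
  -- constant basis vectors.
  have h1 : formPair (G y) (ContinuousAlternatingMap.alternatizeUncurryFin
      ((fderiv ℝ a y).comp P)) (β y) * w y = ∑ j, ((k.factorial : ℝ))⁻¹ *
      ∑ f : Fin k → Fin (finrank ℝ V),
        fderiv ℝ a y (finBasis ℝ V j) (fun i => finBasis ℝ V (f i)) *
            flux G w P β j y (fun i => finBasis ℝ V (f i)) := by
    rw [alternatize_comp_eq_sum, formPair_sum_left, Finset.sum_mul]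
    refine Finset.sum_congr rfl fun j _ => ?_
    rw [formPair_wedge, formPair, mul_assoc, Finset.sum_mul]
    congr 1
    refine Finset.sum_congr rfl fun f _ => ?_
    simp only [flux, ContinuousAlternatingMap.smul_apply, smul_eq_mul,
      ContinuousAlternatingMap.compContinuousLinearMap_apply, Function.comp_def, raise_basis]
    ring
  -- Here `lower` turns the dual basis vectors back into the fixed basis, on which the derivative of
  -- the flux is evaluated.
  have h2 : formPair (G y) (a y) (codiff G w P β y) * w y = -∑ j, ((k.factorial : ℝ))⁻¹ *
      ∑ f : Fin k → Fin (finrank ℝ V), a y (fun i => finBasis ℝ V (f i)) *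
            fderiv ℝ (flux G w P β j) y (finBasis ℝ V j) (fun i => finBasis ℝ V (f i)) := by
    rw [formPair, mul_assoc, Finset.sum_mul, ← Finset.mul_sum, ← mul_neg, Finset.sum_comm,
      ← Finset.sum_neg_distrib]
    congr 1
    refine Finset.sum_congr rfl fun f _ => ?_
    simp only [codiff, ContinuousAlternatingMap.smul_apply, smul_eq_mul, Function.comp_def,
      ContinuousAlternatingMap.compContinuousLinearMap_apply, hin.lower_sharpL,
      ContinuousAlternatingMap.sum_apply]
    rw [← Finset.mul_sum]
    field_simp
  rw [h1, h2, sub_neg_eq_add, ← Finset.sum_add_distrib]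
  refine Finset.sum_congr rfl fun j _ => ?_
  rw [← mul_add, ← Finset.sum_add_distrib]
  congr 1
  exact Finset.sum_congr rfl fun f _ => add_comm _ _

end LocalCodifferential

/-! ### Vanishing integrals of derivatives -/

section Divergence

variable {V : Type*} [NormedAddCommGroup V] [NormedSpace ℝ V] [FiniteDimensional ℝ V]
  [MeasurableSpace V] [BorelSpace V] (ν : Measure V) [ν.IsAddHaarMeasure]

/-- Extended by zero outside `T`, the function is of class `C¹` with compact support on all of `V`.
Integration by parts against the constant function `1` gives the claim. -/
theorem setIntegral_fderiv_eq_zero {T K : Set V} (hT : IsOpen T) (hK : IsCompact K) (hKT : K ⊆ T)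
    {c : V → ℝ} (hc : ∀ y ∈ T, ContDiffAt ℝ 1 c y) (h0 : ∀ y ∈ T, y ∉ K → c y = 0) (v : V) :
    IntegrableOn (fun y => fderiv ℝ c y v) T ν ∧ ∫ y in T, fderiv ℝ c y v ∂ν = 0 := by
  set e : V → ℝ := T.indicator c with he
  have heT {y : V} (hy : y ∈ T) : e =ᶠ[𝓝 y] c := by
    filter_upwards [hT.mem_nhds hy] with z hz
    exact indicator_of_mem hz c
  have he0 {y : V} (hy : y ∉ K) : e =ᶠ[𝓝 y] fun _ => 0 := by
    filter_upwards [hK.isClosed.isOpen_compl.mem_nhds hy] with z hz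
    by_cases hzT : z ∈ T
    · rw [he, indicator_of_mem hzT, h0 z hzT hz]
    · exact indicator_of_notMem hzT c
  have hsm : ContDiff ℝ 1 e := by
    rw [contDiff_iff_contDiffAt]
    intro y
    by_cases hy : y ∈ T
    · exact (hc y hy).congr_of_eventuallyEq (heT hy)
    · exact contDiffAt_const.congr_of_eventuallyEq (he0 fun h => hy (hKT h))
  have hecs : HasCompactSupport e := HasCompactSupport.intro hK fun y hy => (he0 hy).eq_of_nhds
  have hcont : Continuous (fun y => fderiv ℝ e y v) :=
    (hsm.continuous_fderiv (by simp)).clm_apply continuous_const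
  have hcs : HasCompactSupport (fun y => fderiv ℝ e y v) := by
    refine HasCompactSupport.intro hK fun y hy => ?_
    rw [(he0 hy).fderiv_eq]; simp
  have hint : Integrable (fun y => fderiv ℝ e y v) ν := hcont.integrable_of_hasCompactSupport hcs
  have hzero : ∫ y, fderiv ℝ e y v ∂ν = 0 := by
    have := integral_mul_fderiv_eq_neg_fderiv_mul_of_integrable (μ := ν) (𝕜 := ℝ) (f := fun _ => 1)
      (g := e) (v := v) (by simp) (by simpa using hint)
      (by simpa using hsm.continuous.integrable_of_hasCompactSupport hecs)
      (fun _ _ => differentiableAt_const _) (fun y _ => hsm.differentiable (by simp) y)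
    simpa using this
  have heq : EqOn (fun y => fderiv ℝ c y v) (fun y => fderiv ℝ e y v) T := fun y hy => by
    simp only [(heT hy).fderiv_eq]
  refine ⟨(hint.integrableOn (s := T)).congr_fun heq.symm hT.measurableSet, ?_⟩
  rw [setIntegral_congr_fun hT.measurableSet heq,
    setIntegral_eq_integral_of_forall_compl_eq_zero, hzero]
  intro y hy
  rw [(he0 fun h => hy (hKT h)).fderiv_eq]; simp

end Divergence

/-! ### Measures with smooth positive densities in charts -/

section Density

variable {V : Type*} [NormedAddCommGroup V] [NormedSpace ℝ V] [FiniteDimensional ℝ V]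
  [MeasurableSpace V] [BorelSpace V] {ν : Measure V} [ν.IsAddHaarMeasure]
  {H : Type*} [TopologicalSpace H] {J : ModelWithCorners ℝ V H} [J.Boundaryless]
  {M : Type*} [TopologicalSpace M] [ChartedSpace H M] [IsManifold J ∞ M]
  [MeasurableSpace M] [BorelSpace M]

variable (J ν) in
/-- The measure `μ` has the smooth positive densities `w` in the preferred charts. -/
structure HasSmoothDensity (μ : Measure M) (w : M → V → ℝ) : Prop where
  smooth : ∀ p₀ : M, ContDiffOn ℝ ∞ (w p₀) (extChartAt J p₀).target
  pos : ∀ p₀ : M, ∀ y ∈ (extChartAt J p₀).target, 0 < w p₀ y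
  apply_eq : ∀ (p₀ : M) (A : Set M), MeasurableSet A → A ⊆ (extChartAt J p₀).source →
    μ A = ∫⁻ y in extChartAt J p₀ '' A, ENNReal.ofReal (w p₀ y) ∂ν

namespace HasSmoothDensity

variable {μ : Measure M} {w : M → V → ℝ} (hμ : HasSmoothDensity ν J μ w)
include hμ

theorem contDiffAt {p₀ : M} {y : V} (hy : y ∈ (extChartAt J p₀).target) :
    ContDiffAt ℝ ∞ (w p₀) y :=
  (hμ.smooth p₀).contDiffAt ((isOpen_extChartAt_target p₀).mem_nhds hy)

theorem aemeasurable (p₀ : M) :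
    AEMeasurable (fun y => ENNReal.ofReal (w p₀ y)) (ν.restrict (extChartAt J p₀).target) :=
  ((hμ.smooth p₀).continuousOn.aemeasurable
    (isOpen_extChartAt_target p₀).measurableSet).ennreal_ofReal

/-- The chart formula for measures of sets becomes an identity of measures, through which integrals
over a chart domain are computed in coordinates. -/
theorem restrict_source (p₀ : M) : μ.restrict (extChartAt J p₀).source =
    ((ν.restrict (extChartAt J p₀).target).withDensity
      fun y => ENNReal.ofReal (w p₀ y)).map (extChartAt J p₀).symm := by
  have hsymm : AEMeasurable (extChartAt J p₀).symm (ν.restrict (extChartAt J p₀).target) :=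
    (continuousOn_extChartAt_symm p₀).aemeasurable (isOpen_extChartAt_target p₀).measurableSet
  ext A hA
  rw [Measure.restrict_apply hA, Measure.map_apply_of_aemeasurable
    (hsymm.mono_ac (withDensity_absolutelyContinuous _ _)) hA,
    withDensity_apply', Measure.restrict_restrict'
      (isOpen_extChartAt_target p₀).measurableSet,
    hμ.apply_eq p₀ _ (hA.inter (isOpen_extChartAt_source p₀).measurableSet) inter_subset_right]
  congr 2
  rw [inter_comm A, (extChartAt J p₀).image_source_inter_eq', inter_comm]

theorem integral_eq {p₀ : M} {F : M → ℝ} (hF : ContinuousOn F (extChartAt J p₀).source)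
    (h0 : ∀ p, p ∉ (extChartAt J p₀).source → F p = 0) :
    ∫ p, F p ∂μ = ∫ y in (extChartAt J p₀).target, F ((extChartAt J p₀).symm y) * w p₀ y ∂ν := by
  have hsymm : AEMeasurable (extChartAt J p₀).symm (ν.restrict (extChartAt J p₀).target) :=
    (continuousOn_extChartAt_symm p₀).aemeasurable (isOpen_extChartAt_target p₀).measurableSet
  rw [← setIntegral_eq_integral_of_forall_compl_eq_zero h0]
  have hFm : AEStronglyMeasurable F (μ.restrict (extChartAt J p₀).source) :=
    hF.aestronglyMeasurable (isOpen_extChartAt_source p₀).measurableSet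
  rw [hμ.restrict_source p₀] at hFm ⊢
  rw [integral_map (hsymm.mono_ac (withDensity_absolutelyContinuous _ _)) hFm,
    integral_withDensity_eq_integral_toReal_smul₀ (hμ.aemeasurable p₀)
      (Filter.Eventually.of_forall fun y => ENNReal.ofReal_lt_top)]
  refine setIntegral_congr_fun (isOpen_extChartAt_target p₀).measurableSet fun y hy => ?_
  simp only [smul_eq_mul]
  rw [ENNReal.toReal_ofReal (hμ.pos p₀ y hy).le, mul_comm]

/-- The density is continuous, hence integrable on a closed ball inside the chart target. -/
theorem isLocallyFiniteMeasure : IsLocallyFiniteMeasure μ := by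
  refine ⟨fun p => ?_⟩
  obtain ⟨r, hr, hrT⟩ := Metric.nhds_basis_closedBall.mem_iff.1
    ((isOpen_extChartAt_target (I := J) p).mem_nhds (mem_extChartAt_target p))
  set B := Metric.closedBall (extChartAt J p p) r
  have hN : (extChartAt J p).source ∩ extChartAt J p ⁻¹' Metric.ball (extChartAt J p p) r ∈ 𝓝 p :=
    (isOpen_extChartAt_preimage' p Metric.isOpen_ball).mem_nhds
      ⟨mem_extChartAt_source p, Metric.mem_ball_self hr⟩
  refine ⟨_, hN, ?_⟩
  rw [hμ.apply_eq p _ (isOpen_extChartAt_preimage' p Metric.isOpen_ball).measurableSet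
    inter_subset_left]
  have hsub : extChartAt J p '' ((extChartAt J p).source ∩
      extChartAt J p ⁻¹' Metric.ball (extChartAt J p p) r) ⊆ B := by
    rintro _ ⟨q, ⟨-, hq⟩, rfl⟩
    exact Metric.ball_subset_closedBall hq
  refine (lintegral_mono_set hsub).trans_lt ?_
  have hc : ContinuousOn (w p) B := (hμ.smooth p).continuousOn.mono hrT
  have hint : IntegrableOn (w p) B ν := hc.integrableOn_compact (isCompact_closedBall _ _)
  exact hint.lintegral_lt_top

/-- A strictly positive density cannot integrate to zero over a nonempty open set in a chart.
Uniqueness of adjoints rests on this. -/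
theorem isOpenPosMeasure : μ.IsOpenPosMeasure := by
  refine ⟨fun N hN ⟨p, hp⟩ h0 => ?_⟩
  have hS := (isOpen_extChartAt_source (I := J) p)
  have h1 : μ ((extChartAt J p).source ∩ N) = 0 := measure_mono_null inter_subset_right h0
  rw [hμ.apply_eq p _ (hS.inter hN).measurableSet inter_subset_left,
    (extChartAt J p).image_source_inter_eq'] at h1
  have hO : IsOpen ((extChartAt J p).target ∩ (extChartAt J p).symm ⁻¹' N) :=
    (continuousOn_extChartAt_symm p).isOpen_inter_preimage (isOpen_extChartAt_target p) hN
  rw [lintegral_eq_zero_iff' ((hμ.aemeasurable p).mono_measure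
    (Measure.restrict_mono inter_subset_left le_rfl))] at h1
  have h2 : ∀ᵐ y ∂(ν.restrict ((extChartAt J p).target ∩ (extChartAt J p).symm ⁻¹' N)), False := by
    filter_upwards [h1, ae_restrict_mem hO.measurableSet] with y hy hy'
    have : ENNReal.ofReal (w p y) = 0 := hy
    rw [ENNReal.ofReal_eq_zero] at this
    exact absurd (hμ.pos p y hy'.1) (not_lt.2 this)
  rw [Filter.eventually_false_iff_eq_bot, ae_eq_bot, Measure.restrict_eq_zero] at h2
  refine (hO.measure_pos ν ⟨extChartAt J p p, mem_extChartAt_target p, ?_⟩).ne' h2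
  rwa [mem_preimage, (extChartAt J p).left_inv (mem_extChartAt_source p)]

end HasSmoothDensity

end Density

/-! ### Locality, additivity and product rule for the codifferential -/

section CodiffRules

variable {V : Type*} [NormedAddCommGroup V] [NormedSpace ℝ V] [FiniteDimensional ℝ V]
  {G : V → V →L[ℝ] V →L[ℝ] ℝ} {w : V → ℝ} {P : V →L[ℝ] V} {k : ℕ}

theorem codiff_congr {β β' : V → V [⋀^Fin (k + 1)]→L[ℝ] ℝ} {y : V} (h : β =ᶠ[𝓝 y] β') :
    codiff G w P β y = codiff G w P β' y := by
  have this (j) : flux G w P β j =ᶠ[𝓝 y] flux G w P β' j := by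
    filter_upwards [h] with z hz
    simp only [flux, hz]
  have h2 (j) := (this j).fderiv_eq (𝕜 := ℝ)
  simp only [codiff, h2]

theorem codiff_zero (y : V) : codiff G w P (fun _ => (0 : V [⋀^Fin (k + 1)]→L[ℝ] ℝ)) y = 0 := by
  have this (j) : flux G w P (fun _ => (0 : V [⋀^Fin (k + 1)]→L[ℝ] ℝ)) j = fun _ => 0 := by
    funext z
    ext v
    simp [flux]
  ext v
  simp [codiff, this]

theorem codiff_add {β β' : V → V [⋀^Fin (k + 1)]→L[ℝ] ℝ} {y : V}
    (hG : ContDiffAt ℝ ∞ (fun z => sharpL (G z)) y) (hw : ContDiffAt ℝ ∞ w y)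
    (hβ : ContDiffAt ℝ ∞ β y) (hβ' : ContDiffAt ℝ ∞ β' y) :
    codiff G w P (fun z => β z + β' z) y = codiff G w P β y + codiff G w P β' y := by
  have h1 (j) : flux G w P (fun z => β z + β' z) j = fun z => flux G w P β j z + flux G w P β' j z := by
    funext z; ext v; simp [flux, mul_add]
  have h2 (j) : fderiv ℝ (flux G w P (fun z => β z + β' z) j) y =
      fderiv ℝ (flux G w P β j) y + fderiv ℝ (flux G w P β' j) y := by
    rw [h1, fderiv_fun_add ((contDiffAt_flux hG hw hβ j).differentiableAt (by simp))
      ((contDiffAt_flux hG hw hβ' j).differentiableAt (by simp))]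
  ext v
  simp [codiff, h2, Finset.sum_add_distrib]

theorem raise_lower {B : V →L[ℝ] V →L[ℝ] ℝ} (hB : IsInner B) (v : V) : raise B (lower B v) = v := by
  simp [raise, lower, hB.sharpL_apply]

/-- The product rule for the codifferential. -/
theorem codiff_smul {β : V → V [⋀^Fin (k + 1)]→L[ℝ] ℝ} {f : V → ℝ} {y : V} (hin : IsInner (G y))
    (hG : ContDiffAt ℝ ∞ (fun z => sharpL (G z)) y) (hw : ContDiffAt ℝ ∞ w y) (hw0 : w y ≠ 0)
    (hβ : ContDiffAt ℝ ∞ β y) (hf : DifferentiableAt ℝ f y) :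
    codiff G w P (fun z => f z • β z) y = f y • codiff G w P β y -
      (β y).curryLeft (sharpL (G y) ((fderiv ℝ f y).comp P)) := by
  have h1 (j) : flux G w P (fun z => f z • β z) j = fun z => f z • flux G w P β j z := by
    funext z; ext v; simp [flux]; ring
  have h2 (j) : fderiv ℝ (flux G w P (fun z => f z • β z) j) y (finBasis ℝ V j) =
      f y • fderiv ℝ (flux G w P β j) y (finBasis ℝ V j) +
        fderiv ℝ f y (finBasis ℝ V j) • flux G w P β j y := by
    rw [h1, fderiv_fun_smul hf ((contDiffAt_flux hG hw hβ j).differentiableAt (by simp))]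
    simp
  -- The terms in which `f` is differentiated are contractions with `♯(dyʲ ∘ P)`, weighted by `∂ⱼ
  -- f`; this identity sums them to a single contraction.
  have h3 : (fderiv ℝ f y).comp P = ∑ j, fderiv ℝ f y (finBasis ℝ V j) • (coord V j).comp P := by
    conv_lhs => rw [← sum_coord_smul (fderiv ℝ f y)]
    ext v; simp
  ext v
  have h4 : (fun i => raise (G y) (lower (G y) (v i))) = v := funext fun i => raise_lower hin (v i)
  simp only [codiff, h2, h3, Finset.sum_add_distrib, ← Finset.smul_sum, map_sum, map_smul,
    ContinuousAlternatingMap.compContinuousLinearMap_apply, ContinuousAlternatingMap.smul_apply,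
    ContinuousAlternatingMap.add_apply, ContinuousAlternatingMap.sum_apply,
    ContinuousAlternatingMap.sub_apply, smul_eq_mul, flux, Function.comp_def, h4, mul_add]
  simp only [mul_left_comm _ (w y), ← Finset.mul_sum]
  field_simp
  ring

end CodiffRules

/-! ### Supports, test forms and localisation -/

section Global

variable {V : Type*} [NormedAddCommGroup V] [NormedSpace ℝ V] [FiniteDimensional ℝ V]
  {H : Type*} [TopologicalSpace H] {J : ModelWithCorners ℝ V H} [J.Boundaryless]
  {M : Type*} [TopologicalSpace M] [ChartedSpace H M] [IsManifold J ∞ M]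

theorem extDAlong_congr {P : V →L[ℝ] V} {k : ℕ} {η ζ : FormField J M k} {p : M}
    (h : ∀ᶠ q in 𝓝 p, η q = ζ q) : extDAlong J P η p = extDAlong J P ζ p := by
  rw [extDAlong, extDAlong, (chartRep_eventuallyEq (mem_extChartAt_source p) h).fderiv_eq]

theorem extDAlong_zero (P : V →L[ℝ] V) {k : ℕ} (p : M) :
    extDAlong J P (0 : FormField J M k) p = 0 := by
  have : chartRep J p (0 : FormField J M k) = fun _ => 0 := by funext y; ext v; rfl
  have h0 : ContinuousAlternatingMap.alternatizeUncurryFin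
      (0 : V →L[ℝ] V [⋀^Fin k]→L[ℝ] ℝ) = 0 :=
    map_zero (ContinuousAlternatingMap.alternatizeUncurryFinCLM ℝ V ℝ)
  rw [extDAlong, this, fderiv_const_apply, ContinuousLinearMap.zero_comp, h0]
  rfl

theorem extDAlong_add (P : V →L[ℝ] V) {k : ℕ} {η ζ : FormField J M k} {p : M}
    (hη : SmoothFormAt J η p) (hζ : SmoothFormAt J ζ p) :
    extDAlong J P (η + ζ) p = extDAlong J P η p + extDAlong J P ζ p := by
  have : chartRep J p (η + ζ) = chartRep J p η + chartRep J p ζ := by funext y; ext v; rfl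
  rw [extDAlong, this, fderiv_add (hη.differentiableAt (by simp)) (hζ.differentiableAt (by simp)),
    ContinuousLinearMap.add_comp, ContinuousAlternatingMap.alternatizeUncurryFin_add]
  rfl

theorem extDAlong_smulField {P : V →L[ℝ] V} (hP : CommutesWithCharts J M P) {k : ℕ} {f : M → ℝ}
    {η : FormField J M k} {p₀ : M} {y : V} (hy : y ∈ (extChartAt J p₀).target)
    (hf : ContMDiffAt J 𝓘(ℝ, ℝ) ∞ f ((extChartAt J p₀).symm y))
    (hη : ContDiffAt ℝ ∞ (chartRep J p₀ η) y) :
    chartRep J p₀ (extDAlong J P (smulField f η)) y =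
      f ((extChartAt J p₀).symm y) • chartRep J p₀ (extDAlong J P η) y +
      wedge ((fderiv ℝ (fun z => f ((extChartAt J p₀).symm z)) y).comp P) (chartRep J p₀ η y) := by
  have hf' := contDiffAt_comp_chartSymm hy hf
  have h1 : chartRep J p₀ (smulField f η) =
      fun z => f ((extChartAt J p₀).symm z) • chartRep J p₀ η z := rfl
  rw [chartRep_extDAlong hP hy hη, chartRep_extDAlong hP hy (hf'.smul hη), h1,
    fderiv_fun_smul (hf'.differentiableAt (by simp)) (hη.differentiableAt (by simp))]
  ext v
  simp [wedge_apply, ContinuousAlternatingMap.alternatizeUncurryFin_apply,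
    Finset.mul_sum, mul_left_comm]

/-- The field `η` vanishes outside of a compact subset of `W`. -/
def SupportedIn {k : ℕ} (η : FormField J M k) (W : Set M) : Prop :=
  ∃ K, IsCompact K ∧ K ⊆ W ∧ ∀ p, p ∉ K → η p = 0

theorem SupportedIn.mono {k : ℕ} {η : FormField J M k} {W W' : Set M} (h : SupportedIn η W)
    (hW : W ⊆ W') : SupportedIn η W' :=
  let ⟨K, hK, hKW, h0⟩ := h
  ⟨K, hK, hKW.trans hW, h0⟩

theorem HasCptSupport.supportedIn {k : ℕ} {η : FormField J M k} (h : HasCptSupport η) :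
    SupportedIn η univ :=
  ⟨_, h, subset_univ _, fun p hp => by
    by_contra h0
    exact hp (subset_closure h0)⟩

variable [T2Space M]

theorem SupportedIn.hasCptSupport {k : ℕ} {η : FormField J M k} {W : Set M}
    (h : SupportedIn η W) : HasCptSupport η := by
  obtain ⟨K, hK, -, h0⟩ := h
  refine hK.of_isClosed_subset isClosed_closure (closure_minimal (fun p hp => ?_) hK.isClosed)
  by_contra hpK
  exact hp (h0 p hpK)

theorem SupportedIn.extDAlong {P : V →L[ℝ] V} {k : ℕ} {η : FormField J M k} {W : Set M}
    (h : SupportedIn η W) : SupportedIn (extDAlong J P η) W := by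
  obtain ⟨K, hK, hKW, h0⟩ := h
  refine ⟨K, hK, hKW, fun p hp => ?_⟩
  rw [extDAlong_congr (ζ := 0), extDAlong_zero]
  filter_upwards [hK.isClosed.isOpen_compl.mem_nhds hp] with q hq
  exact h0 q hq

theorem IsSmoothForm.of_supportedIn {k : ℕ} {η : FormField J M k} {W : Set M}
    (h : SupportedIn η W) (hη : ∀ p ∈ W, SmoothFormAt J η p) : IsSmoothForm J η := by
  obtain ⟨K, hK, hKW, h0⟩ := h
  rw [isSmoothForm_iff]
  intro p
  by_cases hp : p ∈ K
  · exact hη p (hKW hp)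
  · have h1 : SmoothFormAt J (0 : FormField J M k) p :=
      isSmoothForm_iff.1 (smoothForms J M k).zero_mem p
    refine h1.congr ?_
    filter_upwards [hK.isClosed.isOpen_compl.mem_nhds hp] with q hq
    exact h0 q hq

namespace IsRiemannian

variable {b : SymTensor J M} (hb : IsRiemannian b)
include hb

theorem continuous_pairing {k : ℕ} {η ζ : FormField J M k} {W : Set M} (h : SupportedIn η W)
    (hη : ∀ p ∈ W, SmoothFormAt J η p) (hζ : ∀ p ∈ W, SmoothFormAt J ζ p) :
    Continuous fun p => b.pairing p (η p) (ζ p) := by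
  obtain ⟨K, hK, hKW, h0⟩ := h
  rw [continuous_iff_continuousAt]
  intro p
  by_cases hp : p ∈ K
  · exact hb.continuousAt_pairing (hη p (hKW hp)) (hζ p (hKW hp))
  · refine (continuousAt_const (y := (0 : ℝ))).congr ?_
    filter_upwards [hK.isClosed.isOpen_compl.mem_nhds hp] with q hq
    rw [h0 q hq, pairing_zero_left]

variable [MeasurableSpace M] [BorelSpace M] {μ : Measure M} [IsFiniteMeasureOnCompacts μ]

theorem integrable_pairing {k : ℕ} {η ζ : FormField J M k} {W : Set M} (h : SupportedIn η W)
    (hη : ∀ p ∈ W, SmoothFormAt J η p) (hζ : ∀ p ∈ W, SmoothFormAt J ζ p) :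
    Integrable (fun p => b.pairing p (η p) (ζ p)) μ := by
  refine (hb.continuous_pairing h hη hζ).integrable_of_hasCompactSupport ?_
  obtain ⟨K, hK, hKW, h0⟩ := h
  refine HasCompactSupport.intro hK fun p hp => ?_
  rw [h0 p hp, pairing_zero_left]

/-- A field of forms is determined by its integrals against compactly supported test forms. -/
theorem eq_of_forall_integral_eq [μ.IsOpenPosMeasure] {k : ℕ} {γ γ' : FormField J M k} {W : Set M}
    (hW : IsOpen W) (hγ : ∀ p ∈ W, SmoothFormAt J γ p) (hγ' : ∀ p ∈ W, SmoothFormAt J γ' p)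
    (h : ∀ α : FormField J M k, IsSmoothForm J α → SupportedIn α W →
      ∫ p, b.pairing p (α p) (γ p) ∂μ = ∫ p, b.pairing p (α p) (γ' p) ∂μ) {p : M} (hp : p ∈ W) :
    γ p = γ' p := by
  obtain ⟨f, -, hfW⟩ := (SmoothBumpFunction.nhds_basis_tsupport (I := J) p).mem_iff.1
    (hW.mem_nhds hp)
  set ε : FormField J M k := γ - γ'
  have hε : ∀ q ∈ W, SmoothFormAt J ε q := fun q hq => (hγ q hq).sub (hγ' q hq)
  -- Testing against the difference itself, cut off near `p`, makes the integrand nonnegative and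
  -- continuous. Its integral is zero, so it vanishes everywhere, in particular at `p`, where the
  -- bump function is `1`.
  set α : FormField J M k := smulField f ε
  have hα : SupportedIn α W := ⟨tsupport f, f.hasCompactSupport, hfW, fun q hq => by
    change f q • ε q = 0
    rw [image_eq_zero_of_notMem_tsupport hq, zero_smul]⟩
  have hαs : ∀ q ∈ W, SmoothFormAt J α q := fun q hq => SmoothFormAt.smul f.contMDiffAt (hε q hq)
  have h1 := h α (IsSmoothForm.of_supportedIn hα hαs) hα
  have hsum : (fun q => b.pairing q (α q) (γ q)) =
      fun q => b.pairing q (α q) (γ' q) + b.pairing q (α q) (ε q) := by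
    funext q
    rw [← pairing_add_right]
    congr 1
    simp [ε]
  rw [hsum, integral_add (hb.integrable_pairing hα hαs hγ') (hb.integrable_pairing hα hαs hε),
    add_eq_left] at h1
  have hnn : ∀ q, 0 ≤ b.pairing q (α q) (ε q) := fun q => by
    change 0 ≤ b.pairing q (f q • ε q) (ε q)
    rw [pairing_smul_left]
    exact mul_nonneg f.nonneg (hb.pairing_self_nonneg ε q)
  have hcont := hb.continuous_pairing hα hαs hε
  rw [integral_eq_zero_iff_of_nonneg hnn (hb.integrable_pairing hα hαs hε)] at h1
  have h2 := congrFun (hcont.ae_eq_iff_eq μ continuous_const |>.1 h1) p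
  change b.pairing p (f p • ε p) (ε p) = 0 at h2
  rw [f.eq_one, one_smul] at h2
  exact sub_eq_zero.1 (hb.pairing_self_eq_zero h2)

end IsRiemannian

/-- There are smooth cut-off functions for compact sets. -/
theorem exists_cutoff {K : Set M} (hK : IsCompact K) :
    ∃ χ : M → ℝ, ContMDiff J 𝓘(ℝ, ℝ) ∞ χ ∧ (∃ K', IsCompact K' ∧ ∀ p, p ∉ K' → χ p = 0) ∧
      ∀ p ∈ K, ∀ᶠ q in 𝓝 p, χ q = 1 := by
  refine hK.induction_on (p := fun S => ∃ χ : M → ℝ, ContMDiff J 𝓘(ℝ, ℝ) ∞ χ ∧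
    (∃ K', IsCompact K' ∧ ∀ p, p ∉ K' → χ p = 0) ∧ ∀ p ∈ S, ∀ᶠ q in 𝓝 p, χ q = 1) ?_ ?_ ?_ ?_
  · exact ⟨fun _ => 0, contMDiff_const, ⟨∅, isCompact_empty, fun _ _ => rfl⟩, by simp⟩
  · rintro s t hst ⟨χ, h1, h2, h3⟩
    exact ⟨χ, h1, h2, fun p hp => h3 p (hst hp)⟩
  · rintro s t ⟨χ, h1, ⟨K₁, hK₁, h2⟩, h3⟩ ⟨χ', h1', ⟨K₂, hK₂, h2'⟩, h3'⟩
    -- This function is `1 - (1 - χ)(1 - χ')`: it is `1` where either cut-off is, and zero where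
    -- both are.
    refine ⟨fun p => χ p + χ' p - χ p * χ' p, (h1.add h1').sub (h1.mul h1'),
      ⟨K₁ ∪ K₂, hK₁.union hK₂, fun p hp => ?_⟩, ?_⟩
    · rw [mem_union, not_or] at hp
      simp only [h2 p hp.1, h2' p hp.2]; ring
    · rintro p (hp | hp)
      · filter_upwards [h3 p hp] with q hq
        rw [hq]; ring
      · filter_upwards [h3' p hp] with q hq
        rw [hq]; ring
  · intro p _
    let f : SmoothBumpFunction J p := Classical.arbitrary _
    refine ⟨{q | ∀ᶠ r in 𝓝 q, f r = 1}, mem_nhdsWithin_of_mem_nhds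
      (eventually_eventually_nhds.2 f.eventuallyEq_one), f, f.contMDiff,
      ⟨tsupport f, f.hasCompactSupport, fun q hq => image_eq_zero_of_notMem_tsupport hq⟩,
      fun q hq => hq⟩

/-- To prove an additive statement about compactly supported forms it is enough to consider forms
supported in chart domains. -/
theorem SupportedIn.induction {k : ℕ} {Q : FormField J M k → Prop} (h0 : Q 0)
    (hadd : ∀ α α', IsSmoothForm J α → IsSmoothForm J α' → SupportedIn α univ →
      SupportedIn α' univ → Q α → Q α' → Q (α + α'))
    (hchart : ∀ (p₀ : M) α, IsSmoothForm J α → SupportedIn α (extChartAt J p₀).source → Q α)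
    {α : FormField J M k} (hα : IsSmoothForm J α) (hs : SupportedIn α univ) : Q α := by
  let f (p : M) : SmoothBumpFunction J p := Classical.arbitrary _
  have key (s : Finset M) : ∀ α : FormField J M k, IsSmoothForm J α →
      ∀ K, IsCompact K → (∀ p, p ∉ K → α p = 0) →
      K ⊆ ⋃ p ∈ s, interior {q | f p q = 1} → Q α := by
    classical
    induction s using Finset.induction_on with
    | empty =>
      intro α _ K hK hα0 hsub
      have hK : K = ∅ := by simpa using hsub
      have : α = 0 := funext fun p => hα0 p (by simp [hK])
      rwa [this]
    | insert a s _ ih =>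
      intro α hα K hK hα0 hsub
      -- The first summand lives in one chart; the second vanishes where the bump function equals
      -- `1`, so its support is covered by the remaining neighbourhoods. No partition of unity has
      -- to be normalised.
      have e : α = smulField (f a) α + smulField (fun q => 1 - f a q) α := by
        funext q
        change α q = f a q • α q + (1 - f a q) • α q
        rw [← add_smul]; simp
      have hs1 : IsSmoothForm J (smulField (f a) α) := isSmoothForm_iff.2 fun q =>
        SmoothFormAt.smul (f a).contMDiffAt (isSmoothForm_iff.1 hα q)
      have hs2 : IsSmoothForm J (smulField (fun q => 1 - f a q) α) := isSmoothForm_iff.2 fun q =>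
        SmoothFormAt.smul (contMDiffAt_const.sub (f a).contMDiffAt) (isSmoothForm_iff.1 hα q)
      have hz1 : ∀ q, q ∉ K ∩ tsupport (f a) → smulField (f a) α q = 0 := fun q hq => by
        change f a q • α q = 0
        by_cases hqK : q ∈ K
        · rw [image_eq_zero_of_notMem_tsupport fun h => hq ⟨hqK, h⟩, zero_smul]
        · rw [hα0 q hqK, smul_zero]
      have hz2 : ∀ q, q ∉ K \ interior {q | f a q = 1} →
          smulField (fun q => 1 - f a q) α q = 0 := fun q hq => by
        change (1 - f a q) • α q = 0
        by_cases hqK : q ∈ K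
        · have : q ∈ interior {q | f a q = 1} := by
            by_contra h
            exact hq ⟨hqK, h⟩
          have h1 : q ∈ {q | f a q = 1} := interior_subset this
          change f a q = 1 at h1
          rw [h1, sub_self, zero_smul]
        · rw [hα0 q hqK, smul_zero]
      have hc1 : IsCompact (K ∩ tsupport (f a)) := hK.inter_right isClosed_closure
      have hc2 : IsCompact (K \ interior {q | f a q = 1}) := hK.diff isOpen_interior
      rw [e]
      refine hadd _ _ hs1 hs2 ⟨_, hc1, subset_univ _, hz1⟩ ⟨_, hc2, subset_univ _, hz2⟩
        (hchart a _ hs1 ⟨_, hc1, fun q hq => (f a).tsupport_subset_extChartAt_source hq.2, hz1⟩)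
        (ih _ hs2 _ hc2 hz2 fun q hq => ?_)
      have h1 := hsub hq.1
      rw [Finset.set_biUnion_insert] at h1
      exact h1.resolve_left hq.2
  obtain ⟨K, hK, -, hα0⟩ := hs
  obtain ⟨t, -, ht⟩ := hK.elim_nhds_subcover (fun p => interior {q | f p q = 1})
    fun p _ => interior_mem_nhds.2 (f p).eventuallyEq_one
  exact key t α hα K hK hα0 ht

end Global

/-! ### Existence and uniqueness of formal adjoints -/

section Adjoint

variable {V : Type*} [NormedAddCommGroup V] [NormedSpace ℝ V] [FiniteDimensional ℝ V]
  [MeasurableSpace V] [BorelSpace V] {ν : Measure V} [ν.IsAddHaarMeasure]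
  {H : Type*} [TopologicalSpace H] {J : ModelWithCorners ℝ V H} [J.Boundaryless]
  {M : Type*} [TopologicalSpace M] [ChartedSpace H M] [IsManifold J ∞ M] [T2Space M]
  [MeasurableSpace M] [BorelSpace M]

theorem integrableOn_of_continuousOn_of_compact {T K : Set V} (hT : IsOpen T) (hK : IsCompact K)
    (hKT : K ⊆ T) {c : V → ℝ} (hc : ContinuousOn c T) (h0 : ∀ y ∈ T, y ∉ K → c y = 0) :
    IntegrableOn c T ν :=
  ((hc.mono hKT).integrableOn_compact hK).of_forall_sdiff_eq_zero hT.measurableSet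
    fun y hy => h0 y hy.1 hy.2

/-- The field of forms given by the codifferential along `P` in the preferred chart at `p₀`. -/
def codiffChart (b : SymTensor J M) (w : M → V → ℝ) (P : V →L[ℝ] V) {k : ℕ} (p₀ : M)
    (β : FormField J M (k + 1)) : FormField J M k :=
  fieldOf J p₀ (codiff (chartMetric b p₀) (w p₀) P (chartRep J p₀ β))

/-- The codifferential along `P`, computed at each point in the preferred chart at that point. -/
def codiffField (b : SymTensor J M) (w : M → V → ℝ) (P : V →L[ℝ] V) {k : ℕ}
    (β : FormField J M (k + 1)) : FormField J M k := fun p => codiffChart b w P p β p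

variable {b : SymTensor J M} {μ : Measure M} {w : M → V → ℝ} {P : V →L[ℝ] V}

theorem codiffField_congr {k : ℕ} {β β' : FormField J M (k + 1)} {p : M}
    (h : ∀ᶠ q in 𝓝 p, β q = β' q) : codiffField b w P β p = codiffField b w P β' p := by
  rw [codiffField, codiffField, codiffChart, codiffChart, fieldOf, fieldOf,
    codiff_congr (chartRep_eventuallyEq (mem_extChartAt_source p) h)]

theorem codiffField_zero {k : ℕ} (p : M) :
    codiffField b w P (0 : FormField J M (k + 1)) p = 0 := by
  have : chartRep J p (0 : FormField J M (k + 1)) = fun _ => 0 := by funext y; ext v; rfl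
  rw [codiffField, codiffChart, fieldOf, this, codiff_zero]
  rfl

theorem SupportedIn.codiffField {k : ℕ} {β : FormField J M (k + 1)} {W : Set M}
    (h : SupportedIn β W) : SupportedIn (codiffField b w P β) W := by
  obtain ⟨K, hK, hKW, h0⟩ := h
  refine ⟨K, hK, hKW, fun p hp => ?_⟩
  rw [codiffField_congr (β' := 0), codiffField_zero]
  filter_upwards [hK.isClosed.isOpen_compl.mem_nhds hp] with q hq
  exact h0 q hq

variable (hb : IsRiemannian b) (hμ : HasSmoothDensity ν J μ w) (hP : CommutesWithCharts J M P)
include hb hμ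

theorem contDiffAt_codiff_chart {k : ℕ} {β : FormField J M (k + 1)} (hβ : IsSmoothForm J β)
    {p₀ : M} {y : V} (hy : y ∈ (extChartAt J p₀).target) :
    ContDiffAt ℝ ∞ (codiff (chartMetric b p₀) (w p₀) P (chartRep J p₀ β)) y :=
  contDiffAt_codiff (hb.contDiffAt_chartMetric hy) (hb.contDiffAt_sharpL hy) (hμ.contDiffAt hy)
    (hμ.pos p₀ y hy).ne' (hβ.contDiffAt hy)

theorem smoothFormAt_codiffChart {k : ℕ} {β : FormField J M (k + 1)} (hβ : IsSmoothForm J β)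
    {p₀ p : M} (hp : p ∈ (extChartAt J p₀).source) :
    SmoothFormAt J (codiffChart b w P p₀ β) p :=
  smoothFormAt_fieldOf hp (contDiffAt_codiff_chart hb hμ hβ ((extChartAt J p₀).map_source hp))

include hP

/-- In coordinates the two integrands differ by a divergence whose components are products of
coefficients of `α` with fluxes, hence compactly supported in the chart target. -/
theorem integral_extDAlong_chart {k : ℕ} {α : FormField J M k} {β : FormField J M (k + 1)}
    (hα : IsSmoothForm J α) (hβ : IsSmoothForm J β) {p₀ : M}
    (hs : SupportedIn α (extChartAt J p₀).source) :
    ∫ p, b.pairing p (extDAlong J P α p) (β p) ∂μ =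
      ∫ p, b.pairing p (α p) (codiffChart b w P p₀ β p) ∂μ := by
  have hα' := isSmoothForm_iff.1 hα
  have hβ' := isSmoothForm_iff.1 hβ
  have hdα' := isSmoothForm_iff.1 (hα.extDAlong hP)
  have hc1 := hb.continuous_pairing (hs.extDAlong (P := P)) (fun p _ => hdα' p) (fun p _ => hβ' p)
  have hc2 := hb.continuous_pairing hs (fun p _ => hα' p)
    (fun p hp => smoothFormAt_codiffChart (P := P) hb hμ hβ hp)
  have hs' := hs.extDAlong (P := P)
  obtain ⟨K', hK', hKs', h0'⟩ := hs'
  obtain ⟨K, hK, hKs, h0⟩ := hs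
  set T := (extChartAt J p₀).target
  have hT : IsOpen T := isOpen_extChartAt_target p₀
  rw [hμ.integral_eq (p₀ := p₀) hc1.continuousOn (fun p hp => by
      rw [h0' p fun h => hp (hKs' h), pairing_zero_left]),
    hμ.integral_eq (p₀ := p₀) hc2.continuousOn (fun p hp => by
      rw [h0 p fun h => hp (hKs h), pairing_zero_left]), ← sub_eq_zero]
  have himg {S : Set M} (hS : IsCompact S) (hSs : S ⊆ (extChartAt J p₀).source) :
      IsCompact (extChartAt J p₀ '' S) ∧ extChartAt J p₀ '' S ⊆ T :=
    ⟨hS.image_of_continuousOn ((continuousOn_extChartAt p₀).mono hSs), by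
      rintro _ ⟨q, hq, rfl⟩; exact (extChartAt J p₀).map_source (hSs hq)⟩
  have hnot {S : Set M} {y : V} (hy : y ∈ T) (hyS : y ∉ extChartAt J p₀ '' S) :
      (extChartAt J p₀).symm y ∉ S := fun h => hyS ⟨_, h, (extChartAt J p₀).right_inv hy⟩
  have hwc : ContinuousOn (w p₀) T := (hμ.smooth p₀).continuousOn
  have hsymm : ContinuousOn (extChartAt J p₀).symm T := continuousOn_extChartAt_symm p₀
  have hI1 : IntegrableOn (fun y => b.pairing ((extChartAt J p₀).symm y)
      (extDAlong J P α ((extChartAt J p₀).symm y)) (β ((extChartAt J p₀).symm y)) * w p₀ y) T ν :=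
    integrableOn_of_continuousOn_of_compact hT (himg hK' hKs').1 (himg hK' hKs').2
      ((hc1.comp_continuousOn hsymm).mul hwc) fun y hy hyK => by
        rw [h0' _ (hnot hy hyK), pairing_zero_left, zero_mul]
  have hI2 : IntegrableOn (fun y => b.pairing ((extChartAt J p₀).symm y)
      (α ((extChartAt J p₀).symm y)) (codiffChart b w P p₀ β ((extChartAt J p₀).symm y)) *
        w p₀ y) T ν :=
    integrableOn_of_continuousOn_of_compact hT (himg hK hKs).1 (himg hK hKs).2
      ((hc2.comp_continuousOn hsymm).mul hwc) fun y hy hyK => by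
        rw [h0 _ (hnot hy hyK), pairing_zero_left, zero_mul]
  rw [← integral_sub hI1 hI2]
  have key : EqOn (fun y => b.pairing ((extChartAt J p₀).symm y)
        (extDAlong J P α ((extChartAt J p₀).symm y)) (β ((extChartAt J p₀).symm y)) * w p₀ y -
      b.pairing ((extChartAt J p₀).symm y) (α ((extChartAt J p₀).symm y))
        (codiffChart b w P p₀ β ((extChartAt J p₀).symm y)) * w p₀ y)
      (fun y => ∑ j, fderiv ℝ (fun z => ((k.factorial : ℝ))⁻¹ *
        ∑ f : Fin k → Fin (finrank ℝ V), chartRep J p₀ α z (fun i => finBasis ℝ V (f i)) *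
        flux (chartMetric b p₀) (w p₀) P (chartRep J p₀ β) j z (fun i => finBasis ℝ V (f i))) y
        (finBasis ℝ V j)) T := fun y hy => by
    simp only
    rw [hb.pairing_chart _ _ hy, hb.pairing_chart _ _ hy, codiffChart, chartRep_fieldOf _ hy,
      chartRep_extDAlong hP hy (hα.contDiffAt hy), formPair_codiff (hb.isInner hy)
        (hb.contDiffAt_sharpL hy) (hμ.contDiffAt hy) (hμ.pos p₀ y hy).ne' (hβ.contDiffAt hy)
        (hα.contDiffAt hy)]
  rw [setIntegral_congr_fun hT.measurableSet key]
  have hdiv (j : Fin (finrank ℝ V)) := setIntegral_fderiv_eq_zero ν hT (himg hK hKs).1 (himg hK hKs).2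
    (c := fun z => ((k.factorial : ℝ))⁻¹ *
        ∑ f : Fin k → Fin (finrank ℝ V), chartRep J p₀ α z (fun i => finBasis ℝ V (f i)) *
        flux (chartMetric b p₀) (w p₀) P (chartRep J p₀ β) j z (fun i => finBasis ℝ V (f i)))
    (fun y hy => (contDiffAt_const.mul (ContDiffAt.sum fun f _ =>
      (contDiffAt_form_iff.1 (hα.contDiffAt hy) _).mul (contDiffAt_form_iff.1
        (contDiffAt_flux (hb.contDiffAt_sharpL hy) (hμ.contDiffAt hy) (hβ.contDiffAt hy) j) _))).of_le
        (WithTop.coe_le_coe.2 le_top))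
    (fun y hy hyK => by
      have : chartRep J p₀ α y = 0 := by
        rw [chartRep, h0 _ (hnot hy hyK)]; rfl
      simp [this]) (finBasis ℝ V j)
  rw [integral_finsetSum _ fun j _ => (hdiv j).1]
  exact Finset.sum_eq_zero fun j _ => (hdiv j).2

/-- Against test forms supported in the overlap of two charts, both local codifferentials are
adjoint to the same operator. Since such test forms separate smooth fields, the two agree there,
without any computation of the effect of a coordinate change. -/
theorem codiffField_eq_codiffChart {k : ℕ} {β : FormField J M (k + 1)} (hβ : IsSmoothForm J β)
    {p₀ p : M} (hp : p ∈ (extChartAt J p₀).source) :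
    codiffField b w P β p = codiffChart b w P p₀ β p := by
  have := hμ.isLocallyFiniteMeasure
  have := hμ.isOpenPosMeasure
  have hW : IsOpen ((extChartAt J p).source ∩ (extChartAt J p₀).source) :=
    (isOpen_extChartAt_source p).inter (isOpen_extChartAt_source p₀)
  refine hb.eq_of_forall_integral_eq (μ := μ) (γ := codiffChart b w P p β) hW
    (fun q hq => smoothFormAt_codiffChart hb hμ hβ hq.1)
    (fun q hq => smoothFormAt_codiffChart hb hμ hβ hq.2) (fun α hα hs => ?_)
    ⟨mem_extChartAt_source p, hp⟩
  rw [← integral_extDAlong_chart hb hμ hP hα hβ (hs.mono inter_subset_left),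
    integral_extDAlong_chart hb hμ hP hα hβ (hs.mono inter_subset_right)]

theorem chartRep_codiffField {k : ℕ} {β : FormField J M (k + 1)} (hβ : IsSmoothForm J β)
    {p₀ : M} {y : V} (hy : y ∈ (extChartAt J p₀).target) :
    chartRep J p₀ (codiffField b w P β) y =
      codiff (chartMetric b p₀) (w p₀) P (chartRep J p₀ β) y := by
  rw [← chartRep_fieldOf (codiff (chartMetric b p₀) (w p₀) P (chartRep J p₀ β)) hy]
  exact chartRep_eq_of_eq (codiffField_eq_codiffChart hb hμ hP hβ ((extChartAt J p₀).map_target hy))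

theorem IsSmoothForm.codiffField {k : ℕ} {β : FormField J M (k + 1)} (hβ : IsSmoothForm J β) :
    IsSmoothForm J (codiffField b w P β) := by
  intro p₀ y hy
  refine ContDiffAt.contDiffWithinAt ?_
  refine (contDiffAt_codiff_chart (P := P) hb hμ hβ hy).congr_of_eventuallyEq ?_
  filter_upwards [(isOpen_extChartAt_target p₀).mem_nhds hy] with z hz
  exact chartRep_codiffField hb hμ hP hβ hz

theorem integral_extDAlong_of_supportedIn {k : ℕ} {α : FormField J M k}
    {β : FormField J M (k + 1)} (hα : IsSmoothForm J α) (hβ : IsSmoothForm J β)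
    (hs : SupportedIn α univ) :
    ∫ p, b.pairing p (extDAlong J P α p) (β p) ∂μ =
      ∫ p, b.pairing p (α p) (codiffField b w P β p) ∂μ := by
  have := hμ.isLocallyFiniteMeasure
  have hβ' := isSmoothForm_iff.1 hβ
  have hδβ' := isSmoothForm_iff.1 (hβ.codiffField hb hμ hP)
  refine SupportedIn.induction (Q := fun α => ∫ p, b.pairing p (extDAlong J P α p) (β p) ∂μ =
      ∫ p, b.pairing p (α p) (codiffField b w P β p) ∂μ) ?_ ?_ ?_ hα hs
  · simp only [extDAlong_zero, Pi.zero_apply, pairing_zero_left]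
  · intro α α' hα hα' hs hs' h h'
    have h1 := isSmoothForm_iff.1 hα
    have h1' := isSmoothForm_iff.1 hα'
    have h2 := isSmoothForm_iff.1 (hα.extDAlong hP)
    have h2' := isSmoothForm_iff.1 (hα'.extDAlong hP)
    simp only [extDAlong_add P (h1 _) (h1' _), Pi.add_apply, pairing_add_left]
    rw [integral_add (hb.integrable_pairing (hs.extDAlong (P := P)) (fun p _ => h2 p) fun p _ => hβ' p)
      (hb.integrable_pairing (hs'.extDAlong (P := P)) (fun p _ => h2' p) fun p _ => hβ' p),
      integral_add (hb.integrable_pairing hs (fun p _ => h1 p) fun p _ => hδβ' p)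
      (hb.integrable_pairing hs' (fun p _ => h1' p) fun p _ => hδβ' p), h, h']
  · intro p₀ α hα hs
    rw [integral_extDAlong_chart hb hμ hP hα hβ hs]
    congr 1
    funext p
    by_cases hp : p ∈ (extChartAt J p₀).source
    · rw [codiffField_eq_codiffChart hb hμ hP hβ hp]
    · obtain ⟨K, hK, hKs, h0⟩ := hs
      rw [h0 p fun h => hp (hKs h), pairing_zero_left, pairing_zero_left]

/-- If only `β` has compact support, `α` is multiplied by a cut-off that is `1` near the support of
`β`. By locality neither integrand changes. -/
theorem integral_extDAlong {k : ℕ} {α : FormField J M k} {β : FormField J M (k + 1)}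
    (hα : IsSmoothForm J α) (hβ : IsSmoothForm J β) (hs : HasCptSupport α ∨ HasCptSupport β) :
    ∫ p, b.pairing p (extDAlong J P α p) (β p) ∂μ =
      ∫ p, b.pairing p (α p) (codiffField b w P β p) ∂μ := by
  rcases hs with hs | hs
  · exact integral_extDAlong_of_supportedIn hb hμ hP hα hβ hs.supportedIn
  · obtain ⟨K, hK, -, h0⟩ := hs.supportedIn
    obtain ⟨χ, hχ, ⟨K', hK', hχ0⟩, hχ1⟩ := exists_cutoff (J := J) hK
    have hs' : IsSmoothForm J (smulField χ α) := isSmoothForm_iff.2 fun p =>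
      SmoothFormAt.smul hχ.contMDiffAt (isSmoothForm_iff.1 hα p)
    have hsupp : SupportedIn (smulField χ α) univ := ⟨K', hK', subset_univ _, fun p hp => by
      change χ p • α p = 0
      rw [hχ0 p hp, zero_smul]⟩
    have hδ0 : ∀ p, p ∉ K → codiffField b w P β p = 0 := fun p hp => by
      rw [codiffField_congr (β' := 0), codiffField_zero]
      filter_upwards [hK.isClosed.isOpen_compl.mem_nhds hp] with q hq
      exact h0 q hq
    have hev : ∀ p ∈ K, ∀ᶠ q in 𝓝 p, α q = smulField χ α q := fun p hp => by
      filter_upwards [hχ1 p hp] with q hq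
      change α q = χ q • α q
      rw [hq, one_smul]
    have h1 : (fun p => b.pairing p (extDAlong J P α p) (β p)) =
        fun p => b.pairing p (extDAlong J P (smulField χ α) p) (β p) := by
      funext p
      by_cases hp : p ∈ K
      · rw [extDAlong_congr (hev p hp)]
      · rw [h0 p hp, pairing_zero_right, pairing_zero_right]
    have h2 : (fun p => b.pairing p (α p) (codiffField b w P β p)) =
        fun p => b.pairing p (smulField χ α p) (codiffField b w P β p) := by
      funext p
      by_cases hp : p ∈ K
      · rw [(hev p hp).self_of_nhds]
      · rw [hδ0 p hp, pairing_zero_right, pairing_zero_right]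
    rw [h1, h2]
    exact integral_extDAlong_of_supportedIn hb hμ hP hs' hβ hsupp

omit hb hμ in
/-- The exterior derivative along `P` on smooth forms. -/
def smoothD (k : ℕ) : smoothForms J M k →ₗ[ℝ] smoothForms J M (k + 1) where
  toFun η := ⟨extDAlong J P η, η.2.extDAlong hP⟩
  map_add' η ζ := Subtype.ext <| funext fun p =>
    extDAlong_add P (isSmoothForm_iff.1 η.2 p) (isSmoothForm_iff.1 ζ.2 p)
  map_smul' c η := Subtype.ext <| funext fun p => by
    have h1 : chartRep J p (c • (η : FormField J M k)) = c • chartRep J p (η : FormField J M k) := by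
      funext y; ext v; rfl
    change extDAlong J P (c • (η : FormField J M k)) p = c • extDAlong J P η p
    have h2 : fderiv ℝ (c • chartRep J p (η : FormField J M k)) (extChartAt J p p) =
        c • fderiv ℝ (chartRep J p (η : FormField J M k)) (extChartAt J p p) :=
      fderiv_const_smul ((isSmoothForm_iff.1 η.2 p).differentiableAt (by simp)) c
    rw [extDAlong, extDAlong, h1, h2,
      ContinuousLinearMap.smul_comp, ContinuousAlternatingMap.alternatizeUncurryFin_smul]
    rfl

/-- The codifferential along `P` on smooth forms. -/
def smoothCodiff (k : ℕ) : smoothForms J M (k + 1) →ₗ[ℝ] smoothForms J M k where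
  toFun η := ⟨codiffField b w P η, IsSmoothForm.codiffField hb hμ hP η.2⟩
  map_add' η ζ := Subtype.ext <| funext fun p => by
    have hy := mem_extChartAt_target (I := J) p
    have h1 : chartRep J p ((η : FormField J M (k + 1)) + (ζ : FormField J M (k + 1))) =
      fun y => chartRep J p (η : FormField J M (k + 1)) y + chartRep J p (ζ : FormField J M (k + 1)) y := by
      funext y; ext v; rfl
    change codiffField b w P ((η : FormField J M (k + 1)) + (ζ : FormField J M (k + 1))) p =
      codiffField b w P η p + codiffField b w P ζ p
    rw [codiffField, codiffField, codiffField, codiffChart, codiffChart, codiffChart, fieldOf,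
      fieldOf, fieldOf, h1, codiff_add (hb.contDiffAt_sharpL hy) (hμ.contDiffAt hy)
        (IsSmoothForm.contDiffAt η.2 hy) (IsSmoothForm.contDiffAt ζ.2 hy)]
    rfl
  map_smul' c η := Subtype.ext <| funext fun p => by
    have hy := mem_extChartAt_target (I := J) p
    have h1 : chartRep J p (c • (η : FormField J M (k + 1))) =
      fun y => (fun _ => c) y • chartRep J p (η : FormField J M (k + 1)) y := by
      funext y; ext v; rfl
    change codiffField b w P (c • (η : FormField J M (k + 1))) p = c • codiffField b w P η p
    rw [codiffField, codiffField, codiffChart, codiffChart, fieldOf, fieldOf, h1,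
      codiff_smul (hb.isInner hy) (hb.contDiffAt_sharpL hy) (hμ.contDiffAt hy)
        (hμ.pos p _ hy).ne' (IsSmoothForm.contDiffAt η.2 hy) (differentiableAt_const c)]
    ext v
    simp

theorem isFormalAdjoint_smoothD (k : ℕ) :
    IsFormalAdjoint b μ (smoothD hP k) (smoothCodiff hb hμ hP k) :=
  fun α β h => integral_extDAlong hb hμ hP α.2 β.2 h

omit hP in
theorem isFormalAdjoint_unique {k l : ℕ} {D : smoothForms J M k →ₗ[ℝ] smoothForms J M l}
    {δ δ' : smoothForms J M l →ₗ[ℝ] smoothForms J M k}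
    (h : IsFormalAdjoint b μ D δ) (h' : IsFormalAdjoint b μ D δ') : δ' = δ := by
  have := hμ.isLocallyFiniteMeasure
  have := hμ.isOpenPosMeasure
  ext1 β
  refine Subtype.ext (funext fun p => ?_)
  refine hb.eq_of_forall_integral_eq (μ := μ) isOpen_univ (fun q _ => isSmoothForm_iff.1 (δ' β).2 q)
    (fun q _ => isSmoothForm_iff.1 (δ β).2 q) (fun α hα hs => ?_) (mem_univ p)
  rw [← h ⟨α, hα⟩ β (Or.inl hs.hasCptSupport), ← h' ⟨α, hα⟩ β (Or.inl hs.hasCptSupport)]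

/-- Each summand is symmetric: `∫⟨δdα, β⟩ = ∫⟨dα, dβ⟩ = ∫⟨α, δdβ⟩`, and likewise for `dδ`. Neither
`d` nor `δ` enlarges supports, so each step has a compactly supported factor and the integrals may
be split. -/
theorem isFormalAdjoint_hodgeLaplacian (k : ℕ) :
    IsFormalAdjoint b μ (hodgeLaplacian (smoothD hP) (smoothCodiff hb hμ hP) k)
      (hodgeLaplacian (smoothD hP) (smoothCodiff hb hμ hP) k) := by
  have := hμ.isLocallyFiniteMeasure
  have hsm {l : ℕ} (ζ : smoothForms J M l) (p : M) : SmoothFormAt J (ζ : FormField J M l) p :=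
    isSmoothForm_iff.1 ζ.2 p
  have hcd {l : ℕ} {ζ : smoothForms J M l} (h : HasCptSupport (ζ : FormField J M l)) :
      HasCptSupport (smoothD hP l ζ : FormField J M (l + 1)) :=
    (h.supportedIn.extDAlong (P := P)).hasCptSupport
  have hcδ {l : ℕ} {ζ : smoothForms J M (l + 1)} (h : HasCptSupport (ζ : FormField J M (l + 1))) :
      HasCptSupport (smoothCodiff hb hμ hP l ζ : FormField J M l) :=
    (h.supportedIn.codiffField (b := b) (w := w) (P := P)).hasCptSupport
  have hint {l : ℕ} (ζ ξ : smoothForms J M l)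
      (h : HasCptSupport (ζ : FormField J M l) ∨ HasCptSupport (ξ : FormField J M l)) :
      Integrable (fun p => b.pairing p ((ζ : FormField J M l) p) ((ξ : FormField J M l) p)) μ := by
    rcases h with h | h
    · exact hb.integrable_pairing h.supportedIn (fun p _ => hsm ζ p) fun p _ => hsm ξ p
    · have := hb.integrable_pairing (μ := μ) h.supportedIn (fun p _ => hsm ξ p) fun p _ => hsm ζ p
      exact this.congr (Filter.Eventually.of_forall fun p => hb.pairing_comm _ _ p)
  have hdd {l : ℕ} (α β : smoothForms J M l)
      (h : HasCptSupport (α : FormField J M l) ∨ HasCptSupport (β : FormField J M l)) :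
      ∫ p, b.pairing p ((smoothCodiff hb hμ hP l (smoothD hP l α) : FormField J M l) p)
        ((β : FormField J M l) p) ∂μ =
      ∫ p, b.pairing p ((α : FormField J M l) p)
        ((smoothCodiff hb hμ hP l (smoothD hP l β) : FormField J M l) p) ∂μ := by
    rw [← isFormalAdjoint_smoothD hb hμ hP l α (smoothD hP l β) (h.imp id hcd)]
    simp only [hb.pairing_comm (smoothCodiff hb hμ hP l (smoothD hP l α) : FormField J M l) β]
    rw [← isFormalAdjoint_smoothD hb hμ hP l β (smoothD hP l α) (h.symm.imp id hcd)]
    simp only [hb.pairing_comm (smoothD hP l β : FormField J M (l + 1)) (smoothD hP l α)]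
  have hδδ {l : ℕ} (α β : smoothForms J M (l + 1))
      (h : HasCptSupport (α : FormField J M (l + 1)) ∨ HasCptSupport (β : FormField J M (l + 1))) :
      ∫ p, b.pairing p ((smoothD hP l (smoothCodiff hb hμ hP l α) : FormField J M (l + 1)) p)
        ((β : FormField J M (l + 1)) p) ∂μ =
      ∫ p, b.pairing p ((α : FormField J M (l + 1)) p)
        ((smoothD hP l (smoothCodiff hb hμ hP l β) : FormField J M (l + 1)) p) ∂μ := by
    rw [isFormalAdjoint_smoothD hb hμ hP l (smoothCodiff hb hμ hP l α) β (h.imp hcδ id)]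
    simp only [hb.pairing_comm (α : FormField J M (l + 1))
      (smoothD hP l (smoothCodiff hb hμ hP l β))]
    rw [isFormalAdjoint_smoothD hb hμ hP l (smoothCodiff hb hμ hP l β) α (h.symm.imp hcδ id)]
    simp only [hb.pairing_comm (smoothCodiff hb hμ hP l β : FormField J M l)
      (smoothCodiff hb hμ hP l α)]
  intro α β h
  cases k with
  | zero => exact hdd α β h
  | succ k =>
    have e1 (p : M) : b.pairing p ((hodgeLaplacian (smoothD hP) (smoothCodiff hb hμ hP) (k + 1) α :
        FormField J M (k + 1)) p) ((β : FormField J M (k + 1)) p) =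
        b.pairing p ((smoothD hP k (smoothCodiff hb hμ hP k α) : FormField J M (k + 1)) p)
          ((β : FormField J M (k + 1)) p) +
        b.pairing p ((smoothCodiff hb hμ hP (k + 1) (smoothD hP (k + 1) α) :
          FormField J M (k + 1)) p) ((β : FormField J M (k + 1)) p) := pairing_add_left _ _ _ _ _
    have e2 (p : M) : b.pairing p ((α : FormField J M (k + 1)) p)
        ((hodgeLaplacian (smoothD hP) (smoothCodiff hb hμ hP) (k + 1) β :
        FormField J M (k + 1)) p) =
        b.pairing p ((α : FormField J M (k + 1)) p)
          ((smoothD hP k (smoothCodiff hb hμ hP k β) : FormField J M (k + 1)) p) +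
        b.pairing p ((α : FormField J M (k + 1)) p)
          ((smoothCodiff hb hμ hP (k + 1) (smoothD hP (k + 1) β) : FormField J M (k + 1)) p) :=
      pairing_add_right _ _ _ _ _
    simp only [e1, e2]
    rw [integral_add (hint _ _ (h.imp (fun h => hcd (hcδ h)) id))
      (hint _ _ (h.imp (fun h => hcδ (hcd h)) id)),
      integral_add (hint _ _ (h.imp id fun h => hcd (hcδ h)))
      (hint _ _ (h.imp id fun h => hcδ (hcd h))), hdd α β h, hδδ α β h]

end Adjoint

/-- `E`, `F` are the commutators of `D`, and `I`, `K` those of `D'`, with the two multiplications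
`m` and `n`. When `E` and `I` commute with `n`, expanding `D' ∘ D` leaves only the products of two
commutators in the double commutator. -/
theorem doubleCommutator_comp {A B C : Type*} [AddCommMonoid A] [AddCommMonoid B]
    [AddCommMonoid C] [Module ℝ A] [Module ℝ B] [Module ℝ C] {D : A →ₗ[ℝ] B} {D' : B →ₗ[ℝ] C}
    {mA nA : A →ₗ[ℝ] A} {mB nB : B →ₗ[ℝ] B} {mC nC : C →ₗ[ℝ] C} {E F : A → B} {I K : B → C}
    (hE : ∀ a, D (mA a) = mB (D a) + E a) (hF : ∀ a, D (nA a) = nB (D a) + F a)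
    (hI : ∀ a, D' (mB a) = mC (D' a) + I a) (hK : ∀ a, D' (nB a) = nC (D' a) + K a)
    (hE' : ∀ a, E (nA a) = nB (E a)) (hI' : ∀ a, I (nB a) = nC (I a))
    (hC : ∀ a, nC (mC a) = mC (nC a)) (a : A) :
    D' (D (mA (nA a))) + mC (nC (D' (D a))) =
      mC (D' (D (nA a))) + nC (D' (D (mA a))) + (I (F a) + K (E a)) := by
  simp only [hE, hF, hI, hK, hE', hI', hC, map_add]
  abel

/-! ### Commutators with functions and the symbol of the Laplacian -/

section Commutator

variable {V : Type*} [NormedAddCommGroup V] [NormedSpace ℝ V] [FiniteDimensional ℝ V]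
  [MeasurableSpace V] [BorelSpace V] {ν : Measure V} [ν.IsAddHaarMeasure]
  {H : Type*} [TopologicalSpace H] {J : ModelWithCorners ℝ V H} [J.Boundaryless]
  {M : Type*} [TopologicalSpace M] [ChartedSpace H M] [IsManifold J ∞ M] [T2Space M]
  [MeasurableSpace M] [BorelSpace M]

theorem IsSmoothForm.smulField {k : ℕ} {η : FormField J M k} (hη : IsSmoothForm J η)
    (f : C^∞⟮J, M; ℝ⟯) : IsSmoothForm J (smulField f η) :=
  isSmoothForm_iff.2 fun p => SmoothFormAt.smul f.contMDiff.contMDiffAt (isSmoothForm_iff.1 hη p)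

/-- Multiplication of smooth forms by a smooth function. -/
def smoothMul (f : C^∞⟮J, M; ℝ⟯) (k : ℕ) : smoothForms J M k →ₗ[ℝ] smoothForms J M k where
  toFun η := ⟨smulField f η, IsSmoothForm.smulField η.2 f⟩
  map_add' _ _ := Subtype.ext <| funext fun p => smul_add (f p) _ _
  map_smul' c _ := Subtype.ext <| funext fun p => smul_comm (f p) c _

variable (J) in
/-- The differential of `f` along `P` in the preferred chart at `p`. -/
def chartDeriv (P : V →L[ℝ] V) (f : M → ℝ) (p : M) : V →L[ℝ] ℝ :=
  (fderiv ℝ (fun z => f ((extChartAt J p).symm z)) (extChartAt J p p)).comp P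

variable {b : SymTensor J M} {μ : Measure M} {w : M → V → ℝ} {P : V →L[ℝ] V}
  (hb : IsRiemannian b) (hμ : HasSmoothDensity ν J μ w) (hP : CommutesWithCharts J M P)

/-- The commutator of the exterior derivative with the multiplication by a function. -/
def commD (f : C^∞⟮J, M; ℝ⟯) (k : ℕ) (η : smoothForms J M k) : smoothForms J M (k + 1) :=
  smoothD hP k (smoothMul f k η) + (-1 : ℝ) • smoothMul f (k + 1) (smoothD hP k η)

/-- The commutator of the codifferential with the multiplication by a function. -/
def commCodiff (f : C^∞⟮J, M; ℝ⟯) (k : ℕ) (η : smoothForms J M (k + 1)) : smoothForms J M k :=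
  smoothCodiff hb hμ hP k (smoothMul f (k + 1) η) +
    (-1 : ℝ) • smoothMul f k (smoothCodiff hb hμ hP k η)

theorem smoothForms_eq_add_add_neg_smul {k : ℕ} (η ζ : smoothForms J M k) :
    η = ζ + (η + (-1 : ℝ) • ζ) :=
  Subtype.ext <| funext fun p => by
    ext v
    change _ = (ζ : FormField J M k) p v + ((η : FormField J M k) p v +
      (-1 : ℝ) * (ζ : FormField J M k) p v)
    ring

theorem chartRep_add_neg_smul {k : ℕ} (p : M) (η ζ : smoothForms J M k) (y : V) :
    chartRep J p ((η + (-1 : ℝ) • ζ : smoothForms J M k) : FormField J M k) y =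
      chartRep J p (η : FormField J M k) y - chartRep J p (ζ : FormField J M k) y := by
  ext v
  change chartRep J p (η : FormField J M k) y v + (-1 : ℝ) * chartRep J p (ζ : FormField J M k) y v
    = chartRep J p (η : FormField J M k) y v - chartRep J p (ζ : FormField J M k) y v
  ring

theorem chartRep_smoothD_smoothMul (f : C^∞⟮J, M; ℝ⟯) {k : ℕ} (η : smoothForms J M k) (p : M) {y : V}
    (hy : y ∈ (extChartAt J p).target) :
    chartRep J p (smoothD hP k (smoothMul f k η) : FormField J M (k + 1)) y =
      f ((extChartAt J p).symm y) • chartRep J p (smoothD hP k η : FormField J M (k + 1)) y +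
      wedge ((fderiv ℝ (fun z => f ((extChartAt J p).symm z)) y).comp P)
        (chartRep J p (η : FormField J M k) y) :=
  extDAlong_smulField hP hy f.contMDiff.contMDiffAt (IsSmoothForm.contDiffAt η.2 hy)

theorem chartRep_smoothCodiff {k : ℕ} (η : smoothForms J M (k + 1)) (p : M) {y : V}
    (hy : y ∈ (extChartAt J p).target) :
    chartRep J p (smoothCodiff hb hμ hP k η : FormField J M k) y =
      codiff (chartMetric b p) (w p) P (chartRep J p (η : FormField J M (k + 1))) y :=
  chartRep_codiffField hb hμ hP η.2 hy

theorem chartRep_smoothMul (f : C^∞⟮J, M; ℝ⟯) {k : ℕ} (η : smoothForms J M k) (p : M) :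
    chartRep J p (smoothMul f k η : FormField J M k) =
      fun y => f ((extChartAt J p).symm y) • chartRep J p (η : FormField J M k) y := rfl

theorem chartRep_smoothMul_self (f : C^∞⟮J, M; ℝ⟯) {k : ℕ} (η : smoothForms J M k) (p : M) :
    chartRep J p (smoothMul f k η : FormField J M k) (extChartAt J p p) =
      f p • chartRep J p (η : FormField J M k) (extChartAt J p p) := by
  rw [chartRep_smoothMul]
  beta_reduce
  rw [(extChartAt J p).left_inv (mem_extChartAt_source p)]

theorem commD_eq (f : C^∞⟮J, M; ℝ⟯) {k : ℕ} (η : smoothForms J M k) :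
    smoothD hP k (smoothMul f k η) = smoothMul f (k + 1) (smoothD hP k η) + commD hP f k η :=
  smoothForms_eq_add_add_neg_smul _ _

theorem commCodiff_eq (f : C^∞⟮J, M; ℝ⟯) {k : ℕ} (η : smoothForms J M (k + 1)) :
    smoothCodiff hb hμ hP k (smoothMul f (k + 1) η) =
      smoothMul f k (smoothCodiff hb hμ hP k η) + commCodiff hb hμ hP f k η :=
  smoothForms_eq_add_add_neg_smul _ _

/-- The Leibniz rule leaves a pointwise operation with no derivative of `η`, which is why this
commutator itself commutes with multiplications. The product rule for the codifferential does the
same for `commCodiff`. -/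
theorem chartRep_commD (f : C^∞⟮J, M; ℝ⟯) {k : ℕ} (η : smoothForms J M k) (p : M) :
    chartRep J p (commD hP f k η : FormField J M (k + 1)) (extChartAt J p p) =
      wedge (chartDeriv J P f p) (chartRep J p (η : FormField J M k) (extChartAt J p p)) := by
  rw [commD, chartRep_add_neg_smul, chartRep_smoothD_smoothMul hP f η p (mem_extChartAt_target p),
    chartRep_smoothMul, add_sub_cancel_left]
  rfl

theorem chartRep_commCodiff (f : C^∞⟮J, M; ℝ⟯) {k : ℕ} (η : smoothForms J M (k + 1)) (p : M) :
    chartRep J p (commCodiff hb hμ hP f k η : FormField J M k) (extChartAt J p p) =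
      -(chartRep J p (η : FormField J M (k + 1)) (extChartAt J p p)).curryLeft
        (sharpL (chartMetric b p (extChartAt J p p)) (chartDeriv J P f p)) := by
  have hy := mem_extChartAt_target (I := J) p
  rw [commCodiff, chartRep_add_neg_smul, chartRep_smoothCodiff hb hμ hP _ p hy, chartRep_smoothMul,
    chartRep_smoothMul]
  beta_reduce
  rw [chartRep_smoothCodiff hb hμ hP _ p hy,
    codiff_smul (hb.isInner hy) (hb.contDiffAt_sharpL hy) (hμ.contDiffAt hy)
    (hμ.pos p _ hy).ne' (IsSmoothForm.contDiffAt η.2 hy)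
    ((contDiffAt_comp_chartSymm hy f.contMDiff.contMDiffAt).differentiableAt (by simp))]
  ext v
  simp [chartDeriv]

theorem smoothForms_ext {k : ℕ} {η ζ : smoothForms J M k}
    (h : ∀ p, chartRep J p (η : FormField J M k) (extChartAt J p p) =
      chartRep J p (ζ : FormField J M k) (extChartAt J p p)) : η = ζ :=
  Subtype.ext <| funext fun p => formField_ext_chart (mem_extChartAt_source p) (h p)

theorem commD_smoothMul (f h : C^∞⟮J, M; ℝ⟯) {k : ℕ} (η : smoothForms J M k) :
    commD hP f k (smoothMul h k η) = smoothMul h (k + 1) (commD hP f k η) :=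
  smoothForms_ext fun p => by
    rw [chartRep_commD, chartRep_smoothMul_self, chartRep_smoothMul_self, chartRep_commD, wedge_smul]

theorem commCodiff_smoothMul (f h : C^∞⟮J, M; ℝ⟯) {k : ℕ} (η : smoothForms J M (k + 1)) :
    commCodiff hb hμ hP f k (smoothMul h (k + 1) η) =
      smoothMul h k (commCodiff hb hμ hP f k η) :=
  smoothForms_ext fun p => by
    rw [chartRep_commCodiff, chartRep_smoothMul_self, chartRep_smoothMul_self, chartRep_commCodiff]
    ext v; simp

theorem smoothMul_comm (f h : C^∞⟮J, M; ℝ⟯) {k : ℕ} (η : smoothForms J M k) :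
    smoothMul h k (smoothMul f k η) = smoothMul f k (smoothMul h k η) :=
  Subtype.ext <| funext fun p => smul_comm (h p) (f p) _

theorem doubleComm_codiff_d (f h : C^∞⟮J, M; ℝ⟯) {k : ℕ} (η : smoothForms J M k) :
    smoothCodiff hb hμ hP k (smoothD hP k (smoothMul f k (smoothMul h k η))) +
        smoothMul f k (smoothMul h k (smoothCodiff hb hμ hP k (smoothD hP k η))) =
      smoothMul f k (smoothCodiff hb hμ hP k (smoothD hP k (smoothMul h k η))) +
        smoothMul h k (smoothCodiff hb hμ hP k (smoothD hP k (smoothMul f k η))) +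
      (commCodiff hb hμ hP f k (commD hP h k η) + commCodiff hb hμ hP h k (commD hP f k η)) :=
  doubleCommutator_comp (commD_eq hP f) (commD_eq hP h)
    (commCodiff_eq hb hμ hP f) (commCodiff_eq hb hμ hP h) (commD_smoothMul hP f h)
    (commCodiff_smoothMul hb hμ hP f h) (smoothMul_comm f h) η

theorem doubleComm_d_codiff (f h : C^∞⟮J, M; ℝ⟯) {k : ℕ} (η : smoothForms J M (k + 1)) :
    smoothD hP k (smoothCodiff hb hμ hP k (smoothMul f (k + 1) (smoothMul h (k + 1) η))) +
        smoothMul f (k + 1) (smoothMul h (k + 1) (smoothD hP k (smoothCodiff hb hμ hP k η))) =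
      smoothMul f (k + 1) (smoothD hP k (smoothCodiff hb hμ hP k (smoothMul h (k + 1) η))) +
        smoothMul h (k + 1) (smoothD hP k (smoothCodiff hb hμ hP k (smoothMul f (k + 1) η))) +
      (commD hP f k (commCodiff hb hμ hP h k η) + commD hP h k (commCodiff hb hμ hP f k η)) :=
  doubleCommutator_comp (commCodiff_eq hb hμ hP f)
    (commCodiff_eq hb hμ hP h) (commD_eq hP f) (commD_eq hP h) (commCodiff_smoothMul hb hμ hP f h)
    (commD_smoothMul hP f h) (smoothMul_comm f h) η

theorem chartRep_commCodiff_commD (f h : C^∞⟮J, M; ℝ⟯) {k : ℕ} (η : smoothForms J M k) (p : M) :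
    chartRep J p (commCodiff hb hμ hP f k (commD hP h k η) : FormField J M k) (extChartAt J p p) =
      -(wedge (chartDeriv J P h p) (chartRep J p (η : FormField J M k)
        (extChartAt J p p))).curryLeft
        (sharpL (chartMetric b p (extChartAt J p p)) (chartDeriv J P f p)) := by
  rw [chartRep_commCodiff, chartRep_commD]

theorem chartRep_commD_commCodiff (f h : C^∞⟮J, M; ℝ⟯) {k : ℕ} (η : smoothForms J M (k + 1))
    (p : M) :
    chartRep J p (commD hP f k (commCodiff hb hμ hP h k η) : FormField J M (k + 1))
      (extChartAt J p p) =
      -wedge (chartDeriv J P f p) ((chartRep J p (η : FormField J M (k + 1))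
        (extChartAt J p p)).curryLeft
        (sharpL (chartMetric b p (extChartAt J p p)) (chartDeriv J P h p))) := by
  rw [chartRep_commD, chartRep_commCodiff]
  ext v; simp [wedge_apply]

/-- The principal symbol of the Laplacian along `P`. -/
theorem doubleComm_hodgeLaplacian (f h : C^∞⟮J, M; ℝ⟯) {k : ℕ} (η : smoothForms J M k) :
    ∃ S : smoothForms J M k,
      hodgeLaplacian (smoothD hP) (smoothCodiff hb hμ hP) k (smoothMul f k (smoothMul h k η)) +
        smoothMul f k (smoothMul h k (hodgeLaplacian (smoothD hP) (smoothCodiff hb hμ hP) k η)) =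
      smoothMul f k (hodgeLaplacian (smoothD hP) (smoothCodiff hb hμ hP) k (smoothMul h k η)) +
        smoothMul h k (hodgeLaplacian (smoothD hP) (smoothCodiff hb hμ hP) k (smoothMul f k η)) +
      S ∧ ∀ p, (S : FormField J M k) p =
        -(2 * chartDeriv J P f p (sharpL (chartMetric b p (extChartAt J p p))
        (chartDeriv J P h p))) • (η : FormField J M k) p := by
  have hsymm (p) := (hb.isInner (mem_extChartAt_target (I := J) p)).apply_sharpL_symm
    (chartDeriv J P f p) (chartDeriv J P h p)
  have hR (p) (c : ℝ) : chartRep J p (fun q => c • (η : FormField J M k) q) (extChartAt J p p) =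
      c • chartRep J p (η : FormField J M k) (extChartAt J p p) := rfl
  have hadd {l : ℕ} (α β : smoothForms J M l) (p) : chartRep J p ((α + β : smoothForms J M l) :
      FormField J M l) (extChartAt J p p) = chartRep J p (α : FormField J M l) (extChartAt J p p) +
      chartRep J p (β : FormField J M l) (extChartAt J p p) := rfl
  cases k with
  | zero =>
    refine ⟨_, doubleComm_codiff_d hb hμ hP f h η, fun p => ?_⟩
    refine formField_ext_chart (ζ := fun q => -(2 * chartDeriv J P f p (sharpL (chartMetric b p
      (extChartAt J p p)) (chartDeriv J P h p))) • (η : FormField J M 0) q)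
      (mem_extChartAt_source p) ?_
    rw [hR, hadd, chartRep_commCodiff_commD, chartRep_commCodiff_commD, curryLeft_wedge_zero,
      curryLeft_wedge_zero, ← hsymm]
    ext v
    simp only [ContinuousAlternatingMap.add_apply, ContinuousAlternatingMap.neg_apply,
      ContinuousAlternatingMap.smul_apply, smul_eq_mul]
    ring
  | succ k =>
    refine ⟨(commD hP f k (commCodiff hb hμ hP h k η) + commD hP h k (commCodiff hb hμ hP f k η)) +
      (commCodiff hb hμ hP f (k + 1) (commD hP h (k + 1) η) +
        commCodiff hb hμ hP h (k + 1) (commD hP f (k + 1) η)), ?_, fun p => ?_⟩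
    · have h1 := doubleComm_d_codiff hb hμ hP f h η
      have h2 := doubleComm_codiff_d hb hμ hP f h η
      have h3 := congrArg₂ (· + ·) h1 h2
      simp only [hodgeLaplacian, LinearMap.add_apply, LinearMap.comp_apply, map_add]
      beta_reduce at h3
      rw [add_add_add_comm, h3, add_add_add_comm, add_add_add_comm (smoothMul f _ _)]
    · refine formField_ext_chart (ζ := fun q => -(2 * chartDeriv J P f p (sharpL (chartMetric b p
        (extChartAt J p p)) (chartDeriv J P h p))) • (η : FormField J M (k + 1)) q)
        (mem_extChartAt_source p) ?_
      -- Cartan's identity rewrites each contraction of a wedge, so that the wedges of contractions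
      -- cancel. The two scalars that survive are equal by symmetry of the inverse metric, which
      -- gives the factor `2`.
      rw [hR, hadd, hadd, hadd, chartRep_commCodiff_commD, chartRep_commCodiff_commD,
        chartRep_commD_commCodiff, chartRep_commD_commCodiff,
        eq_sub_of_add_eq (curryLeft_wedge (chartDeriv J P f p) _ _),
        eq_sub_of_add_eq (curryLeft_wedge (chartDeriv J P h p) _ _), ← hsymm]
      ext v
      simp only [ContinuousAlternatingMap.add_apply, ContinuousAlternatingMap.neg_apply,
        ContinuousAlternatingMap.sub_apply, ContinuousAlternatingMap.smul_apply, smul_eq_mul]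
      ring

end Commutator

/-! ### Codifferential and pairing of one-forms -/

section Functions

variable {V : Type*} [NormedAddCommGroup V] [NormedSpace ℝ V] [FiniteDimensional ℝ V]

/-- The result has no arguments left to be raised or lowered, so the general formula reduces to the
classical divergence of a vector field with respect to `w`. -/
theorem codiff_oneForm {G : V → V →L[ℝ] V →L[ℝ] ℝ} {w : V → ℝ} {P : V →L[ℝ] V}
    {β : V → V [⋀^Fin 1]→L[ℝ] ℝ} {y : V}
    (hG : ContDiffAt ℝ ∞ (fun z => sharpL (G z)) y) (hw : ContDiffAt ℝ ∞ w y)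
    (hβ : ContDiffAt ℝ ∞ β y) (v : Fin 0 → V) :
    codiff G w P β y v = -(w y)⁻¹ * ∑ j, fderiv ℝ (fun z => w z *
      β z (fun _ => sharpL (G z) ((coord V j).comp P))) y (finBasis ℝ V j) := by
  have h1 (j) : fderiv ℝ (fun z => w z * β z (fun _ => sharpL (G z) ((coord V j).comp P))) y
      (finBasis ℝ V j) = fderiv ℝ (flux G w P β j) y (finBasis ℝ V j) v := by
    have hd : DifferentiableAt ℝ (flux G w P β j) y :=
      (contDiffAt_flux hG hw hβ j).differentiableAt (by simp)
    have e : (fun z => w z * β z (fun _ => sharpL (G z) ((coord V j).comp P))) =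
        fun z => flux G w P β j z v := by
      funext z
      simp only [flux, ContinuousAlternatingMap.smul_apply, smul_eq_mul,
        ContinuousAlternatingMap.compContinuousLinearMap_apply,
        ContinuousAlternatingMap.curryLeft_apply_apply]
      congr 2
      funext i
      rw [Subsingleton.elim i 0, Matrix.cons_val_zero]
    rw [e, (hd.hasFDerivAt.continuousAlternatingMap_apply_const v).fderiv]
    rfl
  simp only [h1, codiff, ContinuousAlternatingMap.compContinuousLinearMap_apply,
    ContinuousAlternatingMap.smul_apply, ContinuousAlternatingMap.sum_apply, smul_eq_mul]
  congr 1
  refine Finset.sum_congr rfl fun j _ => ?_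
  congr 1
  exact Subsingleton.elim _ _

theorem alternatize_zeroForm (a : V →L[ℝ] V [⋀^Fin 0]→L[ℝ] ℝ) (u : Fin 1 → V) :
    ContinuousAlternatingMap.alternatizeUncurryFin a u = a (u 0) ![] := by
  rw [ContinuousAlternatingMap.alternatizeUncurryFin_apply, Finset.sum_eq_single 0
    (fun i _ hi => (hi (Subsingleton.elim (α := Fin 1) i 0)).elim) (by simp), Fin.val_zero, pow_zero, one_smul]
  congr 1
  exact Subsingleton.elim _ _

theorem formPair_oneForm (B : V →L[ℝ] V →L[ℝ] ℝ) (α β : V [⋀^Fin 1]→L[ℝ] ℝ) (θ ξ : V →L[ℝ] ℝ)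
    (hα : ∀ u, α u = θ (u 0)) (hβ : ∀ u, β u = ξ (u 0)) : formPair B α β = ξ (sharpL B θ) := by
  conv_rhs => rw [← sum_coord_smul θ, map_sum, map_sum]
  simp only [formPair, hα, hβ, Nat.factorial_one, Nat.cast_one, inv_one, one_mul, map_smul,
    smul_eq_mul]
  exact Fintype.sum_equiv (Equiv.funUnique (Fin 1) _) _ _ fun f => rfl

end Functions

/-! ### Warped metrics over a product decomposition -/

section Warped

variable {V : Type*} [NormedAddCommGroup V] [NormedSpace ℝ V] [FiniteDimensional ℝ V]
  {H : Type*} [TopologicalSpace H] {J : ModelWithCorners ℝ V H}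
  {M : Type*} [TopologicalSpace M] [ChartedSpace H M] [IsManifold J ∞ M]
  {ι : Type*} [Fintype ι]

theorem IsRiemannian.of_chart {b : SymTensor J M}
    (hpos : ∀ p₀ : M, ∀ y ∈ (extChartAt J p₀).target, ∀ v ≠ 0, 0 < chartMetric b p₀ y v v)
    (hsmooth : ∀ (p₀ : M) (v w : V),
      ContDiffOn ℝ ∞ (fun y => chartMetric b p₀ y v w) (extChartAt J p₀).target)
    [J.Boundaryless] : IsRiemannian b where
  pos p v hv := by
    have hp := mem_extChartAt_source (I := J) p
    have hy := mem_extChartAt_target (I := J) p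
    -- The base point is generalised because `p` equals the image of its coordinates only
    -- propositionally, and the tangent space depends on it.
    have key : ∀ q, q = (extChartAt J p).symm (extChartAt J p p) →
        ∀ u : TangentSpace J q, u ≠ 0 → 0 < b.inner q u u := by
      rintro q rfl u hu
      have h1 := chartInv_chartDer hy u
      have h2 := hpos p _ hy (chartDer J p ((extChartAt J p).symm (extChartAt J p p)) u)
        fun h => hu (by rw [← h1, h, map_zero])
      rwa [chartMetric_apply, h1] at h2
    exact key p ((extChartAt J p).left_inv hp).symm v hv
  smooth := hsmooth

/-- The metric `b` arises from `b₀` by scaling the factors of a product decomposition, with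
projections `P a`, by functions `t a` which are constant in the direction of the factor. -/
structure IsWarped (b b₀ : SymTensor J M) (P : ι → V →L[ℝ] V) (t : ι → C^∞⟮J, M; ℝ⟯) : Prop where
  comm : ∀ a, CommutesWithCharts J M (P a)
  sum_proj : ∑ a, P a = ContinuousLinearMap.id ℝ V
  proj_proj : ∀ a, (P a).comp (P a) = P a
  proj_proj_ne : ∀ a c, a ≠ c → (P a).comp (P c) = 0
  pos : ∀ a p, 0 < t a p
  inner_eq : ∀ (p₀ : M), ∀ y ∈ (extChartAt J p₀).target, ∀ v w, chartMetric b p₀ y v w =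
    ∑ a, t a ((extChartAt J p₀).symm y) * chartMetric b₀ p₀ y (P a v) (P a w)
  selfAdjoint : ∀ (p₀ : M), ∀ y ∈ (extChartAt J p₀).target, ∀ a v w,
    chartMetric b₀ p₀ y (P a v) w = chartMetric b₀ p₀ y v (P a w)
  fderiv_comp : ∀ (p₀ : M), ∀ y ∈ (extChartAt J p₀).target, ∀ a,
    (fderiv ℝ (fun z => t a ((extChartAt J p₀).symm z)) y).comp (P a) = 0

namespace IsWarped

variable [J.Boundaryless] {b b₀ : SymTensor J M} {P : ι → V →L[ℝ] V} {t : ι → C^∞⟮J, M; ℝ⟯}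
  (hw : IsWarped b b₀ P t) (hb₀ : IsRiemannian b₀)
include hw

theorem sum_apply (v : V) : ∑ a, P a v = v := by
  have := congrArg (fun A : V →L[ℝ] V => A v) hw.sum_proj
  simpa using this

theorem contDiffAt_weight (a : ι) {p₀ : M} {y : V} (hy : y ∈ (extChartAt J p₀).target) :
    ContDiffAt ℝ ∞ (fun z => t a ((extChartAt J p₀).symm z)) y :=
  contDiffAt_comp_chartSymm hy (t a).contMDiff.contMDiffAt

include hb₀

theorem isRiemannian : IsRiemannian b := by
  refine IsRiemannian.of_chart (fun p₀ y hy v hv => ?_) fun p₀ v w => ?_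
  · rw [hw.inner_eq p₀ y hy]
    have hin := hb₀.isInner hy
    obtain ⟨a, ha⟩ : ∃ a, P a v ≠ 0 := by
      by_contra! h
      exact hv (by rw [← hw.sum_apply v]; simp [h])
    refine Finset.sum_pos' (fun c _ => mul_nonneg (hw.pos c _).le ?_)
      ⟨a, Finset.mem_univ a, mul_pos (hw.pos a _) (hin.pos _ ha)⟩
    by_cases hc : P c v = 0
    · simp [hc]
    · exact (hin.pos _ hc).le
  · intro y hy
    have : ContDiffAt ℝ ∞ (fun z => ∑ a, t a ((extChartAt J p₀).symm z) *
        chartMetric b₀ p₀ z (P a v) (P a w)) y :=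
      ContDiffAt.sum fun a _ => (hw.contDiffAt_weight a hy).mul
        ((((hb₀.contDiffAt_chartMetric hy).clm_apply contDiffAt_const)).clm_apply contDiffAt_const)
    refine (this.congr_of_eventuallyEq ?_).contDiffWithinAt
    filter_upwards [(isOpen_extChartAt_target p₀).mem_nhds hy] with z hz
    exact hw.inner_eq p₀ z hz v w

/-- Because `P a` is self-adjoint for the product metric, covectors factoring through `P a`
correspond to vectors in its range. -/
theorem proj_sharpL {p₀ : M} {y : V} (hy : y ∈ (extChartAt J p₀).target) (a : ι) (θ : V →L[ℝ] ℝ) :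
    P a (sharpL (chartMetric b₀ p₀ y) (θ.comp (P a))) =
      sharpL (chartMetric b₀ p₀ y) (θ.comp (P a)) := by
  have hin := hb₀.isInner hy
  refine (hin.sharpL_unique ?_).symm
  ext w
  rw [hw.selfAdjoint p₀ y hy, hin.apply_sharpL, ContinuousLinearMap.comp_apply,
    ContinuousLinearMap.comp_apply]
  exact congrArg θ (congrArg (fun A : V →L[ℝ] V => A w) (hw.proj_proj a))

/-- The right-hand side solves the defining equation: `P c` selects the `c`-th summand, and the
weight of the metric cancels the inverse weight. -/
theorem sharpL_eq {p₀ : M} {y : V} (hy : y ∈ (extChartAt J p₀).target) (θ : V →L[ℝ] ℝ) :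
    sharpL (chartMetric b p₀ y) θ = ∑ a, (t a ((extChartAt J p₀).symm y))⁻¹ •
      sharpL (chartMetric b₀ p₀ y) (θ.comp (P a)) := by
  have hin := hb₀.isInner hy
  refine ((hw.isRiemannian hb₀).isInner hy).sharpL_unique ?_
  ext w
  rw [hw.inner_eq p₀ y hy]
  have h1 (c : ι) : chartMetric b₀ p₀ y (P c (∑ a, (t a ((extChartAt J p₀).symm y))⁻¹ •
      sharpL (chartMetric b₀ p₀ y) (θ.comp (P a)))) (P c w) =
      (t c ((extChartAt J p₀).symm y))⁻¹ * θ (P c w) := by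
    rw [hw.selfAdjoint p₀ y hy, map_sum, _root_.sum_apply, Finset.sum_eq_single c]
    · have e : P c (P c w) = P c w := congrArg (fun A : V →L[ℝ] V => A w) (hw.proj_proj c)
      rw [map_smul, hin.apply_sharpL]
      simp [e]
    · intro a _ hac
      have e : P a (P c w) = 0 := congrArg (fun A : V →L[ℝ] V => A w) (hw.proj_proj_ne a c hac)
      have e' : P c (P c w) = P c w := congrArg (fun A : V →L[ℝ] V => A w) (hw.proj_proj c)
      rw [map_smul, hin.apply_sharpL]
      simp [e, e']
    · simp
  simp only [h1]
  conv_rhs => rw [← hw.sum_apply w, map_sum]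
  refine Finset.sum_congr rfl fun a _ => ?_
  rw [mul_inv_cancel_left₀ (hw.pos a _).ne']

theorem apply_sharpL {p₀ : M} {y : V} (hy : y ∈ (extChartAt J p₀).target) (θ ξ : V →L[ℝ] ℝ) :
    ξ (sharpL (chartMetric b p₀ y) θ) = ∑ a, (t a ((extChartAt J p₀).symm y))⁻¹ *
      ξ.comp (P a) (sharpL (chartMetric b₀ p₀ y) (θ.comp (P a))) := by
  rw [hw.sharpL_eq hb₀ hy, map_sum]
  refine Finset.sum_congr rfl fun a _ => ?_
  rw [map_smul, smul_eq_mul, ContinuousLinearMap.comp_apply, hw.proj_sharpL hb₀ hy]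

end IsWarped

end Warped

/-! ### Coefficients of functions in charts -/

section ChartCoeff

variable {V : Type*} [NormedAddCommGroup V] [NormedSpace ℝ V] [FiniteDimensional ℝ V]
  {H : Type*} [TopologicalSpace H] {J : ModelWithCorners ℝ V H} [J.Boundaryless]
  {M : Type*} [TopologicalSpace M] [ChartedSpace H M] [IsManifold J ∞ M]

/-- The coefficient of a field of `0`-forms in a chart. -/
def chartCoeff (p : M) (η : FormField J M 0) (z : V) : ℝ := chartRep J p η z ![]

theorem contDiffAt_chartCoeff {p : M} {η : FormField J M 0} {y : V}
    (hη : ContDiffAt ℝ ∞ (chartRep J p η) y) : ContDiffAt ℝ ∞ (chartCoeff p η) y :=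
  contDiffAt_form_iff.1 hη _

theorem fderiv_chartCoeff {p : M} {η : FormField J M 0} {y : V}
    (hη : ContDiffAt ℝ ∞ (chartRep J p η) y) (v : V) :
    fderiv ℝ (chartCoeff p η) y v = fderiv ℝ (chartRep J p η) y v ![] := by
  have := ((hη.differentiableAt (by simp)).hasFDerivAt.continuousAlternatingMap_apply_const
    (![] : Fin 0 → V)).fderiv
  exact congrArg (fun A : V →L[ℝ] ℝ => A v) this

theorem chartRep_extDAlong_zeroForm {Q : V →L[ℝ] V} (hQ : CommutesWithCharts J M Q) {p : M}
    {η : FormField J M 0} {y : V} (hy : y ∈ (extChartAt J p).target)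
    (hη : ContDiffAt ℝ ∞ (chartRep J p η) y) (u : Fin 1 → V) :
    chartRep J p (extDAlong J Q η) y u = (fderiv ℝ (chartCoeff p η) y).comp Q (u 0) := by
  rw [chartRep_extDAlong hQ hy hη, alternatize_zeroForm]
  exact (fderiv_chartCoeff hη _).symm

end ChartCoeff

/-! ### The first-order remainder -/

section Remainder

variable {V : Type*} [NormedAddCommGroup V] [NormedSpace ℝ V] [FiniteDimensional ℝ V]
  [MeasurableSpace V] [BorelSpace V] {ν : Measure V} [ν.IsAddHaarMeasure]
  {H : Type*} [TopologicalSpace H] {J : ModelWithCorners ℝ V H} [J.Boundaryless]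
  {M : Type*} [TopologicalSpace M] [ChartedSpace H M] [IsManifold J ∞ M] [T2Space M]
  [MeasurableSpace M] [BorelSpace M] {ι : Type*} [Fintype ι]

variable {b b₀ : SymTensor J M} {P : ι → V →L[ℝ] V} {t : ι → C^∞⟮J, M; ℝ⟯}
  {μ μ₀ : Measure M} {w w₀ : M → V → ℝ}

/-- The smooth reciprocal of a nowhere vanishing smooth function. -/
def smoothInv (t : C^∞⟮J, M; ℝ⟯) (ht : ∀ p, 0 < t p) : C^∞⟮J, M; ℝ⟯ :=
  ⟨fun p => (t p)⁻¹, t.contMDiff.inv₀ fun p => (ht p).ne'⟩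

variable (hw : IsWarped b b₀ P t) (hb : IsRiemannian b) (hb₀ : IsRiemannian b₀)
  (hμ : HasSmoothDensity ν J μ w) (hμ₀ : HasSmoothDensity ν J μ₀ w₀)

/-- The difference between the Laplacian of `b` and the rescaled Laplacians of the factors. -/
def remainder (k : ℕ) : smoothForms J M k →ₗ[ℝ] smoothForms J M k :=
  hodgeLaplacian (smoothD commutesWithCharts_id) (smoothCodiff hb hμ commutesWithCharts_id) k +
    (-1 : ℝ) • ∑ a, smoothMul (smoothInv (t a) (hw.pos a)) k ∘ₗ
      hodgeLaplacian (smoothD (hw.comm a)) (smoothCodiff hb₀ hμ₀ (hw.comm a)) k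

theorem coe_sum_apply {k : ℕ} (s : Finset ι) (η : ι → smoothForms J M k) (p : M)
    (v : Fin k → TangentSpace J p) :
    ((∑ a ∈ s, η a : smoothForms J M k) : FormField J M k) p v =
      ∑ a ∈ s, (η a : FormField J M k) p v := by
  classical
  induction s using Finset.induction_on with
  | empty => rfl
  | insert a s ha ih =>
    rw [Finset.sum_insert ha, Finset.sum_insert ha, ← ih]
    rfl

theorem remainder_apply (k : ℕ) (η : smoothForms J M k) (p : M) (v : Fin k → TangentSpace J p) :
    (remainder hw hb hb₀ hμ hμ₀ k η : FormField J M k) p v =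
      (hodgeLaplacian (smoothD commutesWithCharts_id) (smoothCodiff hb hμ commutesWithCharts_id) k η :
        FormField J M k) p v - ∑ a, (t a p)⁻¹ *
      (hodgeLaplacian (smoothD (hw.comm a)) (smoothCodiff hb₀ hμ₀ (hw.comm a)) k η :
        FormField J M k) p v := by
  have h := coe_sum_apply Finset.univ (fun a => smoothMul (smoothInv (t a) (hw.pos a)) k
      (hodgeLaplacian (smoothD (hw.comm a)) (smoothCodiff hb₀ hμ₀ (hw.comm a)) k η)) p v
  have h2 : ∑ a, (smoothMul (smoothInv (t a) (hw.pos a)) k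
      (hodgeLaplacian (smoothD (hw.comm a)) (smoothCodiff hb₀ hμ₀ (hw.comm a)) k η) :
        FormField J M k) p v = ∑ a, (t a p)⁻¹ *
      (hodgeLaplacian (smoothD (hw.comm a)) (smoothCodiff hb₀ hμ₀ (hw.comm a)) k η :
        FormField J M k) p v := rfl
  rw [h2] at h
  rw [← h, sub_eq_add_neg, ← neg_one_mul, remainder, LinearMap.add_apply, LinearMap.smul_apply,
    LinearMap.sum_apply]
  rfl

theorem smoothForms_apply_congr {k : ℕ} {η ζ : smoothForms J M k} (h : η = ζ) (p : M)
    (v : Fin k → TangentSpace J p) :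
    (η : FormField J M k) p v = (ζ : FormField J M k) p v := by rw [h]

/-- The remainder is a differential operator of order at most one. -/
theorem remainder_doubleComm (f h : C^∞⟮J, M; ℝ⟯) {k : ℕ} (η : smoothForms J M k) (p : M)
    (v : Fin k → TangentSpace J p) :
    (remainder hw hb hb₀ hμ hμ₀ k (smoothMul f k (smoothMul h k η)) : FormField J M k) p v -
      f p * (remainder hw hb hb₀ hμ hμ₀ k (smoothMul h k η) : FormField J M k) p v -
      h p * (remainder hw hb hb₀ hμ hμ₀ k (smoothMul f k η) : FormField J M k) p v +
      f p * (h p * (remainder hw hb hb₀ hμ hμ₀ k η : FormField J M k) p v) = 0 := by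
  obtain ⟨S, hS, hSp⟩ := doubleComm_hodgeLaplacian hb hμ commutesWithCharts_id f h η
  choose Sa hSa hSap using fun a => doubleComm_hodgeLaplacian hb₀ hμ₀ (hw.comm a) f h η
  have hy := mem_extChartAt_target (I := J) p
  have hs := hw.apply_sharpL hb₀ hy (chartDeriv J (ContinuousLinearMap.id ℝ V) h p)
    (chartDeriv J (ContinuousLinearMap.id ℝ V) f p)
  rw [(extChartAt J p).left_inv (mem_extChartAt_source p)] at hs
  -- The principal symbols agree because the inverse of the warped metric is the weighted sum of
  -- those of the factors. This is the only place where the choice of the coefficients `(t a)⁻¹`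
  -- matters for the order of the remainder.
  have hSv : (S : FormField J M k) p v = ∑ a, (t a p)⁻¹ * (Sa a : FormField J M k) p v := by
    have h1 : (S : FormField J M k) p v = -(2 * chartDeriv J (ContinuousLinearMap.id ℝ V) f p
        (sharpL (chartMetric b p (extChartAt J p p))
          (chartDeriv J (ContinuousLinearMap.id ℝ V) h p))) * (η : FormField J M k) p v := by
      rw [hSp]; rfl
    have h2 (a : ι) : (Sa a : FormField J M k) p v = -(2 * chartDeriv J (P a) f p
        (sharpL (chartMetric b₀ p (extChartAt J p p)) (chartDeriv J (P a) h p))) *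
        (η : FormField J M k) p v := by
      rw [hSap]; rfl
    simp only [h1, h2, hs, Finset.mul_sum, ← Finset.sum_neg_distrib, Finset.sum_mul]
    refine Finset.sum_congr rfl fun a _ => ?_
    simp only [chartDeriv, ContinuousLinearMap.comp_id]
    ring
  have e := smoothForms_apply_congr hS p v
  have ea (a) := smoothForms_apply_congr (hSa a) p v
  set T := hodgeLaplacian (smoothD (M := M) (J := J) commutesWithCharts_id)
    (smoothCodiff hb hμ commutesWithCharts_id) k
  set Ta := fun a => hodgeLaplacian (smoothD (hw.comm a)) (smoothCodiff hb₀ hμ₀ (hw.comm a)) k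
  have e' : (T (smoothMul f k (smoothMul h k η)) : FormField J M k) p v +
      f p * (h p * (T η : FormField J M k) p v) = f p * (T (smoothMul h k η) : FormField J M k) p v +
      h p * (T (smoothMul f k η) : FormField J M k) p v + (S : FormField J M k) p v := e
  have ea' (a) : (Ta a (smoothMul f k (smoothMul h k η)) : FormField J M k) p v +
      f p * (h p * (Ta a η : FormField J M k) p v) =
      f p * (Ta a (smoothMul h k η) : FormField J M k) p v +
      h p * (Ta a (smoothMul f k η) : FormField J M k) p v + (Sa a : FormField J M k) p v := ea a
  simp only [remainder_apply]
  have hsum : ∑ a, (t a p)⁻¹ * (Ta a (smoothMul f k (smoothMul h k η)) : FormField J M k) p v =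
      f p * ∑ a, (t a p)⁻¹ * (Ta a (smoothMul h k η) : FormField J M k) p v +
      h p * ∑ a, (t a p)⁻¹ * (Ta a (smoothMul f k η) : FormField J M k) p v +
      (S : FormField J M k) p v -
      f p * (h p * ∑ a, (t a p)⁻¹ * (Ta a η : FormField J M k) p v) := by
    rw [hSv]
    simp only [Finset.mul_sum, ← Finset.sum_add_distrib, ← Finset.sum_sub_distrib]
    refine Finset.sum_congr rfl fun a _ => ?_
    linear_combination (t a p)⁻¹ * ea' a
  linear_combination e' - hsum

/-- The Laplace–Beltrami formula in divergence form, with derivatives only along `Q` and with the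
sign that makes the operator nonnegative. -/
theorem chartRep_hodgeLaplacian_zero {Q : V →L[ℝ] V} (hQ : CommutesWithCharts J M Q)
    (η : smoothForms J M 0) {p : M} {y : V} (hy : y ∈ (extChartAt J p).target) (v : Fin 0 → V) :
    chartRep J p (hodgeLaplacian (smoothD hQ) (smoothCodiff hb hμ hQ) 0 η : FormField J M 0) y v =
      -(w p y)⁻¹ * ∑ j, fderiv ℝ (fun z => w p z * (fderiv ℝ (chartCoeff p η.1) z).comp Q
        (sharpL (chartMetric b p z) ((coord V j).comp Q))) y (finBasis ℝ V j) := by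
  have e : (hodgeLaplacian (smoothD hQ) (smoothCodiff hb hμ hQ) 0 η : FormField J M 0) =
    (smoothCodiff hb hμ hQ 0 (smoothD hQ 0 η) : smoothForms J M 0) := rfl
  rw [e, chartRep_smoothCodiff hb hμ hQ _ p hy, codiff_oneForm (hb.contDiffAt_sharpL hy)
    (hμ.contDiffAt hy) (IsSmoothForm.contDiffAt (smoothD hQ 0 η).2 hy)]
  congr 1
  refine Finset.sum_congr rfl fun j _ => ?_
  congr 1
  refine Filter.EventuallyEq.fderiv_eq ?_
  filter_upwards [(isOpen_extChartAt_target p).mem_nhds hy] with z hz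
  congr 1
  exact chartRep_extDAlong_zeroForm hQ hz (IsSmoothForm.contDiffAt η.2 hz) _

/-- The remainder on functions. -/
theorem remainder_zeroForm (σ : C^∞⟮J, M; ℝ⟯) (hσ : ∀ p, 0 < σ p)
    (hww : ∀ p₀, ∀ y ∈ (extChartAt J p₀).target,
      w p₀ y = σ ((extChartAt J p₀).symm y) * w₀ p₀ y)
    (hσform : IsSmoothForm J (funForm J fun p => σ p)) (η : smoothForms J M 0) (p : M)
    (v : Fin 0 → TangentSpace J p) :
    (remainder hw hb hb₀ hμ hμ₀ 0 η : FormField J M 0) p v =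
      -((σ p)⁻¹ * b.pairing p (extD J (funForm J fun p => σ p) p) (extD J η.1 p)) := by
  set y := extChartAt J p p with hydef
  have hy : y ∈ (extChartAt J p).target := mem_extChartAt_target (I := J) p
  have hpy : (extChartAt J p).symm y = p := (extChartAt J p).left_inv (mem_extChartAt_source p)
  have hval (ζ : FormField J M 0) : ζ p v = chartRep J p ζ y ![] := by
    conv_lhs => rw [← chartRep_chartDer ζ (mem_extChartAt_source p)]
    rw [ContinuousAlternatingMap.compContinuousLinearMap_apply]
    congr 1
    exact Subsingleton.elim _ _
  set f := chartCoeff p η.1 with hf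
  have hfs {z : V} (hz : z ∈ (extChartAt J p).target) : ContDiffAt ℝ ∞ f z :=
    contDiffAt_chartCoeff (IsSmoothForm.contDiffAt η.2 hz)
  set s : V → ℝ := fun z => σ ((extChartAt J p).symm z) with hs
  have hss : ContDiffAt ℝ ∞ s y := contDiffAt_comp_chartSymm hy σ.contMDiff.contMDiffAt
  set c : ι → V → ℝ := fun a z => t a ((extChartAt J p).symm z) with hc
  have hcs (a) : ContDiffAt ℝ ∞ (c a) y := hw.contDiffAt_weight a hy
  have hc0 (a) : c a y ≠ 0 := (hw.pos a _).ne'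
  have hs0 : s y ≠ 0 := (hσ _).ne'
  have hw0 : w₀ p y ≠ 0 := (hμ₀.pos p y hy).ne'
  set F : Fin (finrank ℝ V) → ι → V → ℝ := fun j a z => w₀ p z * (fderiv ℝ f z).comp (P a)
        (sharpL (chartMetric b₀ p z) ((coord V j).comp (P a))) with hF
  have hFs (j a) : ContDiffAt ℝ ∞ (F j a) y := by
    refine (hμ₀.contDiffAt hy).mul ?_
    exact (((hfs hy).fderiv_right (m := ∞) (by simp)).clm_comp contDiffAt_const).clm_apply
      ((hb₀.contDiffAt_sharpL hy).clm_apply contDiffAt_const)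
  -- The total flux is the sum over the factors of `σ t⁻¹` times the flux of that factor. Its
  -- divergence has three parts: the rescaled factor Laplacian, a derivative of `σ`, and a
  -- derivative of the weight.
  have hdf (j) : fderiv ℝ (fun z => w p z * (fderiv ℝ f z).comp (ContinuousLinearMap.id ℝ V)
        (sharpL (chartMetric b p z) ((coord V j).comp (ContinuousLinearMap.id ℝ V)))) y
        (finBasis ℝ V j) = ∑ a, ((s y * (c a y)⁻¹) * fderiv ℝ (F j a) y (finBasis ℝ V j) +
          F j a y * ((c a y)⁻¹ * fderiv ℝ s y (finBasis ℝ V j) -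
            s y * ((c a y)⁻¹ ^ 2 * fderiv ℝ (c a) y (finBasis ℝ V j)))) := by
    have e1 : (fun z => w p z * (fderiv ℝ f z).comp (ContinuousLinearMap.id ℝ V)
        (sharpL (chartMetric b p z) ((coord V j).comp (ContinuousLinearMap.id ℝ V)))) =ᶠ[𝓝 y]
        fun z => ∑ a, (s z * (c a z)⁻¹) * F j a z := by
      filter_upwards [(isOpen_extChartAt_target p).mem_nhds hy] with z hz
      rw [hww p z hz, ContinuousLinearMap.comp_id, ContinuousLinearMap.comp_id,
        hw.apply_sharpL hb₀ hz, Finset.mul_sum]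
      refine Finset.sum_congr rfl fun a _ => ?_
      simp only [hF, hs, hc]
      ring
    have e2 (a) := ((hss.differentiableAt (by simp)).hasFDerivAt.mul
      ((hasDerivAt_inv (hc0 a)).comp_hasFDerivAt y
        ((hcs a).differentiableAt (by simp)).hasFDerivAt)).mul
      ((hFs j a).differentiableAt (by simp)).hasFDerivAt
    have e3 := HasFDerivAt.fun_sum (u := Finset.univ) fun a _ => e2 a
    rw [e1.fderiv_eq]
    refine (congrArg (fun A : V →L[ℝ] ℝ => A (finBasis ℝ V j)) e3.fderiv).trans ?_
    simp only [_root_.sum_apply, add_apply, smul_apply, smul_eq_mul]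
    refine Finset.sum_congr rfl fun a _ => ?_
    change s y * (c a y)⁻¹ * _ + F j a y * (s y * (-(c a y ^ 2)⁻¹ * _) + (c a y)⁻¹ * _) = _
    ring
  have hθ (θ : V →L[ℝ] ℝ) (a : ι) : ∑ j, θ (finBasis ℝ V j) * F j a y =
      w₀ p y * (fderiv ℝ f y).comp (P a) (sharpL (chartMetric b₀ p y) (θ.comp (P a))) := by
    have e : θ.comp (P a) = ∑ j, θ (finBasis ℝ V j) • (coord V j).comp (P a) := by
      conv_lhs => rw [← sum_coord_smul θ]
      ext u; simp
    rw [e, map_sum, map_sum, Finset.mul_sum]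
    refine Finset.sum_congr rfl fun j _ => ?_
    rw [map_smul, map_smul, smul_eq_mul]
    simp only [hF]
    ring
  have hpair : b.pairing p (extD J (funForm J fun p => σ p) p) (extD J η.1 p) =
      fderiv ℝ f y (sharpL (chartMetric b p y) (fderiv ℝ s y)) := by
    rw [hb.pairing_eq _ _ (mem_extChartAt_source p)]
    refine formPair_oneForm _ _ _ _ _ (fun u => ?_) fun u => ?_
    · rw [extD_eq_extDAlong, chartRep_extDAlong_zeroForm commutesWithCharts_id hy
        (hσform.contDiffAt hy)]
      rfl
    · rw [extD_eq_extDAlong, chartRep_extDAlong_zeroForm commutesWithCharts_id hy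
        (IsSmoothForm.contDiffAt η.2 hy)]
      rfl
  rw [remainder_apply, hval, chartRep_hodgeLaplacian_zero hb hμ _ η hy]
  simp only [hval, chartRep_hodgeLaplacian_zero hb₀ hμ₀ _ η hy]
  rw [← hf, hpair, hw.apply_sharpL hb₀ hy, Finset.sum_congr rfl fun j _ => hdf j,
    Finset.sum_comm, hww p y hy, Finset.mul_sum, Finset.mul_sum, ← Finset.sum_sub_distrib,
    ← Finset.sum_neg_distrib]
  refine Finset.sum_congr rfl fun a _ => ?_
  have h1 := hθ (fderiv ℝ s y) a
  have h2 := hθ (fderiv ℝ (c a) y) a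
  -- The derivative of a weight is paired only with the flux along its own factor, where the weight
  -- is constant. Hence only the derivative of `σ` survives.
  rw [hw.fderiv_comp p y hy a, map_zero, map_zero, mul_zero] at h2
  have h3 : ∑ j, ((s y * (c a y)⁻¹) * fderiv ℝ (F j a) y (finBasis ℝ V j) +
          F j a y * ((c a y)⁻¹ * fderiv ℝ s y (finBasis ℝ V j) -
            s y * ((c a y)⁻¹ ^ 2 * fderiv ℝ (c a) y (finBasis ℝ V j)))) =
      (s y * (c a y)⁻¹) * ∑ j, fderiv ℝ (F j a) y (finBasis ℝ V j) +
      (c a y)⁻¹ * ∑ j, fderiv ℝ s y (finBasis ℝ V j) * F j a y -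
      s y * (c a y)⁻¹ ^ 2 * ∑ j, fderiv ℝ (c a) y (finBasis ℝ V j) * F j a y := by
    simp only [Finset.mul_sum, ← Finset.sum_add_distrib, ← Finset.sum_sub_distrib]
    refine Finset.sum_congr rfl fun j _ => ?_
    ring
  rw [h3, h1, h2]
  have h4 : t a p = c a y := by simp only [hc, hpy]
  have h5 : σ p = s y := by simp only [hs, hpy]
  have h6 : t a ((extChartAt J p).symm y) = c a y := rfl
  have h7 : σ ((extChartAt J p).symm y) = s y := rfl
  have h8 : w₀ p (extChartAt J p p) = w₀ p y := rfl
  rw [h4, h5, h6, h7]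
  have h9 := hc0 a
  generalize c a y = r at h9 ⊢
  simp only [hF]
  field_simp
  ring

end Remainder

/-! ### Maps that respect a splitting -/

section Split

variable {V : Type*} [NormedAddCommGroup V] [NormedSpace ℝ V]

theorem fderiv_apply_eq_zero_of_eventually {W : Type*} [NormedAddCommGroup W] [NormedSpace ℝ W]
    {f : V → W} {y v : V} (hf : DifferentiableAt ℝ f y)
    (h : ∀ᶠ z in 𝓝 y, (∃ r : ℝ, z = y + r • v) → f z = f y) : fderiv ℝ f y v = 0 := by
  have h1 : HasDerivAt (fun r : ℝ => y + r • v) v 0 := by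
    simpa using ((hasDerivAt_id (0 : ℝ)).smul_const v).const_add y
  have hf' : HasFDerivAt f (fderiv ℝ f y) (y + (0 : ℝ) • v) := by
    simpa using hf.hasFDerivAt
  have h2 : HasDerivAt (f ∘ fun r : ℝ => y + r • v) (fderiv ℝ f y v) 0 :=
    hf'.comp_hasDerivAt (0 : ℝ) h1
  have hc : Filter.Tendsto (fun r : ℝ => y + r • v) (𝓝 0) (𝓝 y) := by
    have := h1.continuousAt.tendsto
    simpa using this
  have h3 : (f ∘ fun r : ℝ => y + r • v) =ᶠ[𝓝 0] fun _ => f y := by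
    filter_upwards [hc.eventually h] with r hr
    exact hr ⟨r, rfl⟩
  exact h2.unique ((hasDerivAt_const (0 : ℝ) (f y)).congr_of_eventuallyEq h3)

/-- The hypotheses express that the two components of `f` depend only on the corresponding
components of the variable. Both off-diagonal blocks of the derivative then vanish, which is the
commutation with `P`. -/
theorem comp_fderiv_comm_of_split {f : V → V} {P : V →L[ℝ] V} {y : V} (hP : P.comp P = P)
    (hf : DifferentiableAt ℝ f y) (h1 : ∀ᶠ z in 𝓝 y, P z = P y → P (f z) = P (f y))
    (h2 : ∀ᶠ z in 𝓝 y, z - P z = y - P y → f z - P (f z) = f y - P (f y)) :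
    P.comp (fderiv ℝ f y) = (fderiv ℝ f y).comp P := by
  have hPP (v : V) : P (P v) = P v := congrArg (fun A : V →L[ℝ] V => A v) hP
  have hPf : DifferentiableAt ℝ (fun z => P (f z)) y := P.differentiableAt.comp y hf
  have e1 : fderiv ℝ (fun z => P (f z)) y = P.comp (fderiv ℝ f y) :=
    (P.hasFDerivAt.comp y hf.hasFDerivAt).fderiv
  have e2 : fderiv ℝ (fun z => f z - P (f z)) y = fderiv ℝ f y - P.comp (fderiv ℝ f y) := by
    rw [fderiv_fun_sub hf hPf, e1]
  ext v
  have k1 : fderiv ℝ (fun z => P (f z)) y (v - P v) = 0 := by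
    refine fderiv_apply_eq_zero_of_eventually hPf (h1.mono fun z hz => ?_)
    rintro ⟨r, rfl⟩
    exact hz (by simp [hPP])
  have k2 : fderiv ℝ (fun z => f z - P (f z)) y (P v) = 0 := by
    refine fderiv_apply_eq_zero_of_eventually (hf.sub hPf) (h2.mono fun z hz => ?_)
    rintro ⟨r, rfl⟩
    exact hz (by simp [hPP])
  rw [e1, ContinuousLinearMap.comp_apply, map_sub, map_sub, sub_eq_zero] at k1
  rw [e2, sub_apply, ContinuousLinearMap.comp_apply, sub_eq_zero] at k2
  rw [ContinuousLinearMap.comp_apply, ContinuousLinearMap.comp_apply, k1, ← k2]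

end Split

/-! ### Charts of the local model in terms of the factors -/

section ModelCharts

variable {I : Finset ℕ} {n : ℕ} {E : Type*} [NormedAddCommGroup E] [NormedSpace ℝ E]
  {G : Type*} [TopologicalSpace G] [ChartedSpace E G]
  [Fact (finrank ℝ (EuclideanSpace ℝ I) = n + 1)]
  {U : TopologicalSpace.Opens (LocalModel I G)}

theorem extChartAt_localModel (p q : U) : extChartAt (localModel I n E) p q =
    (extChartAt (𝓡 n) p.1.1 q.1.1, fun i => extChartAt 𝓘(ℝ, E) (p.1.2 i) (q.1.2 i)) := rfl

theorem mem_source_localModel {p q : U} (h : q ∈ (extChartAt (localModel I n E) p).source) :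
    q.1.1 ∈ (extChartAt (𝓡 n) p.1.1).source ∧
      ∀ i, q.1.2 i ∈ (extChartAt 𝓘(ℝ, E) (p.1.2 i)).source := by
  rw [extChartAt_source] at h
  have h' : q.1 ∈ (chartAt (ModelProd (EuclideanSpace ℝ (Fin n)) (ModelPi fun _ : I => E)) p.1).source := by
    have := (chartAt (ModelProd (EuclideanSpace ℝ (Fin n)) (ModelPi fun _ : I => E)) p.1).subtypeRestr_source ⟨p⟩
    have h2 : q ∈ ((chartAt (ModelProd (EuclideanSpace ℝ (Fin n)) (ModelPi fun _ : I => E)) p.1).subtypeRestr ⟨p⟩).source := h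
    rw [this] at h2
    exact h2
  refine ⟨?_, fun i => ?_⟩
  · rw [extChartAt_source]
    exact h'.1
  · rw [extChartAt_source]
    exact h'.2 i (mem_univ i)

variable {p : U} {y : EuclideanSpace ℝ (Fin n) × (I → E)}
  (hy : y ∈ (extChartAt (localModel I n E) p).target)
include hy

/-- The chart of `U` is a product by definition, but its inverse must produce points of the open
subset. On the target, the components of the inverse are recovered by injectivity of the factor
charts. -/
theorem symm_localModel_fst :
    ((extChartAt (localModel I n E) p).symm y).1.1 = (extChartAt (𝓡 n) p.1.1).symm y.1 := by
  have h1 := (extChartAt (localModel I n E) p).right_inv hy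
  have h2 := mem_source_localModel ((extChartAt (localModel I n E) p).map_target hy)
  have h4 : extChartAt (𝓡 n) p.1.1 ((extChartAt (localModel I n E) p).symm y).1.1 = y.1 :=
    congrArg Prod.fst h1
  exact ((extChartAt (𝓡 n) p.1.1).left_inv h2.1).symm.trans
    (congrArg (extChartAt (𝓡 n) p.1.1).symm h4)

theorem symm_localModel_snd (i : I) :
    ((extChartAt (localModel I n E) p).symm y).1.2 i =
      (extChartAt 𝓘(ℝ, E) (p.1.2 i)).symm (y.2 i) := by
  have h1 := (extChartAt (localModel I n E) p).right_inv hy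
  have h2 := mem_source_localModel ((extChartAt (localModel I n E) p).map_target hy)
  have h4 : extChartAt 𝓘(ℝ, E) (p.1.2 i) (((extChartAt (localModel I n E) p).symm y).1.2 i) = y.2 i :=
    congrArg (fun z : EuclideanSpace ℝ (Fin n) × (I → E) => z.2 i) h1
  exact ((extChartAt 𝓘(ℝ, E) (p.1.2 i)).left_inv (h2.2 i)).symm.trans
    (congrArg (extChartAt 𝓘(ℝ, E) (p.1.2 i)).symm h4)

theorem target_localModel_fst : y.1 ∈ (extChartAt (𝓡 n) p.1.1).target := by
  have h1 := (extChartAt (localModel I n E) p).right_inv hy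
  have h2 := mem_source_localModel ((extChartAt (localModel I n E) p).map_target hy)
  have h3 := (extChartAt (𝓡 n) p.1.1).map_source h2.1
  have h4 : extChartAt (𝓡 n) p.1.1 ((extChartAt (localModel I n E) p).symm y).1.1 = y.1 :=
    congrArg Prod.fst h1
  rwa [h4] at h3

theorem target_localModel_snd (i : I) : y.2 i ∈ (extChartAt 𝓘(ℝ, E) (p.1.2 i)).target := by
  have h1 := (extChartAt (localModel I n E) p).right_inv hy
  have h2 := mem_source_localModel ((extChartAt (localModel I n E) p).map_target hy)
  have h3 := (extChartAt 𝓘(ℝ, E) (p.1.2 i)).map_source (h2.2 i)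
  have h4 : extChartAt 𝓘(ℝ, E) (p.1.2 i) (((extChartAt (localModel I n E) p).symm y).1.2 i) = y.2 i :=
    congrArg (fun z : EuclideanSpace ℝ (Fin n) × (I → E) => z.2 i) h1
  rwa [h4] at h3

end ModelCharts

/-! ### Projections onto the factors -/

section FactorProj

instance boundaryless_localModel (I : Finset ℕ) (n : ℕ) (E : Type*) [NormedAddCommGroup E]
    [NormedSpace ℝ E] : (localModel I n E).Boundaryless := by
  have : (ModelWithCorners.pi fun _ : I => 𝓘(ℝ, E)).Boundaryless :=
    ⟨range_eq_univ.2 fun y => ⟨y, rfl⟩⟩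
  infer_instance

variable {I : Finset ℕ} {n : ℕ} {E : Type*} [NormedAddCommGroup E] [NormedSpace ℝ E]

theorem factorProj_none (v : EuclideanSpace ℝ (Fin n) × (I → E)) :
    factorProj I n E none v = (v.1, 0) := rfl

theorem factorProj_some (i : I) (v : EuclideanSpace ℝ (Fin n) × (I → E)) :
    factorProj I n E (some i) v = (0, Pi.single i (v.2 i)) := rfl

theorem sum_factorProj : ∑ a, factorProj I n E a =
    ContinuousLinearMap.id ℝ (EuclideanSpace ℝ (Fin n) × (I → E)) := by
  refine ContinuousLinearMap.ext fun v => ?_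
  rw [Fintype.sum_option, add_apply, _root_.sum_apply]
  simp only [factorProj_none, factorProj_some]
  refine Prod.ext ?_ ?_
  · simp [Prod.fst_sum]
  · rw [Prod.snd_add, Prod.snd_sum, zero_add]
    exact Finset.univ_sum_single v.2

theorem factorProj_comp_self (a : Option I) :
    (factorProj I n E a).comp (factorProj I n E a) = factorProj I n E a := by
  refine ContinuousLinearMap.ext fun v => ?_
  rw [ContinuousLinearMap.comp_apply]
  cases a <;> simp [factorProj_none, factorProj_some]

theorem factorProj_comp_of_ne (a c : Option I) (h : a ≠ c) :
    (factorProj I n E a).comp (factorProj I n E c) = 0 := by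
  refine ContinuousLinearMap.ext fun v => ?_
  rw [ContinuousLinearMap.comp_apply]
  rcases a with _ | i <;> rcases c with _ | j
  · exact (h rfl).elim
  · rfl
  · simp [factorProj_none, factorProj_some]
  · have : i ≠ j := fun e => h (by rw [e])
    simp [factorProj_some, Pi.single_eq_of_ne this]

variable {G : Type*} [TopologicalSpace G] [ChartedSpace E G] [IsManifold 𝓘(ℝ, E) ∞ G]
  [Fact (finrank ℝ (EuclideanSpace ℝ I) = n + 1)]
  {U : TopologicalSpace.Opens (LocalModel I G)} 

/-- Transition maps of the local model are products of transition maps of the factors, so their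
derivatives are block diagonal. -/
theorem commutesWithCharts_factorProj (a : Option I) :
    CommutesWithCharts (localModel I n E) U (factorProj I n E a) := by
  intro p₀ p y hy hy'
  have key : ∀ z ∈ (extChartAt (localModel I n E) p).target,
      transition (localModel I n E) p₀ p z =
        (extChartAt (𝓡 n) p₀.1.1 ((extChartAt (𝓡 n) p.1.1).symm z.1), fun i =>
          extChartAt 𝓘(ℝ, E) (p₀.1.2 i) ((extChartAt 𝓘(ℝ, E) (p.1.2 i)).symm (z.2 i))) := by
    intro z hz
    rw [transition, Function.comp_apply, extChartAt_localModel, symm_localModel_fst hz]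
    simp only [symm_localModel_snd hz]
  refine comp_fderiv_comm_of_split (factorProj_comp_self a)
    ((contDiffAt_transition hy hy').differentiableAt (by simp)) ?_ ?_
  · filter_upwards [(isOpen_extChartAt_target p).mem_nhds hy] with z hz h
    rw [key z hz, key y hy]
    cases a with
    | none =>
      have h1 : z.1 = y.1 := by
        have := congrArg Prod.fst h
        simpa [factorProj_none] using this
      simp only [factorProj_none, h1]
    | some i =>
      have h1 : z.2 i = y.2 i := by
        have := congrFun (congrArg Prod.snd h) i
        simpa [factorProj_some] using this
      simp only [factorProj_some, h1]
  · filter_upwards [(isOpen_extChartAt_target p).mem_nhds hy] with z hz h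
    rw [key z hz, key y hy]
    cases a with
    | none =>
      have h1 : z.2 = y.2 := by
        have := congrArg Prod.snd h
        simpa [factorProj_none] using this
      simp only [factorProj_none, h1, Prod.mk_sub_mk, sub_self]
    | some i =>
      have h1 : z.1 = y.1 := by
        have := congrArg Prod.fst h
        simpa [factorProj_some] using this
      have h2 : ∀ j, j ≠ i → z.2 j = y.2 j := fun j hj => by
        have := congrFun (congrArg Prod.snd h) j
        simpa [factorProj_some, Pi.single_eq_of_ne hj] using this
      simp only [factorProj_some, h1, Prod.mk_sub_mk]
      refine Prod.ext rfl (funext fun j => ?_)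
      by_cases hj : j = i
      · subst hj; simp
      · simp [Pi.single_eq_of_ne hj, h2 j hj]

end FactorProj

/-! ### The metric of the group in charts -/

section GroupPart

variable {E : Type*} [NormedAddCommGroup E] [NormedSpace ℝ E]
  {G : Type*} [TopologicalSpace G] [ChartedSpace E G] [IsManifold 𝓘(ℝ, E) ∞ G]
  (gG : Bundle.ContMDiffRiemannianMetric 𝓘(ℝ, E) ∞ E (fun a : G => TangentSpace 𝓘(ℝ, E) a))

/-- A Riemannian metric, read in the preferred chart at `a`. -/
def coordMetric (a : G) (u v w : E) : ℝ :=
  gG.inner ((extChartAt 𝓘(ℝ, E) a).symm u) (chartInv 𝓘(ℝ, E) a u v) (chartInv 𝓘(ℝ, E) a u w)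

/-- This is the tangent map of the smooth inverse chart applied to a constant vector field. It lets
the bundle smoothness of the metric be evaluated on coordinate fields. -/
theorem contMDiffAt_chartInv {a : G} {u : E} (hu : u ∈ (extChartAt 𝓘(ℝ, E) a).target) (v : E) :
    ContMDiffAt 𝓘(ℝ, E) 𝓘(ℝ, E).tangent ∞ (fun z => (⟨(extChartAt 𝓘(ℝ, E) a).symm z,
      chartInv 𝓘(ℝ, E) a z v⟩ : TangentBundle 𝓘(ℝ, E) G)) u := by
  have hopen := isOpen_extChartAt_target (I := 𝓘(ℝ, E)) a
  have h1 := (contMDiffOn_extChartAt_symm (I := 𝓘(ℝ, E)) (n := ∞) a).contMDiffOn_tangentMapWithin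
    (m := ∞) (by simp) hopen.uniqueMDiffOn
  have h2 : ContMDiff 𝓘(ℝ, E) 𝓘(ℝ, E).tangent ∞ (fun z : E => (⟨z, v⟩ : TangentBundle 𝓘(ℝ, E) E)) :=
    fun z => contMDiffAt_vectorSpace_iff_contDiffAt (V := fun _ => v) |>.2 contDiffAt_const
  have h3 := h1.comp h2.contMDiffOn (s := (extChartAt 𝓘(ℝ, E) a).target) fun z hz => hz
  refine (h3.contMDiffAt (hopen.mem_nhds hu)).congr_of_eventuallyEq ?_
  filter_upwards [hopen.mem_nhds hu] with z hz
  simp only [Function.comp_apply, tangentMapWithin]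
  rw [mfderivWithin_of_isOpen hopen hz]
  rfl

theorem contDiffAt_coordMetric {a : G} {u : E} (hu : u ∈ (extChartAt 𝓘(ℝ, E) a).target) (v w : E) :
    ContDiffAt ℝ ∞ (fun z => coordMetric gG a z v w) u := by
  have hb : ContMDiffAt 𝓘(ℝ, E) 𝓘(ℝ, E) ∞ (extChartAt 𝓘(ℝ, E) a).symm u :=
    (contMDiffOn_extChartAt_symm a).contMDiffAt ((isOpen_extChartAt_target a).mem_nhds hu)
  have : ContMDiffAt 𝓘(ℝ, E) (𝓘(ℝ, E).prod 𝓘(ℝ)) ∞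
      (fun z => Bundle.TotalSpace.mk' ℝ (E := Bundle.Trivial G ℝ) ((extChartAt 𝓘(ℝ, E) a).symm z)
        (coordMetric gG a z v w)) u := by
    apply ContMDiffAt.clm_bundle_apply₂ (F₁ := E) (F₂ := E)
    · exact gG.contMDiff.contMDiffAt.comp u hb
    · exact contMDiffAt_chartInv hu v
    · exact contMDiffAt_chartInv hu w
  simp only [Bundle.contMDiffAt_totalSpace] at this
  exact this.2.contDiffAt

theorem coordMetric_pos {a : G} {u : E} (hu : u ∈ (extChartAt 𝓘(ℝ, E) a).target) {v : E}
    (hv : v ≠ 0) : 0 < coordMetric gG a u v v := by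
  refine gG.pos _ _ fun h => hv ?_
  rw [← chartDer_chartInv hu v, h, map_zero]

end GroupPart

/-! ### The round metric of the sphere in charts -/

section SpherePart

variable {F : Type*} [NormedAddCommGroup F] [InnerProductSpace ℝ F] {n : ℕ}
  [Fact (finrank ℝ F = n + 1)]

/-- The inverse of the preferred chart at `q` of the sphere, as a map into the ambient space. -/
def sphereInv (q : Metric.sphere (0 : F) 1) (z : EuclideanSpace ℝ (Fin n)) : F :=
  ((extChartAt (𝓡 n) q).symm z : F)

theorem contDiffAt_sphereInv {q : Metric.sphere (0 : F) 1} {u : EuclideanSpace ℝ (Fin n)}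
    (hu : u ∈ (extChartAt (𝓡 n) q).target) : ContDiffAt ℝ ∞ (sphereInv q) u := by
  have hb : ContMDiffAt 𝓘(ℝ, EuclideanSpace ℝ (Fin n)) (𝓡 n) ∞ (extChartAt (𝓡 n) q).symm u :=
    (contMDiffOn_extChartAt_symm q).contMDiffAt ((isOpen_extChartAt_target q).mem_nhds hu)
  exact ((contMDiff_coe_sphere.contMDiffAt (x := (extChartAt (𝓡 n) q).symm u)).comp u hb).contDiffAt

/-- The inclusion of the sphere is an immersion and the inverse chart has invertible derivative.
This yields positivity of `∑ dxᵢ²` on the sphere factor. -/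
theorem fderiv_sphereInv_injective {q : Metric.sphere (0 : F) 1} {u : EuclideanSpace ℝ (Fin n)}
    (hu : u ∈ (extChartAt (𝓡 n) q).target) : Function.Injective (fderiv ℝ (sphereInv q) u) := by
  have hs := mdifferentiableAt_chartSymm (J := 𝓡 n) hu
  have h1 : HasMFDerivAt 𝓘(ℝ, EuclideanSpace ℝ (Fin n)) 𝓘(ℝ, F) (sphereInv q) u _ :=
    HasMFDerivAt.comp u ((contMDiff_coe_sphere (n := n) (m := 1) (E := F)).mdifferentiable (by simp)
      ((extChartAt (𝓡 n) q).symm u)).hasMFDerivAt hs.hasMFDerivAt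
  have h2 := h1.mfderiv
  rw [mfderiv_eq_fderiv] at h2
  intro v w hvw
  have h3 := injective_mvfderiv_subtypeVal_sphere (n := n) ((extChartAt (𝓡 n) q).symm u)
  have h4 : chartInv (𝓡 n) q u v = chartInv (𝓡 n) q u w :=
    h3 (((DFunLike.congr_fun h2 v).symm.trans hvw).trans (DFunLike.congr_fun h2 w))
  rw [← chartDer_chartInv hu v, h4, chartDer_chartInv hu w]

end SpherePart

/-! ### Weighted metrics of the local model in charts -/

section ModelMetric

variable {I : Finset ℕ} {n : ℕ} {E : Type*} [NormedAddCommGroup E] [NormedSpace ℝ E]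
  {G : Type*} [TopologicalSpace G] [ChartedSpace E G] [IsManifold 𝓘(ℝ, E) ∞ G]
  [Fact (finrank ℝ (EuclideanSpace ℝ I) = n + 1)]
  {U : TopologicalSpace.Opens (LocalModel I G)}

theorem contMDiff_sphCoord :
    ContMDiff (localModel I n E) 𝓘(ℝ, EuclideanSpace ℝ I) ∞ (sphCoord U) :=
  contMDiff_coe_sphere.comp (contMDiff_fst.comp contMDiff_subtype_val)

theorem continuous_grpCoord (i : I) : Continuous (grpCoord U i) :=
  (continuous_apply i).comp (continuous_snd.comp continuous_subtype_val)

theorem contMDiff_grpCoord (i : I) :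
    ContMDiff (localModel I n E) 𝓘(ℝ, E) ∞ (grpCoord U i) := by
  intro p
  rw [contMDiffAt_iff]
  refine ⟨(continuous_grpCoord i).continuousAt, ContDiffAt.contDiffWithinAt ?_⟩
  have h : ContDiffAt ℝ ∞ (fun z : EuclideanSpace ℝ (Fin n) × (I → E) => z.2 i)
      (extChartAt (localModel I n E) p p) :=
    ((contDiff_apply ℝ E i).comp contDiff_snd).contDiffAt
  refine h.congr_of_eventuallyEq ?_
  filter_upwards [(isOpen_extChartAt_target p).mem_nhds (mem_extChartAt_target p)] with z hz
  have h1 : grpCoord U i ((extChartAt (localModel I n E) p).symm z) =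
    (extChartAt 𝓘(ℝ, E) (p.1.2 i)).symm (z.2 i) := symm_localModel_snd hz i
  rw [Function.comp_apply, Function.comp_apply, h1]
  exact (extChartAt 𝓘(ℝ, E) (p.1.2 i)).right_inv (target_localModel_snd hz i)

variable {p : U} {y : EuclideanSpace ℝ (Fin n) × (I → E)}
  (hy : y ∈ (extChartAt (localModel I n E) p).target)
include hy

theorem sphCoord_comp_symm : sphCoord U ((extChartAt (localModel I n E) p).symm y) =
    sphereInv p.1.1 y.1 :=
  congrArg Subtype.val (symm_localModel_fst hy)

theorem mfderiv_sphCoord_chartInv (v : EuclideanSpace ℝ (Fin n) × (I → E)) :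
    mfderiv (localModel I n E) 𝓘(ℝ, EuclideanSpace ℝ I) (sphCoord U)
      ((extChartAt (localModel I n E) p).symm y) (chartInv (localModel I n E) p y v) =
    fderiv ℝ (sphereInv (p.1.1 : Metric.sphere (0 : EuclideanSpace ℝ I) 1)) y.1 v.1 := by
  have h1 := HasMFDerivAt.comp y
    ((contMDiff_sphCoord (n := n) (E := E) (U := U)).mdifferentiable (by simp) _).hasMFDerivAt
    (mdifferentiableAt_chartSymm hy).hasMFDerivAt
  have h3 : sphCoord U ∘ (extChartAt (localModel I n E) p).symm =ᶠ[𝓝 y]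
      sphereInv p.1.1 ∘ Prod.fst := by
    filter_upwards [(isOpen_extChartAt_target p).mem_nhds hy] with z hz
    exact sphCoord_comp_symm hz
  have h4 : HasFDerivAt (sphereInv p.1.1 ∘ Prod.fst) _ y :=
    HasFDerivAt.comp y ((contDiffAt_sphereInv (target_localModel_fst hy)).differentiableAt
      (by simp)).hasFDerivAt hasFDerivAt_fst
  have h5 := h1.mfderiv.symm.trans (h3.mfderiv_eq.trans h4.hasMFDerivAt.mfderiv)
  exact DFunLike.congr_fun h5 v

/-- The equality is read in `E`, since the two base points in `G` agree only propositionally;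
`inner_congr` later feeds it to the metric. -/
theorem mfderiv_grpCoord_chartInv (i : I) (v : EuclideanSpace ℝ (Fin n) × (I → E)) :
    (mfderiv (localModel I n E) 𝓘(ℝ, E) (grpCoord U i)
      ((extChartAt (localModel I n E) p).symm y) (chartInv (localModel I n E) p y v) : E) =
    (chartInv 𝓘(ℝ, E) (p.1.2 i) (y.2 i) (v.2 i) : E) := by
  have h1 := HasMFDerivAt.comp y
    ((contMDiff_grpCoord (n := n) (E := E) (U := U) i).mdifferentiable (by simp) _).hasMFDerivAt
    (mdifferentiableAt_chartSymm hy).hasMFDerivAt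
  have h3 : grpCoord U i ∘ (extChartAt (localModel I n E) p).symm =ᶠ[𝓝 y]
      (extChartAt 𝓘(ℝ, E) (p.1.2 i)).symm ∘ fun z => z.2 i := by
    filter_upwards [(isOpen_extChartAt_target p).mem_nhds hy] with z hz
    exact symm_localModel_snd hz i
  have h4 := HasMFDerivAt.comp y
    (mdifferentiableAt_chartSymm (J := 𝓘(ℝ, E)) (target_localModel_snd hy i)).hasMFDerivAt
    ((ContinuousLinearMap.proj (R := ℝ) (φ := fun _ : I => E) i).comp
      (ContinuousLinearMap.snd ℝ (EuclideanSpace ℝ (Fin n)) (I → E))).hasFDerivAt.hasMFDerivAt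
  have h5 := h1.mfderiv.symm.trans (h3.mfderiv_eq.trans h4.mfderiv)
  exact DFunLike.congr_fun h5 v

variable (gG : Bundle.ContMDiffRiemannianMetric 𝓘(ℝ, E) ∞ E (fun a : G => TangentSpace 𝓘(ℝ, E) a))

omit hy in
theorem inner_congr {a a' : G} (h : a = a') {v w v' w' : E} (hv : v = v') (hw : w = w') :
    gG.inner a (v : TangentSpace 𝓘(ℝ, E) a) (w : TangentSpace 𝓘(ℝ, E) a) =
      gG.inner a' (v' : TangentSpace 𝓘(ℝ, E) a') (w' : TangentSpace 𝓘(ℝ, E) a') := by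
  subst h hv hw; rfl

theorem inner_weightedMetric (c : U → I → ℝ) (v w : EuclideanSpace ℝ (Fin n) × (I → E)) :
    (weightedMetric U gG c).inner _ (chartInv (localModel I n E) p y v)
      (chartInv (localModel I n E) p y w) =
      inner ℝ (fderiv ℝ (sphereInv (p.1.1 : Metric.sphere (0 : EuclideanSpace ℝ I) 1)) y.1 v.1)
        (fderiv ℝ (sphereInv (p.1.1 : Metric.sphere (0 : EuclideanSpace ℝ I) 1)) y.1 w.1) +
      ∑ i, c ((extChartAt (localModel I n E) p).symm y) i *
        coordMetric gG (p.1.2 i) (y.2 i) (v.2 i) (w.2 i) := by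
  rw [← mfderiv_sphCoord_chartInv hy v, ← mfderiv_sphCoord_chartInv hy w]
  refine congrArg₂ (· + ·) rfl (Finset.sum_congr rfl fun i _ => congrArg (fun r : ℝ => _ * r) ?_)
  exact inner_congr gG (symm_localModel_snd hy i) (mfderiv_grpCoord_chartInv hy i v)
    (mfderiv_grpCoord_chartInv hy i w)

end ModelMetric

/-! ### The warped metric as a rescaled product metric -/

section ModelWarped

variable {I : Finset ℕ} {n : ℕ} {E : Type*} [NormedAddCommGroup E] [NormedSpace ℝ E]
  {G : Type*} [TopologicalSpace G] [ChartedSpace E G] [IsManifold 𝓘(ℝ, E) ∞ G]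
  (gG : Bundle.ContMDiffRiemannianMetric 𝓘(ℝ, E) ∞ E (fun a : G => TangentSpace 𝓘(ℝ, E) a))

theorem coordMetric_zero_left (a : G) (u w : E) : coordMetric gG a u 0 w = 0 := by
  rw [coordMetric, map_zero, map_zero]; rfl

variable [FiniteDimensional ℝ E] [Fact (finrank ℝ (EuclideanSpace ℝ I) = n + 1)]
  {U : TopologicalSpace.Opens (LocalModel I G)}

section Chart

variable {p : U} {y : EuclideanSpace ℝ (Fin n) × (I → E)}
  (hy : y ∈ (extChartAt (localModel I n E) p).target)
include hy

theorem chartMetric_weightedMetric (c : U → I → ℝ) (v w : EuclideanSpace ℝ (Fin n) × (I → E)) :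
    chartMetric (weightedMetric U gG c) p y v w =
      inner ℝ (fderiv ℝ (sphereInv (p.1.1 : Metric.sphere (0 : EuclideanSpace ℝ I) 1)) y.1 v.1)
        (fderiv ℝ (sphereInv (p.1.1 : Metric.sphere (0 : EuclideanSpace ℝ I) 1)) y.1 w.1) +
      ∑ i, c ((extChartAt (localModel I n E) p).symm y) i *
        coordMetric gG (p.1.2 i) (y.2 i) (v.2 i) (w.2 i) := by
  rw [chartMetric_apply]
  exact inner_weightedMetric hy gG c v w

theorem chartMetric_productMetric_none (v w : EuclideanSpace ℝ (Fin n) × (I → E)) :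
    chartMetric (productMetric U gG) p y (factorProj I n E none v) w =
      inner ℝ (fderiv ℝ (sphereInv (p.1.1 : Metric.sphere (0 : EuclideanSpace ℝ I) 1)) y.1 v.1)
        (fderiv ℝ (sphereInv (p.1.1 : Metric.sphere (0 : EuclideanSpace ℝ I) 1)) y.1 w.1) := by
  rw [chartMetric_weightedMetric gG hy]
  simp [factorProj_none, coordMetric_zero_left]

theorem chartMetric_productMetric_some (i : I) (v w : EuclideanSpace ℝ (Fin n) × (I → E)) :
    chartMetric (productMetric U gG) p y (factorProj I n E (some i) v) w =
      coordMetric gG (p.1.2 i) (y.2 i) (v.2 i) (w.2 i) := by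
  rw [chartMetric_weightedMetric gG hy, factorProj_some, map_zero, inner_zero_left, zero_add,
    Finset.sum_eq_single i]
  · simp
  · intro j _ hj
    simp [Pi.single_eq_of_ne hj, coordMetric_zero_left]
  · simp

theorem chartMetric_productMetric_proj (a : Option I) (v w : EuclideanSpace ℝ (Fin n) × (I → E)) :
    chartMetric (productMetric U gG) p y (factorProj I n E a v) (factorProj I n E a w) =
      chartMetric (productMetric U gG) p y (factorProj I n E a v) w := by
  cases a with
  | none =>
    rw [chartMetric_productMetric_none gG hy, chartMetric_productMetric_none gG hy,
      factorProj_none]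
  | some i =>
    rw [chartMetric_productMetric_some gG hy, chartMetric_productMetric_some gG hy,
      factorProj_some]
    simp

theorem chartMetric_productMetric_selfAdjoint (a : Option I)
    (v w : EuclideanSpace ℝ (Fin n) × (I → E)) :
    chartMetric (productMetric U gG) p y (factorProj I n E a v) w =
      chartMetric (productMetric U gG) p y v (factorProj I n E a w) := by
  have hsymm (v w) : chartMetric (productMetric U gG) p y v w =
    chartMetric (productMetric U gG) p y w v := (productMetric U gG).symm _ _ _
  rw [hsymm v, ← chartMetric_productMetric_proj gG hy, hsymm,
    chartMetric_productMetric_proj gG hy]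

theorem chartMetric_weightedMetric_eq_sum (c : U → I → ℝ)
    (v w : EuclideanSpace ℝ (Fin n) × (I → E)) :
    chartMetric (weightedMetric U gG c) p y v w = ∑ a : Option I,
      (a.elim 1 fun i => c ((extChartAt (localModel I n E) p).symm y) i) *
      chartMetric (productMetric U gG) p y (factorProj I n E a v) (factorProj I n E a w) := by
  simp only [chartMetric_productMetric_proj gG hy, Fintype.sum_option,
    chartMetric_productMetric_none gG hy, chartMetric_productMetric_some gG hy, Option.elim_none,
    Option.elim_some, one_mul]
  exact chartMetric_weightedMetric gG hy c v w

theorem chartMetric_weightedMetric_pos {c : U → I → ℝ}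
    (hc : ∀ i, 0 < c ((extChartAt (localModel I n E) p).symm y) i)
    {v : EuclideanSpace ℝ (Fin n) × (I → E)} (hv : v ≠ 0) :
    0 < chartMetric (weightedMetric U gG c) p y v v := by
  have hnn (i : I) : 0 ≤ c ((extChartAt (localModel I n E) p).symm y) i *
      coordMetric gG (p.1.2 i) (y.2 i) (v.2 i) (v.2 i) := by
    by_cases h : v.2 i = 0
    · rw [h, coordMetric_zero_left, mul_zero]
    · exact (mul_pos (hc i) (coordMetric_pos gG (target_localModel_snd hy i) h)).le
  rw [chartMetric_weightedMetric gG hy]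
  by_cases h1 : v.1 = 0
  · refine add_pos_of_nonneg_of_pos real_inner_self_nonneg ?_
    obtain ⟨i, hi⟩ : ∃ i, v.2 i ≠ 0 := by
      by_contra! h
      exact hv (Prod.ext h1 (funext h))
    exact Finset.sum_pos' (fun j _ => hnn j) ⟨i, Finset.mem_univ i,
      mul_pos (hc i) (coordMetric_pos gG (target_localModel_snd hy i) hi)⟩
  · refine add_pos_of_pos_of_nonneg (real_inner_self_pos.2 fun h => h1 ?_)
      (Finset.sum_nonneg fun i _ => hnn i)
    exact fderiv_sphereInv_injective (target_localModel_fst hy) (by rw [h, map_zero])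

end Chart

theorem isRiemannian_productMetric : IsRiemannian (productMetric (n := n) U gG) := by
  refine IsRiemannian.of_chart (fun p₀ y hy v hv =>
    chartMetric_weightedMetric_pos gG hy (fun _ => one_pos) hv) fun p₀ v w y hy => ?_
  have h1 : ContDiffAt ℝ ∞ (fun z : EuclideanSpace ℝ (Fin n) × (I → E) =>
      fderiv ℝ (sphereInv (p₀.1.1 : Metric.sphere (0 : EuclideanSpace ℝ I) 1)) z.1) y :=
    ((contDiffAt_sphereInv (target_localModel_fst hy)).fderiv_right (m := ∞) (by simp)).comp y
      contDiffAt_fst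
  have h2 (i : I) : ContDiffAt ℝ ∞ (fun z : EuclideanSpace ℝ (Fin n) × (I → E) =>
      coordMetric gG (p₀.1.2 i) (z.2 i) (v.2 i) (w.2 i)) y :=
    ContDiffAt.comp (g := fun u => coordMetric gG (p₀.1.2 i) u (v.2 i) (w.2 i))
      (f := fun z : EuclideanSpace ℝ (Fin n) × (I → E) => z.2 i) y
      (contDiffAt_coordMetric gG (target_localModel_snd hy i) _ _)
      ((contDiff_apply ℝ E i).comp contDiff_snd).contDiffAt
  have h3 : ContDiffAt ℝ ∞ (fun z : EuclideanSpace ℝ (Fin n) × (I → E) =>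
      inner ℝ (fderiv ℝ (sphereInv (p₀.1.1 : Metric.sphere (0 : EuclideanSpace ℝ I) 1)) z.1 v.1)
        (fderiv ℝ (sphereInv (p₀.1.1 : Metric.sphere (0 : EuclideanSpace ℝ I) 1)) z.1 w.1) +
      ∑ i, (1 : ℝ) * coordMetric gG (p₀.1.2 i) (z.2 i) (v.2 i) (w.2 i)) y :=
    ((h1.clm_apply contDiffAt_const).inner ℝ (h1.clm_apply contDiffAt_const)).add
      (ContDiffAt.sum fun i _ => contDiffAt_const.mul (h2 i))
  refine (h3.congr_of_eventuallyEq ?_).contDiffWithinAt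
  filter_upwards [(isOpen_extChartAt_target p₀).mem_nhds hy] with z hz
  rw [chartMetric_weightedMetric gG hz]

variable (U n E) in
/-- The weights of the warped metric, except that they are `1` if the group is discrete. -/
def modelWeight (a : Option I) : C^∞⟮localModel I n E, U; ℝ⟯ :=
  haveI := Classical.propDecidable (Subsingleton E)
  ⟨fun p => a.elim 1 fun i => if Subsingleton E then 1 else sphCoord U p i ^ 2, by
    cases a with
    | none => exact contMDiff_const
    | some i =>
      by_cases h : Subsingleton E
      · simp only [Option.elim_some, if_pos h]
        exact contMDiff_const
      · simp only [Option.elim_some, if_neg h]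
        exact ((EuclideanSpace.proj (𝕜 := ℝ) i).contMDiff.comp contMDiff_sphCoord).pow 2⟩

theorem modelWeight_none (p : U) : modelWeight n E U none p = 1 := rfl

theorem modelWeight_of_subsingleton [h : Subsingleton E] (a : Option I) (p : U) :
    modelWeight n E U a p = 1 := by
  cases a with
  | none => rfl
  | some i => exact if_pos h

theorem modelWeight_some [h : Nontrivial E] (i : I) (p : U) :
    modelWeight n E U (some i) p = sphCoord U p i ^ 2 :=
  if_neg (not_subsingleton E)

/-- For a nontrivial `E` the weights `xᵢ²` are positive and depend on the sphere variable only, so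
they are constant along every group factor. For a trivial `E` coordinates may vanish, but the group
blocks of the metric are zero, and the weight `1` is equally correct and positive. -/
theorem isWarped_warpedMetric (hne : Nontrivial E → ∀ (p : U) i, sphCoord U p i ≠ 0) :
    IsWarped (warpedMetric (n := n) U gG) (productMetric U gG) (factorProj I n E)
      (modelWeight n E U) where
  comm := commutesWithCharts_factorProj
  sum_proj := sum_factorProj
  proj_proj := factorProj_comp_self
  proj_proj_ne := factorProj_comp_of_ne
  pos a p := by
    rcases subsingleton_or_nontrivial E with h | h
    · rw [modelWeight_of_subsingleton]; exact one_pos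
    · cases a with
      | none => rw [modelWeight_none]; exact one_pos
      | some i => rw [modelWeight_some]; exact sq_pos_iff.2 (hne h p i)
  inner_eq p₀ y hy v w := by
    rw [chartMetric_weightedMetric_eq_sum gG hy]
    refine Finset.sum_congr rfl fun a _ => ?_
    cases a with
    | none => rw [modelWeight_none]; rfl
    | some i =>
      rcases subsingleton_or_nontrivial E with h | h
      · rw [chartMetric_productMetric_some gG hy, Subsingleton.elim (v.2 i) 0,
          coordMetric_zero_left, mul_zero, mul_zero]
      · rw [modelWeight_some]; rfl
  selfAdjoint p₀ y hy a v w := chartMetric_productMetric_selfAdjoint gG hy a v w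
  fderiv_comp p₀ y hy a := by
    have hd : DifferentiableAt ℝ (fun z => modelWeight n E U a
        ((extChartAt (localModel I n E) p₀).symm z)) y :=
      (contDiffAt_comp_chartSymm hy (modelWeight n E U a).contMDiff.contMDiffAt).differentiableAt
        (by simp)
    refine ContinuousLinearMap.ext fun v => ?_
    refine fderiv_apply_eq_zero_of_eventually hd ?_
    filter_upwards [(isOpen_extChartAt_target p₀).mem_nhds hy] with z hz
    rintro ⟨r, hr⟩
    cases a with
    | none => rw [modelWeight_none, modelWeight_none]
    | some i =>
      rcases subsingleton_or_nontrivial E with h | h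
      · rw [modelWeight_of_subsingleton, modelWeight_of_subsingleton]
      · have h1 : z.1 = y.1 := by
          rw [hr]
          change y.1 + r • (factorProj I n E (some i) v).1 = y.1
          rw [factorProj_some, smul_zero, add_zero]
        rw [modelWeight_some, modelWeight_some, sphCoord_comp_symm hz, sphCoord_comp_symm hy, h1]

end ModelWarped

/-! ### Constant rank forces nonvanishing coordinates -/

section Rank

variable {I : Finset ℕ} {n : ℕ} {E : Type*} [NormedAddCommGroup E] [NormedSpace ℝ E]
  {G : Type*} [TopologicalSpace G] [ChartedSpace E G] [IsManifold 𝓘(ℝ, E) ∞ G]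
  (gG : Bundle.ContMDiffRiemannianMetric 𝓘(ℝ, E) ∞ E (fun a : G => TangentSpace 𝓘(ℝ, E) a))
  [FiniteDimensional ℝ E] [Fact (finrank ℝ (EuclideanSpace ℝ I) = n + 1)]
  {U : TopologicalSpace.Opens (LocalModel I G)}

/-- Points with nonvanishing coordinates are dense in the sphere. -/
theorem exists_tendsto_sphere (x : Metric.sphere (0 : EuclideanSpace ℝ I) 1) :
    ∃ c : ℝ → Metric.sphere (0 : EuclideanSpace ℝ I) 1, Filter.Tendsto c (𝓝[>] 0) (𝓝 x) ∧
      ∀ᶠ r in 𝓝[>] (0 : ℝ), ∀ i, (c r : EuclideanSpace ℝ I) i ≠ 0 := by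
  -- The signs are chosen so that a positive multiple of `s` pushes each coordinate of `x` away from
  -- zero; vanishing coordinates become positive.
  set s : EuclideanSpace ℝ I := WithLp.toLp 2 fun i => if 0 ≤ (x : EuclideanSpace ℝ I) i then 1 else -1
  set d : ℝ → EuclideanSpace ℝ I := fun r => (x : EuclideanSpace ℝ I) + r • s with hd
  have hdc : Continuous d := by fun_prop
  have hx : ‖(x : EuclideanSpace ℝ I)‖ = 1 := by simp
  have hd0 : d 0 = x := by simp [hd]
  have hx0 : (x : EuclideanSpace ℝ I) ≠ 0 := fun h => by simp [h] at hx
  have hne : ∀ᶠ r in 𝓝 (0 : ℝ), d r ≠ 0 :=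
    hdc.continuousAt.eventually_ne (by rw [hd0]; exact hx0)
  classical
  -- The perturbed point is normalised back to the sphere. The default value `x` occurs only where
  -- `d r = 0`, hence not for small `r`.
  let c : ℝ → Metric.sphere (0 : EuclideanSpace ℝ I) 1 := fun r =>
    if h : d r ≠ 0 then ⟨‖d r‖⁻¹ • d r, by simp [norm_smul, h]⟩ else x
  have hcv : ∀ r, d r ≠ 0 → (c r : EuclideanSpace ℝ I) = ‖d r‖⁻¹ • d r := fun r h => by
    simp only [c, dif_pos h]
  refine ⟨c, ?_, ?_⟩
  · rw [tendsto_subtype_rng]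
    have h1 : Filter.Tendsto (fun r => ‖d r‖⁻¹ • d r) (𝓝 0) (𝓝 (x : EuclideanSpace ℝ I)) := by
      have : ContinuousAt (fun r => ‖d r‖⁻¹ • d r) 0 :=
        (hdc.norm.continuousAt.inv₀ (by simp [hd0, hx])).smul hdc.continuousAt
      have h2 := this.tendsto
      simpa [hd0, hx] using h2
    exact (h1.congr' (hne.mono fun r hr => (hcv r hr).symm)).mono_left nhdsWithin_le_nhds
  · filter_upwards [hne.filter_mono nhdsWithin_le_nhds, self_mem_nhdsWithin] with r hr hr0 i
    rw [hcv r hr]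
    have hr0' : (0 : ℝ) < r := hr0
    have h3 : d r i ≠ 0 := by
      have : d r i = (x : EuclideanSpace ℝ I) i + r * (if 0 ≤ (x : EuclideanSpace ℝ I) i then 1 else -1) := rfl
      rw [this]
      split_ifs with h
      · exact (by linarith : (0 : ℝ) < (x : EuclideanSpace ℝ I) i + r * 1).ne'
      · exact (by linarith [not_le.1 h] : (x : EuclideanSpace ℝ I) i + r * -1 < 0).ne
    have h4 : (‖d r‖⁻¹ • d r) i = ‖d r‖⁻¹ * d r i := rfl
    rw [h4]
    exact mul_ne_zero (inv_ne_zero (norm_ne_zero_iff.2 hr)) h3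

theorem kernel_warpedMetric_eq_bot (q : U) (hq : ∀ i, sphCoord U q i ≠ 0) :
    (warpedMetric (n := n) U gG).kernel q = ⊥ := by
  have key : ∀ q', (∀ i, sphCoord U q' i ≠ 0) →
      q' = (extChartAt (localModel I n E) q).symm (extChartAt (localModel I n E) q q) →
      (warpedMetric (n := n) U gG).kernel q' = ⊥ := by
    rintro q' hq' rfl
    have hy := mem_extChartAt_target (I := localModel I n E) q
    rw [Submodule.eq_bot_iff]
    intro v hv
    have hv' : (warpedMetric (n := n) U gG).inner _ v = 0 := hv
    by_contra h0
    have h1 := chartInv_chartDer hy v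
    have h2 := chartMetric_weightedMetric_pos gG hy (c := fun p i => sphCoord U p i ^ 2)
      (fun i => sq_pos_iff.2 (hq' i)) (v := chartDer (localModel I n E) q _ v)
      fun h => h0 (by rw [← h1, h, map_zero])
    rw [chartMetric_apply, h1] at h2
    change 0 < (warpedMetric (n := n) U gG).inner _ v v at h2
    rw [hv'] at h2
    exact lt_irrefl _ h2
  exact key q hq ((extChartAt (localModel I n E) q).left_inv (mem_extChartAt_source q)).symm

/-- Where `x_i = 0`, the metric does not see vectors tangent to the `i`-th copy of the group. -/
theorem kernel_warpedMetric_ne_bot [Nontrivial E] (q : U) (i : I) (hq : sphCoord U q i = 0) :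
    (warpedMetric (n := n) U gG).kernel q ≠ ⊥ := by
  have key : ∀ q', sphCoord U q' i = 0 →
      q' = (extChartAt (localModel I n E) q).symm (extChartAt (localModel I n E) q q) →
      (warpedMetric (n := n) U gG).kernel q' ≠ ⊥ := by
    rintro q' hq' rfl
    have hy := mem_extChartAt_target (I := localModel I n E) q
    obtain ⟨e, he⟩ := exists_ne (0 : E)
    intro hbot
    set v : EuclideanSpace ℝ (Fin n) × (I → E) := (0, Pi.single i e) with hv
    have h1 : chartInv (localModel I n E) q _ v ∈ (warpedMetric (n := n) U gG).kernel
        ((extChartAt (localModel I n E) q).symm (extChartAt (localModel I n E) q q)) := by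
      change (warpedMetric (n := n) U gG).inner _ _ = 0
      ext u
      obtain ⟨u', rfl⟩ : ∃ u', u = chartInv (localModel I n E) q _ u' :=
        ⟨_, (chartInv_chartDer hy u).symm⟩
      have h2 := chartMetric_weightedMetric gG hy (fun p i => sphCoord U p i ^ 2) v u'
      rw [chartMetric_apply] at h2
      refine h2.trans ?_
      rw [hv, map_zero, inner_zero_left, zero_add, LinearMap.zero_apply]
      refine Finset.sum_eq_zero fun j _ => ?_
      by_cases hj : j = i
      · subst hj
        rw [hq', zero_pow two_ne_zero, zero_mul]
      · simp [Pi.single_eq_of_ne hj, coordMetric_zero_left]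
    rw [hbot, Submodule.mem_bot] at h1
    have h3 : v = 0 := by
      rw [← chartDer_chartInv hy v, h1, map_zero]
    have h4 := congrFun (congrArg Prod.snd h3) i
    simp [hv] at h4
    exact he h4
  exact key q hq ((extChartAt (localModel I n E) q).left_inv (mem_extChartAt_source q)).symm

/-- By rank-nullity, at a zero of a coordinate the quotient has strictly smaller dimension than the
tangent space. Along the approximating points of `exists_tendsto_sphere` it has full dimension,
contradicting local constancy. -/
theorem sphCoord_ne_zero_of_hasFiniteRank [Nontrivial E]
    (h : (warpedMetric (n := n) U gG).HasFiniteRank) (p : U) (i : I) : sphCoord U p i ≠ 0 := by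
  intro hp
  obtain ⟨c, hc, hc0⟩ := exists_tendsto_sphere p.1.1
  have hc' : Filter.Tendsto (fun r => (c r, p.1.2)) (𝓝[>] 0) (𝓝 p.1) :=
    hc.prodMk_nhds tendsto_const_nhds
  have hconst := h.2.eventually_eq p
  -- Local constancy is moved from `U` to the ambient space, where the approximating curve takes its
  -- values.
  have hconst' : ∀ᶠ r in 𝓝 p.1, ∀ hr : r ∈ U, finrank ℝ ((warpedMetric (n := n) U gG).Hor ⟨r, hr⟩) =
      finrank ℝ ((warpedMetric (n := n) U gG).Hor p) := by
    rw [← map_nhds_subtype_coe_eq_nhds p.2 (U.isOpen.mem_nhds p.2)]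
    rw [Filter.eventually_map]
    exact hconst.mono fun q hq hr => hq
  obtain ⟨r, ⟨h1, h2⟩, h3⟩ := (((hc'.eventually hconst').and
    (hc'.eventually (U.isOpen.mem_nhds p.2))).and hc0).exists
  have h4 := h1 h2
  have (q : U) : FiniteDimensional ℝ (TangentSpace (localModel I n E) q) :=
    inferInstanceAs (FiniteDimensional ℝ (EuclideanSpace ℝ (Fin n) × (I → E)))
  have hV (q : U) : finrank ℝ (TangentSpace (localModel I n E) q) =
    finrank ℝ (EuclideanSpace ℝ (Fin n) × (I → E)) := rfl
  have e1 := Submodule.finrank_quotient_add_finrank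
    ((warpedMetric (n := n) U gG).kernel ⟨(c r, p.1.2), h2⟩)
  have e2 := Submodule.finrank_quotient_add_finrank ((warpedMetric (n := n) U gG).kernel p)
  have e0 : finrank ℝ ((warpedMetric (n := n) U gG).kernel ⟨(c r, p.1.2), h2⟩) = 0 := by
    rw [kernel_warpedMetric_eq_bot gG ⟨(c r, p.1.2), h2⟩ h3, finrank_bot]
  have e3 : 0 < finrank ℝ ((warpedMetric (n := n) U gG).kernel p) :=
    Submodule.one_le_finrank_iff.2 (kernel_warpedMetric_ne_bot gG p i hp)
  rw [hV] at e1 e2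
  change finrank ℝ ((warpedMetric (n := n) U gG).Hor ⟨(c r, p.1.2), h2⟩) + _ = _ at e1
  change finrank ℝ ((warpedMetric (n := n) U gG).Hor p) + _ = _ at e2
  omega

end Rank

/-! ### Gram determinants -/

section Gram

variable {V : Type*} [NormedAddCommGroup V] [NormedSpace ℝ V] [FiniteDimensional ℝ V]

/-- The Gram matrix of a bilinear form in the fixed basis. -/
def gramOf (B : V →L[ℝ] V →L[ℝ] ℝ) : Matrix (Fin (finrank ℝ V)) (Fin (finrank ℝ V)) ℝ :=
  Matrix.of fun i j => B (finBasis ℝ V i) (finBasis ℝ V j)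

theorem IsInner.gramOf_det_pos {B : V →L[ℝ] V →L[ℝ] ℝ} (hB : IsInner B) : 0 < (gramOf B).det := by
  refine Matrix.PosDef.det_pos (.of_dotProduct_mulVec_pos ?_ fun x hx => ?_)
  · ext i j
    exact hB.symm _ _
  · have h0 : ∑ i, x i • finBasis ℝ V i ≠ 0 := fun h =>
      hx (funext (Fintype.linearIndependent_iff.1 (finBasis ℝ V).linearIndependent x h))
    have h1 := hB.pos _ h0
    refine h1.trans_eq ?_
    simp only [map_sum, map_smul, _root_.sum_apply, _root_.smul_apply, smul_eq_mul, dotProduct,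
      Matrix.mulVec, gramOf, Matrix.of_apply, star_trivial, Finset.mul_sum]
    rw [Finset.sum_comm]
    refine Finset.sum_congr rfl fun i _ => Finset.sum_congr rfl fun j _ => by ring

/-- Only one argument is transformed, so the determinant of `T` enters once and not squared. It is
applied with `T` the block scaling by the weights. -/
theorem gramOf_comp_det (B : V →L[ℝ] V →L[ℝ] ℝ) (T : V →ₗ[ℝ] V) {B' : V →L[ℝ] V →L[ℝ] ℝ}
    (h : ∀ v w, B' v w = B (T v) w) : (gramOf B').det = LinearMap.det T * (gramOf B).det := by
  have h1 : gramOf B' = (LinearMap.toMatrix (finBasis ℝ V) (finBasis ℝ V) T).transpose * gramOf B := by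
    ext i j
    rw [gramOf, Matrix.of_apply, h, Matrix.mul_apply]
    conv_lhs => rw [← (finBasis ℝ V).sum_repr (T (finBasis ℝ V i))]
    rw [map_sum, _root_.sum_apply]
    simp [gramOf, LinearMap.toMatrix_apply, -Basis.sum_repr]
  rw [h1, Matrix.det_mul, Matrix.det_transpose, LinearMap.det_toMatrix]

variable {H : Type*} [TopologicalSpace H] {J : ModelWithCorners ℝ V H} [J.Boundaryless]
  {M : Type*} [TopologicalSpace M] [ChartedSpace H M] [IsManifold J ∞ M]

/-- The density of the Riemannian volume in the preferred chart at `p₀`. -/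
def volDensity (b : SymTensor J M) (p₀ : M) (y : V) : ℝ :=
  Real.sqrt (gramOf (chartMetric b p₀ y)).det

theorem IsRiemannian.contDiffAt_gramOf_det {b : SymTensor J M} (hb : IsRiemannian b) {p₀ : M} {y : V}
    (hy : y ∈ (extChartAt J p₀).target) :
    ContDiffAt ℝ ∞ (fun z => (gramOf (chartMetric b p₀ z)).det) y := by
  simp only [Matrix.det_apply']
  refine ContDiffAt.sum fun τ _ => contDiffAt_const.mul (contDiffAt_prod fun i _ => ?_)
  exact (hb.smooth p₀ _ _).contDiffAt ((isOpen_extChartAt_target p₀).mem_nhds hy)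

end Gram

/-! ### Riemannian volumes have smooth densities -/

section Volume

variable (V : Type*) [NormedAddCommGroup V] [NormedSpace ℝ V] [FiniteDimensional ℝ V]
  [MeasurableSpace V] [BorelSpace V]

/-- The Lebesgue measure for which the fixed basis spans a unit cube. -/
def basisVolume : Measure V :=
  (volume : Measure (Fin (finrank ℝ V) → ℝ)).map
    (finBasis ℝ V).equivFunL.symm

instance : (basisVolume V).IsAddHaarMeasure :=
  ContinuousLinearEquiv.isAddHaarMeasure_map _ _

variable {V}

theorem setLIntegral_basisVolume (A : Set V) (f : V → ENNReal) :
    ∫⁻ z in A, f z ∂(basisVolume V) =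
      ∫⁻ y in (finBasis ℝ V).equivFun '' A, f ((finBasis ℝ V).equivFun.symm y) := by
  have h : basisVolume V = (volume : Measure (Fin (finrank ℝ V) → ℝ)).map
    (finBasis ℝ V).equivFunL.symm.toHomeomorph.toMeasurableEquiv := rfl
  rw [h, MeasurableEquiv.restrict_map, MeasureTheory.lintegral_map_equiv]
  have h2 : (finBasis ℝ V).equivFun '' A =
      (finBasis ℝ V).equivFunL.symm.toHomeomorph.toMeasurableEquiv ⁻¹' A :=
    (finBasis ℝ V).equivFun.toEquiv.image_eq_preimage_symm A
  rw [h2]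
  rfl

variable {H : Type*} [TopologicalSpace H] {J : ModelWithCorners ℝ V H} [J.Boundaryless]
  {M : Type*} [TopologicalSpace M] [ChartedSpace H M] [IsManifold J ∞ M]
  [MeasurableSpace M] [BorelSpace M]

/-- The square root is smooth because the Gram determinant stays positive. -/
theorem IsRiemannian.hasSmoothDensity {b : SymTensor J M} (hb : IsRiemannian b) {μ : Measure M}
    (hμ : b.IsVolume μ) : HasSmoothDensity (basisVolume V) J μ (volDensity b) where
  smooth p₀ y hy := ((hb.contDiffAt_gramOf_det hy).sqrt
    (hb.isInner hy).gramOf_det_pos.ne').contDiffWithinAt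
  pos p₀ y hy := Real.sqrt_pos.2 (hb.isInner hy).gramOf_det_pos
  apply_eq p₀ A hA hAs := by
    rw [hμ p₀ A hA hAs, setLIntegral_basisVolume, image_image]
    rfl

theorem HasSmoothDensity.withDensity {ν : Measure V} [ν.IsAddHaarMeasure] {μ : Measure M}
    {w : M → V → ℝ} (hμ : HasSmoothDensity ν J μ w) (ρ : C^∞⟮J, M; ℝ⟯) (hρ : ∀ p, 0 < ρ p) :
    HasSmoothDensity ν J (μ.withDensity fun p => ENNReal.ofReal (ρ p))
      fun p₀ y => ρ ((extChartAt J p₀).symm y) * w p₀ y where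
  smooth p₀ y hy := ((contDiffAt_comp_chartSymm hy ρ.contMDiff.contMDiffAt).mul
    (hμ.contDiffAt hy)).contDiffWithinAt
  pos p₀ y hy := mul_pos (hρ _) (hμ.pos p₀ y hy)
  apply_eq p₀ A hA hAs := by
    have hsymm : AEMeasurable (extChartAt J p₀).symm (ν.restrict (extChartAt J p₀).target) :=
      (continuousOn_extChartAt_symm p₀).aemeasurable (isOpen_extChartAt_target p₀).measurableSet
    have hρm : Measurable fun p => ENNReal.ofReal (ρ p) :=
      ρ.contMDiff.continuous.measurable.ennreal_ofReal
    have hsub : (extChartAt J p₀).symm ⁻¹' A ∩ (extChartAt J p₀).target = extChartAt J p₀ '' A := by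
      rw [inter_comm, ← (extChartAt J p₀).image_source_inter_eq', inter_eq_right.2 hAs]
    have hsub' : extChartAt J p₀ '' A ⊆ (extChartAt J p₀).target := hsub ▸ inter_subset_right
    rw [withDensity_apply _ hA, ← inter_eq_left.2 hAs, ← Measure.restrict_restrict hA,
      inter_eq_left.2 hAs, hμ.restrict_source p₀,
      Measure.restrict_map_of_aemeasurable
        (hsymm.mono_ac (withDensity_absolutelyContinuous _ _)) hA]
    rw [lintegral_map' hρm.aemeasurable
      (hsymm.mono_ac (withDensity_absolutelyContinuous _ _)).restrict]
    rw [restrict_withDensity', Measure.restrict_restrict' (isOpen_extChartAt_target p₀).measurableSet,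
      hsub]
    have hle : ν.restrict (extChartAt J p₀ '' A) ≤ ν.restrict (extChartAt J p₀).target :=
      Measure.restrict_mono hsub' le_rfl
    rw [lintegral_withDensity_eq_lintegral_mul₀ ((hμ.aemeasurable p₀).mono_measure hle)
      (g := fun y => ENNReal.ofReal (ρ ((extChartAt J p₀).symm y)))
      (hρm.comp_aemeasurable (hsymm.mono_measure hle))]
    refine lintegral_congr fun y => ?_
    rw [Pi.mul_apply, mul_comm, ENNReal.ofReal_mul (hρ _).le]

end Volume

/-! ### Comparison of the warped and the product volume -/

section ModelVolume

variable {I : Finset ℕ} {n : ℕ} {E : Type*} [NormedAddCommGroup E] [NormedSpace ℝ E]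
  {G : Type*} [TopologicalSpace G] [ChartedSpace E G] [IsManifold 𝓘(ℝ, E) ∞ G]
  (gG : Bundle.ContMDiffRiemannianMetric 𝓘(ℝ, E) ∞ E (fun a : G => TangentSpace 𝓘(ℝ, E) a))
  [FiniteDimensional ℝ E] [Fact (finrank ℝ (EuclideanSpace ℝ I) = n + 1)]
  {U : TopologicalSpace.Opens (LocalModel I G)}

theorem det_sum_factorProj (t : I → ℝ) :
    LinearMap.det (∑ a : Option I, a.elim 1 t •
      (factorProj I n E a : (EuclideanSpace ℝ (Fin n) × (I → E)) →ₗ[ℝ] _)) =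
      ∏ i, t i ^ finrank ℝ E := by
  have h : ∑ a : Option I, a.elim 1 t •
      (factorProj I n E a : (EuclideanSpace ℝ (Fin n) × (I → E)) →ₗ[ℝ] _) =
      LinearMap.prodMap LinearMap.id
        (LinearMap.pi fun i => (t i • (LinearMap.id : E →ₗ[ℝ] E)) ∘ₗ LinearMap.proj i) := by
    refine LinearMap.ext fun v => ?_
    rw [LinearMap.sum_apply, Fintype.sum_option]
    simp only [Option.elim_none, Option.elim_some, one_smul, LinearMap.smul_apply,
      ContinuousLinearMap.coe_coe, factorProj_none, factorProj_some]
    refine Prod.ext ?_ (funext fun i => ?_)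
    · simp [Prod.fst_sum]
    · simp [Prod.snd_sum, Finset.sum_apply, ← Pi.single_smul]
  rw [h, LinearMap.det_prodMap, LinearMap.det_id, one_mul, LinearMap.det_pi]
  simp

/-- The logarithm of the quotient of the volume densities of the warped metric and the
product metric is `dim G ∑ᵢ log |xᵢ|`. -/
theorem volDensity_warpedMetric (hne : Nontrivial E → ∀ (p : U) i, sphCoord U p i ≠ 0) {p : U}
    {y : EuclideanSpace ℝ (Fin n) × (I → E)} (hy : y ∈ (extChartAt (localModel I n E) p).target) :
    volDensity (warpedMetric U gG) p y =
      Real.exp (finrank ℝ E *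
        ∑ i, Real.log (sphCoord U ((extChartAt (localModel I n E) p).symm y) i)) *
      volDensity (productMetric U gG) p y := by
  set q := (extChartAt (localModel I n E) p).symm y
  rw [volDensity, volDensity, gramOf_comp_det (chartMetric (productMetric U gG) p y)
    (∑ a : Option I, a.elim 1 (fun i => sphCoord U q i ^ 2) •
      (factorProj I n E a : (EuclideanSpace ℝ (Fin n) × (I → E)) →ₗ[ℝ] _)) fun v w => ?_,
    det_sum_factorProj, Real.sqrt_mul (Finset.prod_nonneg fun i _ => by positivity)]
  · congr 1
    rw [Real.sqrt_eq_iff_mul_self_eq (Finset.prod_nonneg fun i _ => by positivity)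
      (Real.exp_pos _).le, ← Real.exp_add, Finset.mul_sum, ← Finset.sum_add_distrib,
      Real.exp_sum]
    -- For trivial `E` all exponents are zero. Otherwise `exp (log x) = |x|`, since the logarithm
    -- ignores the sign, so each factor squares to the required power of `xᵢ²`.
    refine Finset.prod_congr rfl fun i _ => ?_
    rcases subsingleton_or_nontrivial E with h | h
    · simp [finrank_zero_of_subsingleton]
    · rw [← mul_add, mul_comm, Real.exp_mul, Real.exp_add, Real.exp_log_eq_abs (hne h q i),
        abs_mul_abs_self, Real.rpow_natCast, sq]
  · rw [chartMetric_weightedMetric_eq_sum gG hy, LinearMap.sum_apply, map_sum, _root_.sum_apply]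
    refine Finset.sum_congr rfl fun a _ => ?_
    rw [chartMetric_productMetric_proj gG hy]
    simp [q]

end ModelVolume

/-! ### Logarithmic derivative of the density -/

section Functions

variable {V : Type*} [NormedAddCommGroup V] [NormedSpace ℝ V] [FiniteDimensional ℝ V]
  {H : Type*} [TopologicalSpace H] {J : ModelWithCorners ℝ V H} [J.Boundaryless]
  {M : Type*} [TopologicalSpace M] [ChartedSpace H M] [IsManifold J ∞ M]

theorem contDiffAt_chartRep_funForm {f : M → ℝ} (hf : ContMDiff J 𝓘(ℝ, ℝ) ∞ f) {p : M} {y : V}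
    (hy : y ∈ (extChartAt J p).target) : ContDiffAt ℝ ∞ (chartRep J p (funForm J f)) y :=
  contDiffAt_form_iff.2 fun _ => contDiffAt_comp_chartSymm hy hf.contMDiffAt

theorem isSmoothForm_funForm {f : M → ℝ} (hf : ContMDiff J 𝓘(ℝ, ℝ) ∞ f) :
    IsSmoothForm J (funForm J f) :=
  fun _ _ hy => (contDiffAt_chartRep_funForm hf hy).contDiffWithinAt

theorem extD_funForm_apply {f : M → ℝ} (hf : ContMDiff J 𝓘(ℝ, ℝ) ∞ f) (p : M)
    (v : Fin 1 → TangentSpace J p) :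
    extD J (funForm J f) p v = fderiv ℝ (fun z => f ((extChartAt J p).symm z)) (extChartAt J p p)
      (mfderiv J 𝓘(ℝ, V) (extChartAt J p) p (v 0)) := by
  have hy := mem_extChartAt_target (I := J) p
  refine (alternatize_zeroForm _ _).trans ?_
  exact (fderiv_chartCoeff (contDiffAt_chartRep_funForm hf hy) _).symm

theorem pairing_sum_left (b : SymTensor J M) {k : ℕ} (p : M) {ι : Type*} (s : Finset ι)
    (α : ι → TangentSpace J p [⋀^Fin k]→L[ℝ] ℝ) (β : TangentSpace J p [⋀^Fin k]→L[ℝ] ℝ) :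
    b.pairing p (∑ i ∈ s, α i) β = ∑ i ∈ s, b.pairing p (α i) β := by
  classical
  induction s using Finset.induction_on with
  | empty => exact pairing_zero_left b p β
  | insert a s ha ih => rw [Finset.sum_insert ha, Finset.sum_insert ha, pairing_add_left, ih]

/-- The logarithmic derivative of `ρ exp (m ∑ᵢ log |xᵢ|)`. -/
theorem extD_mul_exp_sum_log {ι : Type*} [Fintype ι] {ρ σ : M → ℝ} {x : ι → M → ℝ} {m : ℕ}
    (hρ : ContMDiff J 𝓘(ℝ, ℝ) ∞ ρ) (hσ : ContMDiff J 𝓘(ℝ, ℝ) ∞ σ)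
    (hx : ∀ i, ContMDiff J 𝓘(ℝ, ℝ) ∞ (x i)) (h0 : m ≠ 0 → ∀ i p, x i p ≠ 0)
    (h : ∀ p, σ p = ρ p * Real.exp (m * ∑ i, Real.log (x i p))) (p : M) :
    extD J (funForm J σ) p = Real.exp (m * ∑ i, Real.log (x i p)) •
      (extD J (funForm J ρ) p + (ρ p * m) • ∑ i, (x i p)⁻¹ • extD J (funForm J (x i)) p) := by
  have hy := mem_extChartAt_target (I := J) p
  have hpy := (extChartAt J p).left_inv (mem_extChartAt_source (I := J) p)
  set y := extChartAt J p p
  have hd {f : M → ℝ} (hf : ContMDiff J 𝓘(ℝ, ℝ) ∞ f) :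
      HasFDerivAt (fun z => f ((extChartAt J p).symm z))
        (fderiv ℝ (fun z => f ((extChartAt J p).symm z)) y) y :=
    ((contDiffAt_comp_chartSymm hy hf.contMDiffAt).differentiableAt (by simp)).hasFDerivAt
  have hl : HasFDerivAt (fun z => (m : ℝ) * ∑ i, Real.log (x i ((extChartAt J p).symm z)))
      ((m : ℝ) • ∑ i, (x i p)⁻¹ • fderiv ℝ (fun z => x i ((extChartAt J p).symm z)) y) y := by
    -- For `m = 0` the coordinates may vanish, but then the exponent is the constant zero and
    -- nothing has to be differentiated.
    by_cases hm : m = 0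
    · subst hm
      simpa using hasFDerivAt_const (0 : ℝ) y
    · refine (HasFDerivAt.fun_sum fun i _ => ?_).const_mul _
      have := (hd (hx i)).log (h0 hm i _)
      rwa [hpy] at this
  have he := (hd hρ).mul hl.exp
  have hs := (he.congr_of_eventuallyEq (f₁ := fun z => σ ((extChartAt J p).symm z))
    (Filter.Eventually.of_forall fun z => h _)).fderiv
  have hs' (u : V) : fderiv ℝ (fun z => σ ((extChartAt J p).symm z)) y u =
      Real.exp (m * ∑ i, Real.log (x i p)) *
        (fderiv ℝ (fun z => ρ ((extChartAt J p).symm z)) y u + (ρ p * m) *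
          ∑ i, (x i p)⁻¹ * fderiv ℝ (fun z => x i ((extChartAt J p).symm z)) y u) := by
    rw [hs, hpy]
    simp only [add_apply, smul_apply, sum_apply, smul_eq_mul]
    ring
  ext v
  rw [extD_funForm_apply hσ]
  refine (hs' _).trans ?_
  simp only [ContinuousAlternatingMap.add_apply, ContinuousAlternatingMap.smul_apply, smul_eq_mul,
    ContinuousAlternatingMap.sum_apply, extD_funForm_apply hρ, extD_funForm_apply (hx _)]
  rfl

/-- Division by `σ` removes the exponential and turns `dσ` into `d log σ = d log ρ + m ∑ dxᵢ / xᵢ`.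
-/
theorem pairing_extD_mul_exp_sum_log (b : SymTensor J M) {ι : Type*} [Fintype ι] {ρ σ : M → ℝ}
    {x : ι → M → ℝ} {m : ℕ} (hρ : ContMDiff J 𝓘(ℝ, ℝ) ∞ ρ) (hσ : ContMDiff J 𝓘(ℝ, ℝ) ∞ σ)
    (hx : ∀ i, ContMDiff J 𝓘(ℝ, ℝ) ∞ (x i)) (h0 : m ≠ 0 → ∀ i p, x i p ≠ 0)
    (h : ∀ p, σ p = ρ p * Real.exp (m * ∑ i, Real.log (x i p))) (p : M) (hp : ρ p ≠ 0)
    (β : TangentSpace J p [⋀^Fin 1]→L[ℝ] ℝ) :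
    (σ p)⁻¹ * b.pairing p (extD J (funForm J σ) p) β =
      (ρ p)⁻¹ * b.pairing p (extD J (funForm J ρ) p) β +
        m * ∑ i, (x i p)⁻¹ * b.pairing p (extD J (funForm J (x i)) p) β := by
  rw [extD_mul_exp_sum_log hρ hσ hx h0 h, pairing_smul_left, pairing_add_left, pairing_smul_left,
    pairing_sum_left]
  simp only [pairing_smul_left]
  rw [h p]
  have := (Real.exp_pos (m * ∑ i, Real.log (x i p))).ne'
  field_simp

end Functions

/-! ### Passing between smooth and horizontal forms -/

section Transfer

variable {V : Type*} [NormedAddCommGroup V] [NormedSpace ℝ V] [FiniteDimensional ℝ V]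
  {H : Type*} [TopologicalSpace H] {J : ModelWithCorners ℝ V H} [J.Boundaryless]
  {M : Type*} [TopologicalSpace M] [ChartedSpace H M] [IsManifold J ∞ M]

/-- For a Riemannian metric, all forms are horizontal. -/
def IsRiemannian.horizontalEquiv {b : SymTensor J M} (hb : IsRiemannian b) (k : ℕ) :
    horizontalForms b k ≃ₗ[ℝ] smoothForms J M k :=
  LinearEquiv.ofEq _ _ <| le_antisymm (horizontalForms_le b k) fun _ h => ⟨h, hb.isHorizontal _⟩

/-- An operator on smooth forms, as an operator on horizontal forms. -/
def IsRiemannian.onHorizontal {b : SymTensor J M} (hb : IsRiemannian b) {k l : ℕ}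
    (D : smoothForms J M k →ₗ[ℝ] smoothForms J M l) : horizontalForms b k →ₗ[ℝ] horizontalForms b l :=
  (hb.horizontalEquiv l).symm.toLinearMap ∘ₗ D ∘ₗ (hb.horizontalEquiv k).toLinearMap

theorem IsRiemannian.hodgeLaplacian_onHorizontal {b : SymTensor J M} (hb : IsRiemannian b)
    (d : ∀ k, smoothForms J M k →ₗ[ℝ] smoothForms J M (k + 1))
    (δ : ∀ k, smoothForms J M (k + 1) →ₗ[ℝ] smoothForms J M k) (k : ℕ) :
    hodgeLaplacian (fun k => hb.onHorizontal (d k)) (fun k => hb.onHorizontal (δ k)) k =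
      hb.onHorizontal (hodgeLaplacian d δ k) := by
  cases k <;> rfl

variable [MeasurableSpace M]

theorem IsRiemannian.isFormalAdjoint_onHorizontal {b : SymTensor J M} (hb : IsRiemannian b)
    {μ : Measure M} {k l : ℕ} {D : smoothForms J M k →ₗ[ℝ] smoothForms J M l}
    {D' : smoothForms J M l →ₗ[ℝ] smoothForms J M k} (h : IsFormalAdjoint b μ D D') :
    IsFormalAdjoint b μ (hb.onHorizontal D) (hb.onHorizontal D') :=
  fun α β hs => h (toSmooth b k α) (toSmooth b l β) hs

theorem IsRiemannian.eq_onHorizontal_of_isFormalAdjoint [MeasurableSpace V] [BorelSpace V]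
    {ν : Measure V} [ν.IsAddHaarMeasure] [T2Space M] [BorelSpace M] {b : SymTensor J M}
    (hb : IsRiemannian b) {μ : Measure M} {w : M → V → ℝ} (hμ : HasSmoothDensity ν J μ w) {k l : ℕ}
    {D : smoothForms J M k →ₗ[ℝ] smoothForms J M l} {δ : smoothForms J M l →ₗ[ℝ] smoothForms J M k}
    (h : IsFormalAdjoint b μ D δ) {δ' : horizontalForms b l →ₗ[ℝ] horizontalForms b k}
    (h' : IsFormalAdjoint b μ (hb.onHorizontal D) δ') : δ' = hb.onHorizontal δ := by
  have h1 : (hb.horizontalEquiv k).toLinearMap ∘ₗ δ' ∘ₗ (hb.horizontalEquiv l).symm.toLinearMap = δ :=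
    isFormalAdjoint_unique hb hμ h fun α β hs =>
      h' ((hb.horizontalEquiv k).symm α) ((hb.horizontalEquiv l).symm β) hs
  rw [← h1]
  rfl

end Transfer

/-! ### Trivial factors -/

section ZeroProjection

variable {V : Type*} [NormedAddCommGroup V] [NormedSpace ℝ V] [FiniteDimensional ℝ V]
  {H : Type*} [TopologicalSpace H] {J : ModelWithCorners ℝ V H} [J.Boundaryless]
  {M : Type*} [TopologicalSpace M] [ChartedSpace H M] [IsManifold J ∞ M]

/-- Needed for zero-dimensional groups: the group Laplacians vanish, so their coefficients `xᵢ⁻²`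
are harmless even at zeros of `xᵢ`. -/
theorem hodgeLaplacian_smoothD_zero {P : V →L[ℝ] V} (hP : CommutesWithCharts J M P) (h0 : P = 0)
    (δ : ∀ k, smoothForms J M (k + 1) →ₗ[ℝ] smoothForms J M k) (k : ℕ) :
    hodgeLaplacian (smoothD hP) δ k = 0 := by
  have hd (l) : smoothD hP l = 0 := by
    refine LinearMap.ext fun η => Subtype.ext (funext fun p => ?_)
    change extDAlong J P _ p = 0
    have h1 : ContinuousAlternatingMap.alternatizeUncurryFin
        (0 : V →L[ℝ] V [⋀^Fin l]→L[ℝ] ℝ) = 0 := by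
      ext v
      simp [ContinuousAlternatingMap.alternatizeUncurryFin_apply]
    rw [extDAlong, h0, ContinuousLinearMap.comp_zero, h1]
    rfl
  cases k <;> simp [hodgeLaplacian, hd]

end ZeroProjection

/-! ### The proposition for general warped metrics -/

section WarpedRemainder

variable {V : Type*} [NormedAddCommGroup V] [NormedSpace ℝ V] [FiniteDimensional ℝ V]
  [MeasurableSpace V] [BorelSpace V] {ν : Measure V} [ν.IsAddHaarMeasure]
  {H : Type*} [TopologicalSpace H] {J : ModelWithCorners ℝ V H} [J.Boundaryless]
  {M : Type*} [TopologicalSpace M] [ChartedSpace H M] [IsManifold J ∞ M] [T2Space M]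
  [MeasurableSpace M] [BorelSpace M]
  {b b₀ : SymTensor J M} {μ μ₀ : Measure M} {w w₀ : M → V → ℝ}

theorem isDiffOpOrderLEOne_remainder {ι : Type*} [Fintype ι] {P : ι → V →L[ℝ] V}
    {t : ι → C^∞⟮J, M; ℝ⟯} (hw : IsWarped b b₀ P t) (hb : IsRiemannian b) (hb₀ : IsRiemannian b₀)
    (hμ : HasSmoothDensity ν J μ w) (hμ₀ : HasSmoothDensity ν J μ₀ w₀) (k : ℕ) :
    IsDiffOpOrderLEOne b (hb.onHorizontal (remainder hw hb hb₀ hμ hμ₀ k)) := by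
  intro f h η
  refine Subtype.ext (funext fun p => ?_)
  ext v
  exact remainder_doubleComm hw hb hb₀ hμ hμ₀ f h (toSmooth _ k η) p v

/-- The decomposition holds by the definition of the remainder. The alternative in `hc` allows a
coefficient other than the inverse weight on factors that contribute nothing. -/
theorem hodgeLaplacian_eq_add_remainder {κ : Type*} [Fintype κ] {P : Option κ → V →L[ℝ] V}
    {t : Option κ → C^∞⟮J, M; ℝ⟯} (hw : IsWarped b b₀ P t) (hb : IsRiemannian b)
    (hb₀ : IsRiemannian b₀) (hμ : HasSmoothDensity ν J μ w) (hμ₀ : HasSmoothDensity ν J μ₀ w₀)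
    (k : ℕ) (η : smoothForms J M k) (p : M) (h1 : t none p = 1) (c : κ → ℝ)
    (hc : ∀ i, c i = (t (some i) p)⁻¹ ∨ P (some i) = 0) :
    (hodgeLaplacian (smoothD commutesWithCharts_id) (smoothCodiff hb hμ commutesWithCharts_id) k η :
        FormField J M k) p =
      (hodgeLaplacian (smoothD (hw.comm none)) (smoothCodiff hb₀ hμ₀ (hw.comm none)) k η :
        FormField J M k) p +
      ∑ i, c i • (hodgeLaplacian (smoothD (hw.comm (some i)))
        (smoothCodiff hb₀ hμ₀ (hw.comm (some i))) k η : FormField J M k) p +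
      (remainder hw hb hb₀ hμ hμ₀ k η : FormField J M k) p := by
  ext v
  have h2 := remainder_apply hw hb hb₀ hμ hμ₀ k η p v
  have h3 (i : κ) : (t (some i) p)⁻¹ * (hodgeLaplacian (smoothD (hw.comm (some i)))
        (smoothCodiff hb₀ hμ₀ (hw.comm (some i))) k η : FormField J M k) p v =
      c i * (hodgeLaplacian (smoothD (hw.comm (some i)))
        (smoothCodiff hb₀ hμ₀ (hw.comm (some i))) k η : FormField J M k) p v := by
    rcases hc i with h | h
    · rw [h]
    · rw [hodgeLaplacian_smoothD_zero (hw.comm (some i)) h]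
      exact (mul_zero _).trans (mul_zero _).symm
  rw [Fintype.sum_option, h1, inv_one, one_mul, Finset.sum_congr rfl fun i _ => h3 i] at h2
  simp only [ContinuousAlternatingMap.add_apply, ContinuousAlternatingMap.sum_apply,
    ContinuousAlternatingMap.smul_apply, smul_eq_mul]
  rw [h2]
  ring

theorem remainder_zeroForm_of_log {ι κ : Type*} [Fintype ι] [Fintype κ] {P : ι → V →L[ℝ] V}
    {t : ι → C^∞⟮J, M; ℝ⟯} (hw : IsWarped b b₀ P t) (hb : IsRiemannian b) (hb₀ : IsRiemannian b₀)
    (hμ : HasSmoothDensity ν J μ w) (hμ₀ : HasSmoothDensity ν J μ₀ w₀) {ρ σ : C^∞⟮J, M; ℝ⟯}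
    {x : κ → M → ℝ} {m : ℕ} (hρ : ∀ p, 0 < ρ p)
    (hx : ∀ i, ContMDiff J 𝓘(ℝ, ℝ) ∞ (x i)) (h0 : m ≠ 0 → ∀ i p, x i p ≠ 0)
    (h : ∀ p, σ p = ρ p * Real.exp (m * ∑ i, Real.log (x i p)))
    (hww : ∀ p₀, ∀ y ∈ (extChartAt J p₀).target,
      w p₀ y = σ ((extChartAt J p₀).symm y) * w₀ p₀ y) (η : smoothForms J M 0) (p : M) :
    (remainder hw hb hb₀ hμ hμ₀ 0 η : FormField J M 0) p = funForm J (fun q =>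
      -((ρ q)⁻¹ * b.pairing q (extD J (funForm J fun y => ρ y) q) (extD J (η : FormField J M 0) q))
      - (m : ℝ) * ∑ i, (x i q)⁻¹ *
        b.pairing q (extD J (funForm J fun y => x i y) q) (extD J (η : FormField J M 0) q)) p := by
  ext v
  rw [remainder_zeroForm hw hb hb₀ hμ hμ₀ σ
    (fun p => by rw [h p]; exact mul_pos (hρ p) (Real.exp_pos _)) hww
    (isSmoothForm_funForm σ.contMDiff),
    pairing_extD_mul_exp_sum_log b ρ.contMDiff σ.contMDiff hx h0 h p (hρ p).ne']
  exact neg_add' _ _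

/-- All analysis is independent of spheres and groups; the local model enters only through the
weights `t`, the functions `x` and the relative density `σ`. -/
theorem exists_hodge_decomposition {κ : Type*} [Fintype κ] {P : Option κ → V →L[ℝ] V}
    {t : Option κ → C^∞⟮J, M; ℝ⟯} (hw : IsWarped b b₀ P t) (hb : IsRiemannian b)
    (hb₀ : IsRiemannian b₀) (hμ : HasSmoothDensity ν J μ w) (hμ₀ : HasSmoothDensity ν J μ₀ w₀)
    (ht : ∀ p, t none p = 1) {c : M → κ → ℝ}
    (hc : ∀ p i, c p i = (t (some i) p)⁻¹ ∨ P (some i) = 0) {ρ σ : C^∞⟮J, M; ℝ⟯}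
    {x : κ → M → ℝ} {m : ℕ} (hρ : ∀ p, 0 < ρ p)
    (hx : ∀ i, ContMDiff J 𝓘(ℝ, ℝ) ∞ (x i)) (h0 : m ≠ 0 → ∀ i p, x i p ≠ 0)
    (h : ∀ p, σ p = ρ p * Real.exp (m * ∑ i, Real.log (x i p)))
    (hww : ∀ p₀, ∀ y ∈ (extChartAt J p₀).target,
      w p₀ y = σ ((extChartAt J p₀).symm y) * w₀ p₀ y) :
    ∃ (d : ∀ k, horizontalForms b k →ₗ[ℝ] horizontalForms b (k + 1))
      (δ : ∀ k, horizontalForms b (k + 1) →ₗ[ℝ] horizontalForms b k),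
      (∀ k (η : horizontalForms b k),
        (d k η : FormField J M (k + 1)) = extD J (η : FormField J M k)) ∧
      (∀ k, IsFormalAdjoint b μ (d k) (δ k)) ∧
      (∀ k δ', IsFormalAdjoint b μ (d k) δ' → δ' = δ k) ∧
      (∀ k, IsFormalAdjoint b μ (hodgeLaplacian d δ k) (hodgeLaplacian d δ k)) ∧
      ∃ (dF : Option κ → ∀ k, smoothForms J M k →ₗ[ℝ] smoothForms J M (k + 1))
        (δF : Option κ → ∀ k, smoothForms J M (k + 1) →ₗ[ℝ] smoothForms J M k),
        (∀ a k (η : smoothForms J M k),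
          (dF a k η : FormField J M (k + 1)) = extDAlong J (P a) (η : FormField J M k)) ∧
        (∀ a k, IsFormalAdjoint b₀ μ₀ (dF a k) (δF a k)) ∧
        (∀ a k δ', IsFormalAdjoint b₀ μ₀ (dF a k) δ' → δ' = δF a k) ∧
        ∃ L : ∀ k, horizontalForms b k →ₗ[ℝ] horizontalForms b k,
          (∀ k (η : horizontalForms b k) (p : M),
            (hodgeLaplacian d δ k η : FormField J M k) p =
              (hodgeLaplacian (dF none) (δF none) k (toSmooth b k η) : FormField J M k) p +
              ∑ i : κ, c p i •
                (hodgeLaplacian (dF (some i)) (δF (some i)) k (toSmooth b k η) :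
                  FormField J M k) p +
              (L k η : FormField J M k) p) ∧
          (∀ k, IsDiffOpOrderLEOne b (L k)) ∧
          (∀ (η : horizontalForms b 0) (p : M),
            (L 0 η : FormField J M 0) p = funForm J (fun q =>
              -((ρ q)⁻¹ * b.pairing q (extD J (funForm J fun y => ρ y) q)
                  (extD J (η : FormField J M 0) q))
              - (m : ℝ) * ∑ i, (x i q)⁻¹ * b.pairing q (extD J (funForm J fun y => x i y) q)
                  (extD J (η : FormField J M 0) q)) p) := by
  refine ⟨fun k => hb.onHorizontal (smoothD commutesWithCharts_id k),
    fun k => hb.onHorizontal (smoothCodiff hb hμ commutesWithCharts_id k), fun k η => rfl,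
    fun k => hb.isFormalAdjoint_onHorizontal (isFormalAdjoint_smoothD hb hμ _ k),
    fun k δ' h => hb.eq_onHorizontal_of_isFormalAdjoint hμ (isFormalAdjoint_smoothD hb hμ _ k) h,
    fun k => ?_, fun a k => smoothD (hw.comm a) k, fun a k => smoothCodiff hb₀ hμ₀ (hw.comm a) k,
    fun a k η => rfl, fun a k => isFormalAdjoint_smoothD hb₀ hμ₀ _ k,
    fun a k δ' h => isFormalAdjoint_unique hb₀ hμ₀ (isFormalAdjoint_smoothD hb₀ hμ₀ _ k) h,
    fun k => hb.onHorizontal (remainder hw hb hb₀ hμ hμ₀ k), fun k η p => ?_,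
    isDiffOpOrderLEOne_remainder hw hb hb₀ hμ hμ₀, fun η p => ?_⟩
  · rw [hb.hodgeLaplacian_onHorizontal]
    exact hb.isFormalAdjoint_onHorizontal (isFormalAdjoint_hodgeLaplacian hb hμ _ k)
  · rw [hb.hodgeLaplacian_onHorizontal]
    exact hodgeLaplacian_eq_add_remainder hw hb hb₀ hμ hμ₀ k (toSmooth _ k η) p (ht p) (c p) (hc p)
  · exact remainder_zeroForm_of_log hw hb hb₀ hμ hμ₀ hρ hx h0 h hww (toSmooth _ 0 η) p

end WarpedRemainder

/-! ### The relative density of the local model -/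

section ModelDensity

variable {I : Finset ℕ} {n : ℕ} {E : Type*} [NormedAddCommGroup E] [NormedSpace ℝ E]
  {G : Type*} [TopologicalSpace G] [ChartedSpace E G] [IsManifold 𝓘(ℝ, E) ∞ G]
  [FiniteDimensional ℝ E] [Fact (finrank ℝ (EuclideanSpace ℝ I) = n + 1)]
  {U : TopologicalSpace.Opens (LocalModel I G)}

theorem contMDiff_sphCoord_apply (i : I) :
    ContMDiff (localModel I n E) 𝓘(ℝ, ℝ) ∞ fun p : U => sphCoord U p i :=
  (EuclideanSpace.proj (𝕜 := ℝ) i).contMDiff.comp contMDiff_sphCoord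

variable (n E) in
/-- The density of `ρ vol_g` with respect to the volume of the product metric. -/
def relDensity (hne : Nontrivial E → ∀ (p : U) i, sphCoord U p i ≠ 0)
    (ρ : C^∞⟮localModel I n E, U; ℝ⟯) : C^∞⟮localModel I n E, U; ℝ⟯ :=
  ⟨fun p => ρ p * Real.exp (finrank ℝ E * ∑ i, Real.log (sphCoord U p i)), by
    refine ρ.contMDiff.mul (Real.contDiff_exp.contMDiff.comp ?_)
    rcases subsingleton_or_nontrivial E with h | h
    · simp only [finrank_zero_of_subsingleton, Nat.cast_zero, zero_mul]
      exact contMDiff_const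
    · refine contMDiff_const.mul (ContMDiff.sum fun i _ p => ?_)
      exact (Real.contDiffAt_log.2 (hne h p i)).contMDiffAt.comp p
        (contMDiff_sphCoord_apply (n := n) (E := E) i).contMDiffAt⟩

theorem factorProj_some_of_subsingleton [Subsingleton E] (i : I) : factorProj I n E (some i) = 0 := by
  refine ContinuousLinearMap.ext fun v => ?_
  rw [factorProj_some, Subsingleton.elim (v.2 i) 0, Pi.single_zero]
  rfl

end ModelDensity

end SphMilnor

end

/-! ### The proposition for the local model -/

open SphMilnor in
theorem mainTheorem9
    (I : Finset ℕ) (n : ℕ) [Fact (finrank ℝ (EuclideanSpace ℝ I) = n + 1)]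
    {E : Type*} [NormedAddCommGroup E] [NormedSpace ℝ E] [FiniteDimensional ℝ E]
    {G : Type*} [TopologicalSpace G] [T2Space G] [ChartedSpace E G] [Group G]
    [LieGroup 𝓘(ℝ, E) ∞ G]
    -- a right-invariant Riemannian metric on `G`
    (gG : Bundle.ContMDiffRiemannianMetric 𝓘(ℝ, E) ∞ E (fun a : G => TangentSpace 𝓘(ℝ, E) a))
    (_hG : ∀ (a h : G) (v w : TangentSpace 𝓘(ℝ, E) a),
      gG.inner (a * h) (mfderiv 𝓘(ℝ, E) 𝓘(ℝ, E) (fun y : G => y * h) a v)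
        (mfderiv 𝓘(ℝ, E) 𝓘(ℝ, E) (fun y : G => y * h) a w) = gG.inner a v w)
    -- an open part `U` of `S_I × G^I` with its warped metric `g` and its product metric `g₀`
    (U : TopologicalSpace.Opens (LocalModel I G)) [MeasurableSpace U] [BorelSpace U]
    (g g₀ : SymTensor (localModel I n E) U)
    (_hg : g = warpedMetric U gG) (_hg₀ : g₀ = productMetric U gG)
    -- on `U`, `ℋ` has finite rank and `ḡ` is strongly non-degenerate
    (_hrank : g.HasFiniteRank) (_hstrong : g.StronglyNondegenerate)
    -- the Riemannian volumes of `g` and `g₀`, and the chosen density `μ = ρ vol`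
    (vol vol₀ μ : Measure U) (_hvol : g.IsVolume vol) (_hvol₀ : g₀.IsVolume vol₀)
    (ρ : C^∞⟮localModel I n E, U; ℝ⟯) (_hρ : ∀ p, 0 < ρ p)
    (_hμ : μ = vol.withDensity fun p => ENNReal.ofReal (ρ p)) :
    ∃ (d : ∀ k, horizontalForms g k →ₗ[ℝ] horizontalForms g (k + 1))
      (δ : ∀ k, horizontalForms g (k + 1) →ₗ[ℝ] horizontalForms g k),
      -- the exterior derivative acts on horizontal forms
      (∀ k (η : horizontalForms g k),
        (d k η : FormField (localModel I n E) U (k + 1)) =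
          extD (localModel I n E) (η : FormField (localModel I n E) U k)) ∧
      -- it has exactly one formal adjoint
      (∀ k, IsFormalAdjoint g μ (d k) (δ k)) ∧
      (∀ k δ', IsFormalAdjoint g μ (d k) δ' → δ' = δ k) ∧
      -- the Laplacian is formally self-adjoint
      (∀ k, IsFormalAdjoint g μ (hodgeLaplacian d δ k) (hodgeLaplacian d δ k)) ∧
      -- the exterior derivatives along the factors and their formal adjoints (product metric)
      ∃ (dF : Option I → ∀ k, smoothForms (localModel I n E) U k →ₗ[ℝ]
            smoothForms (localModel I n E) U (k + 1))
        (δF : Option I → ∀ k, smoothForms (localModel I n E) U (k + 1) →ₗ[ℝ]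
            smoothForms (localModel I n E) U k),
        (∀ a k (η : smoothForms (localModel I n E) U k),
          (dF a k η : FormField (localModel I n E) U (k + 1)) =
            extDAlong (localModel I n E) (factorProj I n E a)
              (η : FormField (localModel I n E) U k)) ∧
        (∀ a k, IsFormalAdjoint g₀ vol₀ (dF a k) (δF a k)) ∧
        (∀ a k δ', IsFormalAdjoint g₀ vol₀ (dF a k) δ' → δ' = δF a k) ∧
        -- the decomposition `Δ = Δ_{S_I} + ∑ᵢ xᵢ⁻² Δ_{G,i} + L`
        ∃ L : ∀ k, horizontalForms g k →ₗ[ℝ] horizontalForms g k,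
          (∀ k (η : horizontalForms g k) (p : U),
            (hodgeLaplacian d δ k η : FormField (localModel I n E) U k) p =
              (hodgeLaplacian (dF none) (δF none) k (toSmooth g k η) :
                FormField (localModel I n E) U k) p +
              ∑ i : I, (sphCoord U p i ^ 2)⁻¹ •
                (hodgeLaplacian (dF (some i)) (δF (some i)) k (toSmooth g k η) :
                  FormField (localModel I n E) U k) p +
              (L k η : FormField (localModel I n E) U k) p) ∧
          (∀ k, IsDiffOpOrderLEOne g (L k)) ∧
          -- on functions, `L f = -⟨d log ρ, df⟩ - dim G · ∑ᵢ xᵢ⁻¹ ⟨dxᵢ, df⟩`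
          (∀ (η : horizontalForms g 0) (p : U),
            (L 0 η : FormField (localModel I n E) U 0) p =
              funForm (localModel I n E) (fun q : U =>
                -((ρ q)⁻¹ * g.pairing q
                    (extD (localModel I n E) (funForm (localModel I n E) fun y => ρ y) q)
                    (extD (localModel I n E) (η : FormField (localModel I n E) U 0) q))
                - (finrank ℝ E : ℝ) * ∑ i : I, (sphCoord U q i)⁻¹ * g.pairing q
                    (extD (localModel I n E)
                      (funForm (localModel I n E) fun y : U => sphCoord U y i) q)
                    (extD (localModel I n E) (η : FormField (localModel I n E) U 0) q)) p) := by
  subst _hg _hg₀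
  let _ : MeasurableSpace (EuclideanSpace ℝ (Fin n) × (I → E)) := borel _
  have : BorelSpace (EuclideanSpace ℝ (Fin n) × (I → E)) := ⟨rfl⟩
  have hne : Nontrivial E → ∀ (p : U) i, sphCoord U p i ≠ 0 :=
    fun _ => sphCoord_ne_zero_of_hasFiniteRank gG _hrank
  have hw := isWarped_warpedMetric (n := n) gG hne
  have hb₀ := isRiemannian_productMetric (n := n) (U := U) gG
  have hb := hw.isRiemannian hb₀
  have hμ₀ := hb₀.hasSmoothDensity _hvol₀
  have hμ := (hb.hasSmoothDensity _hvol).withDensity ρ _hρ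
  rw [← _hμ] at hμ
  -- The density `σ` combines `ρ` with the ratio of the two Riemannian volumes; with `m = dim G` it
  -- has exactly the exponential form required. The remaining goals compare coefficients, treating a
  -- discrete group separately, and identify the density.
  refine exists_hodge_decomposition hw hb hb₀ hμ hμ₀ modelWeight_none (fun p i => ?_) _hρ
    contMDiff_sphCoord_apply (fun hm i p => ?_) (σ := relDensity n E hne ρ) (fun _ => rfl)
    fun p₀ y hy => ?_
  · rcases subsingleton_or_nontrivial E with hE | hE
    · exact Or.inr (factorProj_some_of_subsingleton i)
    · exact Or.inl (by rw [modelWeight_some])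
  · have : Nontrivial E := Module.nontrivial_of_finrank_pos (R := ℝ) (Nat.pos_of_ne_zero hm)
    exact hne this p i
  · rw [volDensity_warpedMetric gG hne hy, ← mul_assoc]
    rfl
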